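/- Let $M$ be a nonempty compact smooth manifold without boundary, of dimension $n\ge 2$, and let $g$ be a smooth Riemannian metric on $M$ with Levi-Civita connection $\nabla$. For a smooth symmetric two-tensor field $\varphi\in C^\infty(S^2M)$ let $\delta\varphi$ be its divergence, $(\delta\varphi)(Y)=-\sum_{i=1}^n(\nabla_{X_i}\varphi)(X_i,Y)$ for a local $g$-orthonormal frame $X_1,\dots,X_n$, and let $$\mathcal H_g=\{\varphi\in C^\infty(S^2M) : \delta\varphi=-\tfrac12\, d(\mathrm{trace}_g\,\varphi)\}$$ be the vector space of harmonic tensors of $(M,g)$. A smooth map $f:(M,g)\to(N,h)$ of Riemannian manifolds is called harmonic if, for every relatively compact open $U\subseteq M$, it is a critical point of the energy $E_U(f)=\frac12\int_U \mathrm{trace}_g(f^*h)\,dv_g$ with respect to all smooth variations of $f$ with compact support in $U$. Then: 1. For every $\varphi\in\mathcal H_g$ there is $\varepsilon>0$ such that for every $t\in(-\varepsilon,\varepsilon)$ the tensor field $g(t)=g+t\varphi$ is a Riemannian metric on $M$ and the identity map $\mathrm{id}_M:(M,g)\to(M,g(t))$ is harmonic. 2. The harmonic identity maps obtained in this way form an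 infinite-dimensional family: the vector space $\mathcal H_g$ is infinite-dimensional, and the Riemannian metrics of the form $g+t\varphi$ with $\varphi\in\mathcal H_g$, $t\in\mathbb R$, for which $\mathrm{id}_M:(M,g)\to(M,g+t\varphi)$ is harmonic span an infinite-dimensional subspace of the space of smooth two-tensor fields on $M$. -/

import Mathlib

open Bundle Manifold MeasureTheory
open scoped ContDiff

noncomputable section

namespace HarmId

/-- The model space `ℝⁿ` with its Euclidean norm. -/
abbrev Model (n : ℕ) : Type := EuclideanSpace ℝ (Fin n)

/-- Smooth Riemannian metrics on a smooth `n`-manifold (without boundary) `M`. -/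
abbrev Metric (n : ℕ) (M : Type*) [TopologicalSpace M] [ChartedSpace (Model n) M]
    [IsManifold (𝓡 n) ∞ M] : Type _ :=
  ContMDiffRiemannianMetric (𝓡 n) ∞ (Model n) (TangentSpace (𝓡 n) : M → Type _)

/-- Smooth covariant two-tensor fields on `M`, that is smooth sections of `T*M ⊗ T*M`. -/
abbrev TwoTensor (n : ℕ) (M : Type*) [TopologicalSpace M] [ChartedSpace (Model n) M]
    [IsManifold (𝓡 n) ∞ M] : Type _ :=
  ContMDiffSection (𝓡 n) (Model n →L[ℝ] Model n →L[ℝ] ℝ) ∞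
    (fun x : M ↦ TangentSpace (𝓡 n) x →L[ℝ] TangentSpace (𝓡 n) x →L[ℝ] ℝ)

set_option synthInstance.maxHeartbeats 400000 in
/-- Shortcut instance. -/
instance instAddCommGroupTwoTensor (n : ℕ) (M : Type*) [TopologicalSpace M]
    [ChartedSpace (Model n) M] [IsManifold (𝓡 n) ∞ M] : AddCommGroup (TwoTensor n M) :=
  ContMDiffSection.instAddCommGroup

set_option synthInstance.maxHeartbeats 400000 in
/-- Shortcut instance. -/
instance instModuleTwoTensor (n : ℕ) (M : Type*) [TopologicalSpace M]
    [ChartedSpace (Model n) M] [IsManifold (𝓡 n) ∞ M] : Module ℝ (TwoTensor n M) :=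
  ContMDiffSection.instModule

/-- Shortcut instance. -/
instance instSMulTwoTensor (n : ℕ) (M : Type*) [TopologicalSpace M]
    [ChartedSpace (Model n) M] [IsManifold (𝓡 n) ∞ M] : SMul ℝ (TwoTensor n M) :=
  (instModuleTwoTensor n M).toSMul

/-- Shortcut instance. -/
instance instAddTwoTensor (n : ℕ) (M : Type*) [TopologicalSpace M]
    [ChartedSpace (Model n) M] [IsManifold (𝓡 n) ∞ M] : Add (TwoTensor n M) :=
  (instAddCommGroupTwoTensor n M).toAdd

/-- Shortcut instance. -/
instance instZeroTwoTensor (n : ℕ) (M : Type*) [TopologicalSpace M]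
    [ChartedSpace (Model n) M] [IsManifold (𝓡 n) ∞ M] : Zero (TwoTensor n M) :=
  (instAddCommGroupTwoTensor n M).toZero

section Coordinates

variable {n : ℕ} {M : Type*} [TopologicalSpace M] [ChartedSpace (Model n) M]

/-- A (not necessarily smooth) field of real functions of two tangent vectors. -/
abbrev Form2 (n : ℕ) (M : Type*) [TopologicalSpace M] [ChartedSpace (Model n) M] : Type _ :=
  (x : M) → TangentSpace (𝓡 n) x → TangentSpace (𝓡 n) x → ℝ

/-- The coordinate vector `∂ᵢ` of the chart around `c`, at the point with coordinates `y`. -/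
def coordVec (c : M) (y : Model n) (i : Fin n) :
    TangentSpace (𝓡 n) ((extChartAt (𝓡 n) c).symm y) :=
  mfderiv 𝓘(ℝ, Model n) (𝓡 n) (extChartAt (𝓡 n) c).symm y (EuclideanSpace.single i (1 : ℝ))

/-- The matrix `Tᵢⱼ = T(∂ᵢ, ∂ⱼ)` of components of `T` in the chart around `c`, at the point with
coordinates `y`. -/
def comp (T : Form2 n M) (c : M) (y : Model n) : Matrix (Fin n) (Fin n) ℝ :=
  Matrix.of fun i j ↦ T ((extChartAt (𝓡 n) c).symm y) (coordVec c y i) (coordVec c y j)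

/-- The partial derivative `∂ᵢ u` of a function on `ℝⁿ`. -/
def pd (i : Fin n) (u : Model n → ℝ) (y : Model n) : ℝ :=
  fderiv ℝ u y (EuclideanSpace.single i (1 : ℝ))

variable [IsManifold (𝓡 n) ∞ M]

/-- A metric as a field of functions of two tangent vectors. -/
def Metric.form (g : Metric n M) : Form2 n M := fun x v w ↦ g.inner x v w

/-- A two-tensor as a field of functions of two tangent vectors. -/
def TwoTensor.form (φ : TwoTensor n M) : Form2 n M := fun x v w ↦ φ x v w

/-- The components `gᵢⱼ` of the metric. -/
def gram (g : Metric n M) (c : M) (y : Model n) : Matrix (Fin n) (Fin n) ℝ :=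
  comp (Metric.form g) c y

/-- The trace `trace_g T = ∑ gⁱʲ Tᵢⱼ`, in the chart around `c`. -/
def coordTrace (g : Metric n M) (T : Form2 n M) (c : M) (y : Model n) : ℝ :=
  ∑ i, ∑ j, (gram g c y)⁻¹ i j * comp T c y i j

/-- The Christoffel symbols of the Levi-Civita connection of `g`:
`Γᵏᵢⱼ = ½ ∑ₗ gᵏˡ (∂ᵢ gⱼₗ + ∂ⱼ gᵢₗ - ∂ₗ gᵢⱼ)`. -/
def christoffel (g : Metric n M) (c : M) (k i j : Fin n) (y : Model n) : ℝ :=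
  (1 / 2) * ∑ l, (gram g c y)⁻¹ k l *
    (pd i (fun z ↦ gram g c z j l) y + pd j (fun z ↦ gram g c z i l) y
      - pd l (fun z ↦ gram g c z i j) y)

/-- The components `(∇ₖ T)ᵢⱼ = ∂ₖ Tᵢⱼ - ∑ₗ Γˡₖᵢ Tₗⱼ - ∑ₗ Γˡₖⱼ Tᵢₗ` of the Levi-Civita covariant
derivative of `T`. -/
def covDeriv (g : Metric n M) (T : Form2 n M) (c : M) (k i j : Fin n) (y : Model n) : ℝ :=
  pd k (fun z ↦ comp T c z i j) y
    - ∑ l, christoffel g c l k i y * comp T c y l j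
    - ∑ l, christoffel g c l k j y * comp T c y i l

/-- The components `(δT)ⱼ = - ∑ gᵏⁱ (∇ₖ T)ᵢⱼ` of the divergence of `T`. -/
def divergence (g : Metric n M) (T : Form2 n M) (c : M) (j : Fin n) (y : Model n) : ℝ :=
  - ∑ k, ∑ i, (gram g c y)⁻¹ k i * covDeriv g T c k i j y

/-- The condition `δφ = -½ d(trace_g φ)` for a symmetric two-tensor field, in all charts
of the atlas. -/
def IsHarmonicTensor (g : Metric n M) (φ : TwoTensor n M) : Prop :=
  (∀ (x : M) (v w : TangentSpace (𝓡 n) x), φ x v w = φ x w v) ∧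
  ∀ (c : M), ∀ y ∈ (extChartAt (𝓡 n) c).target, ∀ j : Fin n,
    divergence g (TwoTensor.form φ) c j y
      = -(1 / 2) * pd j (coordTrace g (TwoTensor.form φ) c) y

end Coordinates

section Linearity

variable {n : ℕ} {M : Type*} [TopologicalSpace M] [ChartedSpace (Model n) M]
  [IsManifold (𝓡 n) ∞ M]

theorem contMDiffAt_coordVec {c : M} {y : Model n} (hy : y ∈ (extChartAt (𝓡 n) c).target)
    (i : Fin n) :
    ContMDiffAt 𝓘(ℝ, Model n) (𝓡 n).tangent ∞
      (fun z ↦ (⟨(extChartAt (𝓡 n) c).symm z, coordVec c z i⟩ : TangentBundle (𝓡 n) M)) y := by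
  have hopen : IsOpen (extChartAt (𝓡 n) c).target := isOpen_extChartAt_target c
  have h1 := (contMDiffOn_extChartAt_symm (I := 𝓡 n) (n := ∞) c).contMDiffOn_tangentMapWithin
    (m := ∞) le_rfl hopen.uniqueMDiffOn
  have h2 : ContMDiffAt 𝓘(ℝ, Model n) 𝓘(ℝ, Model n).tangent ∞
      (fun z ↦ (⟨z, EuclideanSpace.single i (1 : ℝ)⟩ : TangentBundle 𝓘(ℝ, Model n) (Model n))) y :=
    contMDiffAt_vectorSpace_iff_contDiffAt.mpr contDiffAt_const
  have h3 := ContMDiffWithinAt.comp y (h1 ⟨y, EuclideanSpace.single i (1 : ℝ)⟩ hy)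
    (h2.contMDiffWithinAt (s := (extChartAt (𝓡 n) c).target)) (fun z hz ↦ hz)
  have h4 := h3.contMDiffAt (hopen.mem_nhds hy)
  refine h4.congr_of_eventuallyEq ?_
  filter_upwards [hopen.mem_nhds hy] with z hz
  simp only [Function.comp_apply, tangentMapWithin, mfderivWithin_of_isOpen hopen hz]
  rfl

theorem differentiableAt_comp
    {T : (x : M) → TangentSpace (𝓡 n) x →L[ℝ] TangentSpace (𝓡 n) x →L[ℝ] ℝ}
    (hT : ContMDiff (𝓡 n) ((𝓡 n).prod 𝓘(ℝ, Model n →L[ℝ] Model n →L[ℝ] ℝ)) ∞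
      (fun x ↦ TotalSpace.mk' (Model n →L[ℝ] Model n →L[ℝ] ℝ) x (T x)))
    {c : M} {y : Model n} (hy : y ∈ (extChartAt (𝓡 n) c).target) (i j : Fin n) :
    DifferentiableAt ℝ (fun z ↦ comp (fun x v w ↦ T x v w) c z i j) y := by
  have hs : ContMDiffAt 𝓘(ℝ, Model n) (𝓡 n) ∞ (extChartAt (𝓡 n) c).symm y :=
    (contMDiffOn_extChartAt_symm c).contMDiffAt ((isOpen_extChartAt_target c).mem_nhds hy)
  have h1 := (hT.contMDiffAt (x := (extChartAt (𝓡 n) c).symm y)).comp y hs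
  have : ContMDiffAt 𝓘(ℝ, Model n) ((𝓡 n).prod 𝓘(ℝ, ℝ)) ∞
      (fun z ↦ TotalSpace.mk' ℝ (E := Bundle.Trivial M ℝ) ((extChartAt (𝓡 n) c).symm z)
        (T ((extChartAt (𝓡 n) c).symm z) (coordVec c z i) (coordVec c z j))) y :=
    ContMDiffAt.clm_bundle_apply₂ (F₁ := Model n) (F₂ := Model n) h1
      (contMDiffAt_coordVec hy i) (contMDiffAt_coordVec hy j)
  simp only [contMDiffAt_totalSpace] at this
  exact this.2.contDiffAt.differentiableAt (by simp)

theorem det_gram_ne_zero (g : Metric n M) {c : M} {y : Model n}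
    (hy : y ∈ (extChartAt (𝓡 n) c).target) : (gram g c y).det ≠ 0 := by
  intro h0
  obtain ⟨v, hv0, hv⟩ := Matrix.exists_mulVec_eq_zero_iff.mpr h0
  have hinv := isInvertible_mfderivWithin_extChartAt_symm (I := 𝓡 n) hy
  rw [ModelWithCorners.range_eq_univ, mfderivWithin_univ] at hinv
  set D := mfderiv 𝓘(ℝ, Model n) (𝓡 n) (extChartAt (𝓡 n) c).symm y with hD
  have hsum : D (WithLp.toLp 2 v) = ∑ j, v j • coordVec c y j := by
    have : (WithLp.toLp 2 v : Model n) = ∑ j, v j • EuclideanSpace.single j (1 : ℝ) := by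
      ext k
      simp [Finset.sum_apply, Pi.single_apply]
    have h2 : D (WithLp.toLp 2 v) = D (∑ j, v j • EuclideanSpace.single j (1 : ℝ) : Model n) :=
      congrArg D this
    rw [h2]
    erw [map_sum]
    refine Finset.sum_congr rfl fun j _ ↦ ?_
    erw [map_smul]
    rfl
  have hne : D (WithLp.toLp 2 v) ≠ 0 := by
    intro h
    have h3 : (WithLp.toLp 2 v : Model n) = 0 := hinv.injective (h.trans (map_zero D).symm)
    exact hv0 (by ext k; simpa using congrArg (fun w : Model n ↦ w k) h3)
  have hpos := g.pos _ _ hne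
  rw [hsum] at hpos
  have : g.inner ((extChartAt (𝓡 n) c).symm y) (∑ j, v j • coordVec c y j)
      (∑ j, v j • coordVec c y j) = ∑ i, v i * (gram g c y).mulVec v i := by
    simp only [map_sum, map_smul, _root_.sum_apply, _root_.smul_apply,
      Matrix.mulVec, dotProduct, gram, comp, Metric.form, Matrix.of_apply, smul_eq_mul,
      Finset.mul_sum]
    rw [Finset.sum_comm]
    refine Finset.sum_congr rfl fun i _ ↦ Finset.sum_congr rfl fun j _ ↦ ?_
    ring
  rw [this, hv] at hpos
  simp at hpos

theorem differentiableAt_det {ι : Type*} [Fintype ι] [DecidableEq ι]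
    {A : Model n → Matrix ι ι ℝ} {y : Model n}
    (hA : ∀ i j, DifferentiableAt ℝ (fun z ↦ A z i j) y) :
    DifferentiableAt ℝ (fun z ↦ (A z).det) y := by
  simp only [Matrix.det_apply]
  refine DifferentiableAt.fun_sum fun σ _ ↦ DifferentiableAt.const_smul ?_ _
  exact (HasFDerivAt.finsetProd (u := Finset.univ)
    fun i _ ↦ (hA (σ i) i).hasFDerivAt).differentiableAt

theorem differentiableAt_inv {A : Model n → Matrix (Fin n) (Fin n) ℝ} {y : Model n}
    (hA : ∀ i j, DifferentiableAt ℝ (fun z ↦ A z i j) y) (h : (A y).det ≠ 0) (i j : Fin n) :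
    DifferentiableAt ℝ (fun z ↦ (A z)⁻¹ i j) y := by
  simp only [Matrix.inv_def, Matrix.smul_apply, Ring.inverse_eq_inv', smul_eq_mul,
    Matrix.adjugate_apply]
  refine ((differentiableAt_det hA).inv h).mul (differentiableAt_det fun k l ↦ ?_)
  by_cases hk : k = j
  · subst hk
    simp
  · simpa [Matrix.updateRow_ne hk] using hA k l

theorem differentiableAt_coordTrace (g : Metric n M) (φ : TwoTensor n M) {c : M} {y : Model n}
    (hy : y ∈ (extChartAt (𝓡 n) c).target) :
    DifferentiableAt ℝ (coordTrace g (TwoTensor.form φ) c) y := by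
  refine DifferentiableAt.fun_sum fun i _ ↦ DifferentiableAt.fun_sum fun j _ ↦ ?_
  exact (differentiableAt_inv (fun k l ↦ differentiableAt_comp g.contMDiff hy k l)
    (det_gram_ne_zero g hy) i j).mul (differentiableAt_comp φ.contMDiff hy i j)

theorem comp_smul_add (a : ℝ) (φ ψ : TwoTensor n M) (c : M) (y : Model n) (i j : Fin n) :
    comp (TwoTensor.form (a • φ + ψ)) c y i j
      = a * comp (TwoTensor.form φ) c y i j + comp (TwoTensor.form ψ) c y i j := rfl

theorem isHarmonicTensor_smul_add {g : Metric n M} {φ ψ : TwoTensor n M} (a : ℝ)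
    (hφ : IsHarmonicTensor g φ) (hψ : IsHarmonicTensor g ψ) : IsHarmonicTensor g (a • φ + ψ) := by
  refine ⟨fun x v w ↦ ?_, fun c y hy j ↦ ?_⟩
  · change a * φ x v w + ψ x v w = a * φ x w v + ψ x w v
    rw [hφ.1, hψ.1]
  · have h1 := hφ.2 c y hy j
    have h2 := hψ.2 c y hy j
    have ht : coordTrace g (TwoTensor.form (a • φ + ψ)) c
        = fun z ↦ a * coordTrace g (TwoTensor.form φ) c z
          + coordTrace g (TwoTensor.form ψ) c z := by
      funext z
      simp only [coordTrace, comp_smul_add, Finset.mul_sum, ← Finset.sum_add_distrib]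
      refine Finset.sum_congr rfl fun i _ ↦ Finset.sum_congr rfl fun j _ ↦ ?_
      ring
    have hpd : ∀ (k : Fin n) (u v : Model n → ℝ), DifferentiableAt ℝ u y →
        DifferentiableAt ℝ v y → pd k (fun z ↦ a * u z + v z) y = a * pd k u y + pd k v y := by
      intro k u v hu hv
      simp only [pd]
      rw [fderiv_fun_add (hu.const_mul a) hv, fderiv_const_mul hu]
      rfl
    have hcov : ∀ k i, covDeriv g (TwoTensor.form (a • φ + ψ)) c k i j y
        = a * covDeriv g (TwoTensor.form φ) c k i j y
          + covDeriv g (TwoTensor.form ψ) c k i j y := by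
      intro k i
      simp only [covDeriv, comp_smul_add]
      have h3 : pd k (fun z ↦ a * comp (TwoTensor.form φ) c z i j
            + comp (TwoTensor.form ψ) c z i j) y
          = a * pd k (fun z ↦ comp (TwoTensor.form φ) c z i j) y
            + pd k (fun z ↦ comp (TwoTensor.form ψ) c z i j) y :=
        hpd k _ _ (differentiableAt_comp φ.contMDiff hy i j)
          (differentiableAt_comp ψ.contMDiff hy i j)
      rw [h3]
      simp only [mul_add, Finset.sum_add_distrib, mul_sub, Finset.mul_sum, mul_left_comm a]
      ring
    have hdiv : divergence g (TwoTensor.form (a • φ + ψ)) c j y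
        = a * divergence g (TwoTensor.form φ) c j y + divergence g (TwoTensor.form ψ) c j y := by
      simp only [divergence, hcov, mul_add, Finset.sum_add_distrib, mul_neg, Finset.mul_sum,
        mul_left_comm a]
      ring
    rw [hdiv, ht, hpd j _ _ (differentiableAt_coordTrace g φ hy)
      (differentiableAt_coordTrace g ψ hy), h1, h2]
    ring

theorem isHarmonicTensor_zero (g : Metric n M) : IsHarmonicTensor g (0 : TwoTensor n M) := by
  have hc : ∀ (c : M) (y : Model n) (i j : Fin n),
      comp (TwoTensor.form (0 : TwoTensor n M)) c y i j = 0 := fun _ _ _ _ ↦ rfl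
  refine ⟨fun _ _ _ ↦ rfl, fun c y _ j ↦ ?_⟩
  have ht : coordTrace g (TwoTensor.form (0 : TwoTensor n M)) c = fun _ ↦ 0 := by
    funext z
    simp [coordTrace, hc]
  simp [divergence, covDeriv, hc, ht, pd]

/-- The vector space `H_g` of harmonic tensors. -/
def harmonicTensors (g : Metric n M) : Submodule ℝ (TwoTensor n M) where
  carrier := {φ | IsHarmonicTensor g φ}
  zero_mem' := isHarmonicTensor_zero g
  add_mem' {φ ψ} hφ hψ := by
    have h := isHarmonicTensor_smul_add 1 hφ hψ
    rwa [one_smul] at h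
  smul_mem' a φ hφ := by
    have h := isHarmonicTensor_smul_add a hφ (isHarmonicTensor_zero g)
    rwa [add_zero] at h

end Linearity

section Energy

variable {n : ℕ} {M : Type*} [TopologicalSpace M] [ChartedSpace (Model n) M]
  [IsManifold (𝓡 n) ∞ M]

/-- The Riemannian volume of the domain of the chart around `c`, as a measure on `M`: the image of
`√(det gᵢⱼ) dy¹ ⋯ dyⁿ` under the inverse of the chart. -/
def chartVolume [MeasurableSpace M] (g : Metric n M) (c : M) : Measure M :=
  ((volume.restrict (extChartAt (𝓡 n) c).target).withDensity
    (fun y ↦ ENNReal.ofReal (Real.sqrt (gram g c y).det))).map (extChartAt (𝓡 n) c).symm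

/-- The Riemannian volume measure `dv_g`: the least measure on `M` that dominates
`√(det gᵢⱼ) dy¹ ⋯ dyⁿ` in every chart. These measures agree where two charts overlap, so this is the
measure that coincides with `√(det gᵢⱼ) dy¹ ⋯ dyⁿ` on the domain of every chart
(if `M` is second countable). -/
def riemannianVolume [MeasurableSpace M] (g : Metric n M) : Measure M :=
  ⨆ c : M, chartVolume g c

variable {m : ℕ} {N : Type*} [TopologicalSpace N] [ChartedSpace (Model m) N]
  [IsManifold (𝓡 m) ∞ N]

/-- The first fundamental form `f^* h` of a map `f : M → (N, h)`. -/
def pullback (h : Metric m N) (f : M → N) : Form2 n M := fun x v w ↦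
  h.inner (f x) (mfderiv (𝓡 n) (𝓡 m) f x v) (mfderiv (𝓡 n) (𝓡 m) f x w)

/-- The energy density `e(f) = trace_g (f^* h)`. The trace at `x` is computed in the chart around
`x`; it does not depend on the chart. -/
def energyDensity (g : Metric n M) (h : Metric m N) (f : M → N) (x : M) : ℝ :=
  coordTrace g (pullback h f) x (extChartAt (𝓡 n) x x)

/-- The energy `E_U(f) = ½ ∫_U e(f) dv_g`. -/
def energyOn [MeasurableSpace M] (g : Metric n M) (h : Metric m N) (U : Set M) (f : M → N) : ℝ :=
  (1 / 2) * ∫ x in U, energyDensity g h f x ∂(riemannianVolume g)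

/-- A smooth map `f : (M, g) → (N, h)` is harmonic if, for every relatively compact open `U ⊆ M`,
it is a critical point of `E_U` with respect to all smooth variations of `f` with compact
support in `U`. -/
def IsHarmonicMap [MeasurableSpace M] (g : Metric n M) (h : Metric m N) (f : M → N) : Prop :=
  ContMDiff (𝓡 n) (𝓡 m) ∞ f ∧
  ∀ (U K : Set M), IsOpen U → IsCompact (closure U) → IsCompact K → K ⊆ U →
  ∀ F : ℝ → M → N,
    ContMDiff (𝓘(ℝ, ℝ).prod (𝓡 n)) (𝓡 m) ∞ (fun p : ℝ × M ↦ F p.1 p.2) →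
    F 0 = f → (∀ s : ℝ, ∀ x ∉ K, F s x = f x) →
    HasDerivAt (fun s : ℝ ↦ energyOn g h U (F s)) 0 0

/-- The metrics on `M`, as elements of the space of two-tensor fields, that are harmonic with
respect to `g`: those metrics `h` for which the identity map `(M, g) → (M, h)` is harmonic. -/
def harmonicMetrics [MeasurableSpace M] (g : Metric n M) : Set (TwoTensor n M) :=
  {T | ∃ h : Metric n M, (∀ x, h.inner x = T x) ∧ IsHarmonicMap g h (id : M → M)}

end Energy

end HarmId

end

/-!
# Harmonic identity maps

The energy density of a map `f : (M, g) → (M, h)` is `½ tr_g (f^* h)`, so the first variation of the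
energy at the identity in the direction of a vector field `V` is `½ ∫ tr_g (L_V h)`. In coordinates
`√(det G) tr_G (L_V h)` is `2 √(det G) ∑ₖ Vₖ defectₖ` plus a divergence, where `defect` is the
one-form `δh + ½ d(tr_g h)` (`sqrt_det_mul_trLie`). By a partition of unity the first variation
vanishes for all `V` as soon as the defect of `h` vanishes (`integral_traceLie`,
`isHarmonicMap_id`). This condition is linear in `h` and `g` itself satisfies it, so it holds for
`g + t φ` with `φ` a harmonic tensor. By compactness `|φ| ≤ C g` (`exists_forall_abs_le`), so
`g + t φ` is positive definite for small `t`.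

Both spaces are infinite-dimensional because every nonempty open set supports a nonzero harmonic
tensor (`exists_harmonicTensor_supported`) and there are infinitely many disjoint nonempty open
sets. For the second space, `φ` is a difference quotient of the metrics `g` and `g + t φ`
(`harmonicTensors_le_span`).

The localized tensors are constructed in coordinates and extended by zero. If `n = 2`, every
conformal multiple `u g` is a harmonic tensor. If `n ≥ 3`, the correction of the trace
`B ↦ B - ½ (tr_g B) g` is bijective, which reduces the problem to compactly supported symmetric `S`
for which `S / √(det G)` is divergence free (`exists_divergence_free`). In Fermi coordinates, where
`∂ᵢ₀` is a unit vector orthogonal to the other coordinate vectors (`exists_fermi`), the Christoffel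
symbols with two indices `i₀` vanish, and the equations can be solved one after the other by
integration in the direction `i₀`, starting from a single component `u`. Iterated integrals are
rewritten by means of fixed primitives of the inverse metric, so that the solution has compact
support as soon as the products of `u` with finitely many fixed functions have compactly supported
primitives in this direction. This holds for `u = A v`, where `A` is a differential operator in the
direction `i₀` whose transpose annihilates these functions on some open set and `v` is any test
function supported there (`exists_annihilating_operator`, `exists_test_with_primitives`).

Independence of coordinates is obtained from the weak form: the defect vanishes exactly when
`∫ √(det G) tr_G (L_X B) = 0` for all test fields `X` (`defect_eq_zero_of_integral`), and the trace
of the Lie derivative is natural (`defect_eq_zero_of_pullback`).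
-/

open scoped Matrix

noncomputable section

namespace HarmId

/-! ### Calculus of matrix fields on `ℝⁿ` -/

section Calculus

variable {n : ℕ}

theorem pd_add {i : Fin n} {u v : Model n → ℝ} {y : Model n} (hu : DifferentiableAt ℝ u y)
    (hv : DifferentiableAt ℝ v y) : pd i (fun z ↦ u z + v z) y = pd i u y + pd i v y := by
  simp [pd, fderiv_fun_add hu hv]

theorem pd_sub {i : Fin n} {u v : Model n → ℝ} {y : Model n} (hu : DifferentiableAt ℝ u y)
    (hv : DifferentiableAt ℝ v y) : pd i (fun z ↦ u z - v z) y = pd i u y - pd i v y := by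
  simp [pd, fderiv_fun_sub hu hv]

theorem pd_mul {i : Fin n} {u v : Model n → ℝ} {y : Model n} (hu : DifferentiableAt ℝ u y)
    (hv : DifferentiableAt ℝ v y) :
    pd i (fun z ↦ u z * v z) y = pd i u y * v y + u y * pd i v y := by
  simp [pd, fderiv_fun_mul hu hv]
  ring

theorem pd_const_mul {i : Fin n} (a : ℝ) {u : Model n → ℝ} {y : Model n}
    (hu : DifferentiableAt ℝ u y) : pd i (fun z ↦ a * u z) y = a * pd i u y := by
  simp [pd, fderiv_const_mul hu]

theorem pd_const (i : Fin n) (a : ℝ) (y : Model n) : pd i (fun _ ↦ a) y = 0 := by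
  simp [pd]

theorem pd_sum {ι : Type*} {s : Finset ι} {i : Fin n} {u : ι → Model n → ℝ} {y : Model n}
    (hu : ∀ k ∈ s, DifferentiableAt ℝ (u k) y) :
    pd i (fun z ↦ ∑ k ∈ s, u k z) y = ∑ k ∈ s, pd i (u k) y := by
  simp [pd, fderiv_fun_sum hu]

theorem pd_congr {i : Fin n} {u v : Model n → ℝ} {y : Model n} (h : u =ᶠ[nhds y] v) :
    pd i u y = pd i v y := by
  simp [pd, h.fderiv_eq]

theorem pd_eq_zero_of_eventually {i : Fin n} {u : Model n → ℝ} {y : Model n}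
    (h : u =ᶠ[nhds y] fun _ ↦ 0) : pd i u y = 0 := by
  rw [pd_congr h, pd_const]

/-- Jacobi's formula for the derivative of a determinant. -/
theorem pd_det {A : Model n → Matrix (Fin n) (Fin n) ℝ} {y : Model n}
    (hA : ∀ i j, DifferentiableAt ℝ (fun z ↦ A z i j) y) (k : Fin n) :
    pd k (fun z ↦ (A z).det) y
      = ∑ i, ∑ j, (A y).adjugate i j * pd k (fun z ↦ A z j i) y := by
  have h1 : ∀ i, ∑ j, (A y).adjugate i j * pd k (fun z ↦ A z j i) y
      = ((A y).updateCol i (fun j ↦ pd k (fun z ↦ A z j i) y)).det := by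
    intro i
    rw [← Matrix.cramer_apply, Matrix.cramer_eq_adjugate_mulVec]
    rfl
  simp only [h1]
  simp only [Matrix.det_apply]
  rw [pd_sum, Finset.sum_comm]
  · refine Finset.sum_congr rfl fun σ _ ↦ ?_
    have hd : HasFDerivAt (fun z ↦ ∏ i, A z (σ i) i)
        (∑ i, (∏ j ∈ Finset.univ.erase i, A y (σ j) j) •
          fderiv ℝ (fun z ↦ A z (σ i) i) y) y :=
      HasFDerivAt.finsetProd (u := Finset.univ) fun i _ ↦ (hA (σ i) i).hasFDerivAt
    have : pd k (fun z ↦ Equiv.Perm.sign σ • ∏ i, A z (σ i) i) y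
        = Equiv.Perm.sign σ • ∑ i, (∏ j ∈ Finset.univ.erase i, A y (σ j) j) *
          pd k (fun z ↦ A z (σ i) i) y := by
      have hd' : HasFDerivAt (fun z ↦ Equiv.Perm.sign σ • ∏ i, A z (σ i) i) _ y :=
        hd.const_smul (Equiv.Perm.sign σ)
      rw [pd, hd'.fderiv]
      simp [pd]
    rw [this, Finset.smul_sum]
    refine Finset.sum_congr rfl fun i _ ↦ ?_
    congr 1
    rw [← Finset.mul_prod_erase Finset.univ _ (Finset.mem_univ i), mul_comm]
    congr 1
    · simp
    · refine Finset.prod_congr rfl fun j hj ↦ ?_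
      rw [Matrix.updateCol_ne (Finset.ne_of_mem_erase hj)]
  · intro σ _
    exact DifferentiableAt.const_smul (HasFDerivAt.finsetProd (u := Finset.univ)
      fun i _ ↦ (hA (σ i) i).hasFDerivAt).differentiableAt _

/-- The matrix of the partial derivatives `∂ₖ Aᵢⱼ`. -/
def pdM (k : Fin n) (A : Model n → Matrix (Fin n) (Fin n) ℝ) (y : Model n) :
    Matrix (Fin n) (Fin n) ℝ :=
  Matrix.of fun i j ↦ pd k (fun z ↦ A z i j) y

/-- Differentiability of all entries of a matrix field at a point. -/
def EntryDiff (A : Model n → Matrix (Fin n) (Fin n) ℝ) (y : Model n) : Prop :=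
  ∀ i j, DifferentiableAt ℝ (fun z ↦ A z i j) y

theorem EntryDiff.mul {A B : Model n → Matrix (Fin n) (Fin n) ℝ} {y : Model n} (hA : EntryDiff A y)
    (hB : EntryDiff B y) : EntryDiff (fun z ↦ A z * B z) y := by
  intro i j
  simp only [Matrix.mul_apply]
  exact DifferentiableAt.fun_sum fun k _ ↦ (hA i k).mul (hB k j)

theorem EntryDiff.inv {A : Model n → Matrix (Fin n) (Fin n) ℝ} {y : Model n} (hA : EntryDiff A y)
    (h : (A y).det ≠ 0) : EntryDiff (fun z ↦ (A z)⁻¹) y :=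
  fun i j ↦ differentiableAt_inv hA h i j

theorem pdM_mul {A B : Model n → Matrix (Fin n) (Fin n) ℝ} {y : Model n} (hA : EntryDiff A y)
    (hB : EntryDiff B y) (k : Fin n) :
    pdM k (fun z ↦ A z * B z) y = pdM k A y * B y + A y * pdM k B y := by
  ext i j
  simp only [pdM, Matrix.of_apply, Matrix.add_apply, Matrix.mul_apply]
  rw [pd_sum fun l _ ↦ (hA i l).fun_mul (hB l j), ← Finset.sum_add_distrib]
  exact Finset.sum_congr rfl fun l _ ↦ pd_mul (hA i l) (hB l j)

theorem pd_trace {A : Model n → Matrix (Fin n) (Fin n) ℝ} {y : Model n} (hA : EntryDiff A y)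
    (k : Fin n) : pd k (fun z ↦ (A z).trace) y = (pdM k A y).trace := by
  simp only [Matrix.trace, Matrix.diag]
  rw [pd_sum fun i _ ↦ hA i i]
  rfl

theorem det_ne_zero_eventually {A : Model n → Matrix (Fin n) (Fin n) ℝ} {y : Model n}
    (hA : EntryDiff A y) (h : (A y).det ≠ 0) : ∀ᶠ z in nhds y, (A z).det ≠ 0 :=
  (differentiableAt_det hA).continuousAt.eventually_ne h

theorem pdM_inv {A : Model n → Matrix (Fin n) (Fin n) ℝ} {y : Model n} (hA : EntryDiff A y)
    (h : (A y).det ≠ 0) (k : Fin n) :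
    pdM k (fun z ↦ (A z)⁻¹) y = -((A y)⁻¹ * pdM k A y * (A y)⁻¹) := by
  have hu : IsUnit (A y).det := isUnit_iff_ne_zero.mpr h
  have h1 := pdM_mul hA (hA.inv h) k
  have h2 : pdM k (fun z ↦ A z * (A z)⁻¹) y = 0 := by
    ext i j
    simp only [pdM, Matrix.of_apply, Matrix.zero_apply]
    rw [← pd_const k ((1 : Matrix (Fin n) (Fin n) ℝ) i j) y]
    refine pd_congr ?_
    filter_upwards [det_ne_zero_eventually hA h] with z hz
    rw [Matrix.mul_nonsing_inv _ (isUnit_iff_ne_zero.mpr hz)]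
  rw [h2] at h1
  have h3 : A y * pdM k (fun z ↦ (A z)⁻¹) y = -(pdM k A y * (A y)⁻¹) :=
    eq_neg_of_add_eq_zero_right h1.symm
  calc pdM k (fun z ↦ (A z)⁻¹) y = (A y)⁻¹ * (A y * pdM k (fun z ↦ (A z)⁻¹) y) := by
        rw [← Matrix.mul_assoc, Matrix.nonsing_inv_mul _ hu, Matrix.one_mul]
    _ = _ := by rw [h3, Matrix.mul_neg, Matrix.mul_assoc]

theorem pd_sqrt_det {G : Model n → Matrix (Fin n) (Fin n) ℝ} {y : Model n} (hG : EntryDiff G y)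
    (h : 0 < (G y).det) (k : Fin n) :
    pd k (fun z ↦ √(G z).det) y = (1 / 2) * √(G y).det * ((G y)⁻¹ * pdM k G y).trace := by
  have hd := differentiableAt_det hG
  have h1 : pd k (fun z ↦ √(G z).det) y = 1 / (2 * √(G y).det) * pd k (fun z ↦ (G z).det) y := by
    simp only [pd]
    rw [(hd.hasFDerivAt.sqrt h.ne').fderiv]
    simp
  rw [h1, pd_det hG]
  have h2 : ((G y)⁻¹ * pdM k G y).trace
      = (G y).det⁻¹ * ∑ i, ∑ j, (G y).adjugate i j * pd k (fun z ↦ G z j i) y := by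
    simp only [Matrix.trace, Matrix.diag, Matrix.mul_apply, Matrix.inv_def, Matrix.smul_apply,
      Ring.inverse_eq_inv', smul_eq_mul, Finset.mul_sum, pdM, Matrix.of_apply, mul_assoc]
  rw [h2]
  have h3 : √(G y).det ≠ 0 := (Real.sqrt_pos.mpr h).ne'
  have h4 : (G y).det = √(G y).det * √(G y).det := (Real.mul_self_sqrt h.le).symm
  generalize (∑ i, ∑ j, (G y).adjugate i j * pd k (fun z ↦ G z j i) y) = S
  rw [show (G y).det⁻¹ = (√(G y).det * √(G y).det)⁻¹ by rw [← h4]]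
  field_simp

end Calculus

/-! ### The trace of the Lie derivative and the divergence identity -/

section LieDerivative

variable {n : ℕ}

/-- The Jacobian matrix `(∂ᵢ Xₖ)ₖᵢ` of a map with components `Xₖ`. -/
def jac (X : Fin n → Model n → ℝ) (y : Model n) : Matrix (Fin n) (Fin n) ℝ :=
  Matrix.of fun k i ↦ pd i (X k) y

/-- The Lie derivative `L_X B` of a field `B` of bilinear forms on `ℝⁿ` along the vector field
with components `Xₖ`, that is `Xₖ ∂ₖ Bᵢⱼ + Bₖⱼ ∂ᵢ Xₖ + Bᵢₖ ∂ⱼ Xₖ`. -/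
def lie (B : Model n → Matrix (Fin n) (Fin n) ℝ) (X : Fin n → Model n → ℝ) (y : Model n) :
    Matrix (Fin n) (Fin n) ℝ :=
  ∑ k, X k y • pdM k B y + (jac X y)ᵀ * B y + B y * jac X y

/-- The trace `tr_G (L_X B)` of the Lie derivative with respect to the metric `G`. -/
def trLie (G B : Model n → Matrix (Fin n) (Fin n) ℝ) (X : Fin n → Model n → ℝ) (y : Model n) : ℝ :=
  ((G y)⁻¹ * lie B X y).trace

/-- The Christoffel symbols `Γᵏᵢⱼ` of a field `G` of positive definite matrices. -/
def gamma (G : Model n → Matrix (Fin n) (Fin n) ℝ) (k i j : Fin n) (y : Model n) : ℝ :=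
  (1 / 2) * ∑ l, (G y)⁻¹ k l *
    (pd i (fun z ↦ G z j l) y + pd j (fun z ↦ G z i l) y - pd l (fun z ↦ G z i j) y)

/-- The defect `(δB)ⱼ + ½ ∂ⱼ (tr_G B)` of `B` from being harmonic with respect to `G`, in a
coordinate domain. -/
def defect (G B : Model n → Matrix (Fin n) (Fin n) ℝ) (j : Fin n) (y : Model n) : ℝ :=
  -(∑ k, ∑ i, (G y)⁻¹ k i * (pd k (fun z ↦ B z i j) y
      - ∑ l, gamma G l k i y * B y l j - ∑ l, gamma G l k j y * B y i l))
    + (1 / 2) * pd j (fun z ↦ ∑ i, ∑ k, (G z)⁻¹ i k * B z i k) y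

theorem sum_comm_swap (f : Fin n → Fin n → Fin n → Fin n → ℝ) :
    ∑ a, ∑ b, ∑ c, ∑ d, f a b c d = ∑ a, ∑ b, ∑ c, ∑ d, f d c b a := by
  have h : ∀ F : Fin n → Fin n → Fin n → Fin n → ℝ, ∑ a, ∑ b, ∑ c, ∑ d, F a b c d
      = ∑ p : Fin n × Fin n × Fin n × Fin n, F p.1 p.2.1 p.2.2.1 p.2.2.2 := by
    intro F
    simp only [Fintype.sum_prod_type]
  rw [h, h]
  exact Fintype.sum_equiv
    ⟨fun p ↦ (p.2.2.2, p.2.2.1, p.2.1, p.1), fun p ↦ (p.2.2.2, p.2.2.1, p.2.1, p.1),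
      fun _ ↦ rfl, fun _ ↦ rfl⟩ _ _ fun _ ↦ rfl

/-- The contractions of the Christoffel symbols in `δB`. Here `P` is the inverse metric and `Dₖ` the
`k`-th partial derivative of the metric. -/
theorem christoffel_contraction {P B : Matrix (Fin n) (Fin n) ℝ}
    {D : Fin n → Matrix (Fin n) (Fin n) ℝ} (hP : P.IsSymm) (hB : B.IsSymm)
    (hD : ∀ k, (D k).IsSymm) (j : Fin n) :
    ∑ k, ∑ i, P k i * (∑ l, (1 / 2 * ∑ m, P l m * (D k i m + D i k m - D m k i)) * B l j
      + ∑ l, (1 / 2 * ∑ m, P l m * (D k j m + D j k m - D m k j)) * B i l)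
    = ∑ i, (P * D i * P * B) i j - ∑ i, 1 / 2 * (P * D i).trace * (P * B) i j
      + 1 / 2 * (P * D j * P * B).trace := by
  have hP' : ∀ a b, P a b = P b a := fun a b ↦ hP.apply b a
  have hB' : ∀ a b, B a b = B b a := fun a b ↦ hB.apply b a
  have hD' : ∀ k a b, D k a b = D k b a := fun k a b ↦ (hD k).apply b a
  have e1 : ∑ k, ∑ i, P k i * (∑ l, (1 / 2 * ∑ m, P l m * (D k i m + D i k m - D m k i)) * B l j)
      = ∑ i, (P * D i * P * B) i j - ∑ i, 1 / 2 * (P * D i).trace * (P * B) i j := by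
    have a1 : ∑ k, ∑ i, P k i * (∑ l, (1 / 2 * ∑ m, P l m * (D k i m + D i k m - D m k i)) * B l j)
        = 1 / 2 * ∑ k, ∑ i, ∑ l, ∑ m, P k i * P l m * D k i m * B l j
        + 1 / 2 * ∑ k, ∑ i, ∑ l, ∑ m, P k i * P l m * D i k m * B l j
        - 1 / 2 * ∑ k, ∑ i, ∑ l, ∑ m, P k i * P l m * D m k i * B l j := by
      simp only [Finset.mul_sum, Finset.sum_mul, ← Finset.sum_add_distrib,
        ← Finset.sum_sub_distrib]
      refine Finset.sum_congr rfl fun k _ ↦ Finset.sum_congr rfl fun i _ ↦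
        Finset.sum_congr rfl fun l _ ↦ Finset.sum_congr rfl fun m _ ↦ ?_
      ring
    have a2 : ∑ k, ∑ i, ∑ l, ∑ m, P k i * P l m * D i k m * B l j
        = ∑ k, ∑ i, ∑ l, ∑ m, P k i * P l m * D k i m * B l j := by
      rw [Finset.sum_comm]
      refine Finset.sum_congr rfl fun k _ ↦ Finset.sum_congr rfl fun i _ ↦
        Finset.sum_congr rfl fun l _ ↦ Finset.sum_congr rfl fun m _ ↦ ?_
      rw [hP' i k]
    have a3 : ∑ i, (P * D i * P * B) i j
        = ∑ k, ∑ i, ∑ l, ∑ m, P k i * P l m * D k i m * B l j := by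
      simp only [Matrix.mul_apply, Finset.sum_mul]
      refine Finset.sum_congr rfl fun k _ ↦ ?_
      rw [Finset.sum_comm]
      have : ∀ l, ∑ m, ∑ i, P k i * D k i m * P m l * B l j
          = ∑ i, ∑ m, P k i * D k i m * P m l * B l j := fun l ↦ Finset.sum_comm
      rw [Finset.sum_comm]
      simp only [this]
      rw [Finset.sum_comm]
      refine Finset.sum_congr rfl fun i _ ↦
        Finset.sum_congr rfl fun l _ ↦ Finset.sum_congr rfl fun m _ ↦ ?_
      rw [hP' l m]
      ring
    have a4 : ∑ i, 1 / 2 * (P * D i).trace * (P * B) i j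
        = 1 / 2 * ∑ k, ∑ i, ∑ l, ∑ m, P k i * P l m * D m k i * B l j := by
      simp only [Matrix.trace, Matrix.diag, Matrix.mul_apply, Finset.sum_mul, Finset.mul_sum]
      have : ∀ F : Fin n → Fin n → Fin n → Fin n → ℝ, ∑ m, ∑ l, ∑ k, ∑ i, F m l k i
          = ∑ k, ∑ i, ∑ l, ∑ m, F m l k i := by
        intro F
        rw [sum_comm_swap]
        rw [Finset.sum_comm]
      rw [this]
      refine Finset.sum_congr rfl fun k _ ↦ Finset.sum_congr rfl fun i _ ↦
        Finset.sum_congr rfl fun l _ ↦ Finset.sum_congr rfl fun m _ ↦ ?_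
      rw [hP' m l, hD' m i k]
      ring
    rw [a1, a2, a3, a4]
    ring
  have e2 : ∑ k, ∑ i, P k i * (∑ l, (1 / 2 * ∑ m, P l m * (D k j m + D j k m - D m k j)) * B i l)
      = 1 / 2 * (P * D j * P * B).trace := by
    have a1 : ∑ k, ∑ i, P k i * (∑ l, (1 / 2 * ∑ m, P l m * (D k j m + D j k m - D m k j)) * B i l)
        = 1 / 2 * ∑ k, ∑ i, ∑ l, ∑ m, P k i * P l m * D k j m * B i l
        + 1 / 2 * ∑ k, ∑ i, ∑ l, ∑ m, P k i * P l m * D j k m * B i l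
        - 1 / 2 * ∑ k, ∑ i, ∑ l, ∑ m, P k i * P l m * D m k j * B i l := by
      simp only [Finset.mul_sum, Finset.sum_mul, ← Finset.sum_add_distrib,
        ← Finset.sum_sub_distrib]
      refine Finset.sum_congr rfl fun k _ ↦ Finset.sum_congr rfl fun i _ ↦
        Finset.sum_congr rfl fun l _ ↦ Finset.sum_congr rfl fun m _ ↦ ?_
      ring
    have a2 : ∑ k, ∑ i, ∑ l, ∑ m, P k i * P l m * D m k j * B i l
        = ∑ k, ∑ i, ∑ l, ∑ m, P k i * P l m * D k j m * B i l := by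
      rw [sum_comm_swap]
      refine Finset.sum_congr rfl fun k _ ↦ Finset.sum_congr rfl fun i _ ↦
        Finset.sum_congr rfl fun l _ ↦ Finset.sum_congr rfl fun m _ ↦ ?_
      rw [hP' m l, hP' i k, hB' l i, hD' k m j]
      ring
    have a3 : (P * D j * P * B).trace
        = ∑ k, ∑ i, ∑ l, ∑ m, P k i * P l m * D j k m * B i l := by
      simp only [Matrix.trace, Matrix.diag, Matrix.mul_apply, Finset.sum_mul]
      rw [Finset.sum_comm]
      have h1 : ∀ F : Fin n → Fin n → Fin n → Fin n → ℝ, ∑ l, ∑ i, ∑ m, ∑ k, F l i m k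
          = ∑ k, ∑ i, ∑ l, ∑ m, F l i m k := by
        intro F
        rw [sum_comm_swap]
        refine Finset.sum_congr rfl fun k _ ↦ ?_
        rw [Finset.sum_comm]
        refine Finset.sum_congr rfl fun i _ ↦ ?_
        rw [Finset.sum_comm]
      rw [h1]
      rw [Finset.sum_congr rfl]
      intro k _
      refine Finset.sum_congr rfl fun i _ ↦
        Finset.sum_congr rfl fun l _ ↦ Finset.sum_congr rfl fun m _ ↦ ?_
      rw [hP' i k, hP' m l, hB' l i]
      ring
    rw [a1, a2, a3]
    ring
  simp only [mul_add, Finset.sum_add_distrib]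
  rw [e1, e2]

theorem isSymm_pdM {A : Model n → Matrix (Fin n) (Fin n) ℝ} {y : Model n}
    (hA : ∀ᶠ z in nhds y, (A z).IsSymm) (k : Fin n) : (pdM k A y).IsSymm := by
  refine Matrix.IsSymm.ext fun i j ↦ pd_congr ?_
  filter_upwards [hA] with z hz using hz.apply i j

theorem trace_eq_sum_inv_mul {P B : Matrix (Fin n) (Fin n) ℝ} (hB : B.IsSymm) :
    ∑ i, ∑ k, P i k * B i k = (P * B).trace := by
  simp only [Matrix.trace, Matrix.diag, Matrix.mul_apply]
  exact Finset.sum_congr rfl fun i _ ↦ Finset.sum_congr rfl fun k _ ↦ by rw [hB.apply k i]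

/-- The harmonicity defect in divergence form:
`√G (δB + ½ d tr B)ⱼ = ½ √G tr (G⁻¹ ∂ⱼB) - ∂ᵢ (√G (G⁻¹B)ᵢⱼ)`. -/
theorem sqrt_det_mul_defect {G B : Model n → Matrix (Fin n) (Fin n) ℝ} {y : Model n}
    (hG : EntryDiff G y) (hB : EntryDiff B y) (hdet : 0 < (G y).det)
    (hGs : ∀ᶠ z in nhds y, (G z).IsSymm) (hBs : ∀ᶠ z in nhds y, (B z).IsSymm) (j : Fin n) :
    √(G y).det * defect G B j y
      = 1 / 2 * √(G y).det * ((G y)⁻¹ * pdM j B y).trace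
        - ∑ i, pd i (fun z ↦ √(G z).det * ((G z)⁻¹ * B z) i j) y := by
  have hGi := hG.inv hdet.ne'
  have hP : (G y)⁻¹.IsSymm := by
    rw [Matrix.IsSymm, Matrix.transpose_nonsing_inv, hGs.self_of_nhds.eq]
  have hs : DifferentiableAt ℝ (fun z ↦ √(G z).det) y :=
    (differentiableAt_det hG).sqrt hdet.ne'
  have h1 : ∀ i, pd i (fun z ↦ √(G z).det * ((G z)⁻¹ * B z) i j) y
      = √(G y).det * (1 / 2 * ((G y)⁻¹ * pdM i G y).trace * ((G y)⁻¹ * B y) i j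
        - ((G y)⁻¹ * pdM i G y * (G y)⁻¹ * B y) i j + ((G y)⁻¹ * pdM i B y) i j) := by
    intro i
    rw [pd_mul hs ((hGi.mul hB) i j), pd_sqrt_det hG hdet]
    have h2 := congrFun (congrFun (pdM_mul hGi hB i) i) j
    rw [pdM_inv hG hdet.ne'] at h2
    change pd i (fun z ↦ ((G z)⁻¹ * B z) i j) y = _ at h2
    rw [h2]
    simp only [Matrix.add_apply, Matrix.neg_mul, Matrix.neg_apply]
    ring
  have h3 : pd j (fun z ↦ ∑ i, ∑ k, (G z)⁻¹ i k * B z i k) y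
      = -((G y)⁻¹ * pdM j G y * (G y)⁻¹ * B y).trace + ((G y)⁻¹ * pdM j B y).trace := by
    have : (fun z ↦ ∑ i, ∑ k, (G z)⁻¹ i k * B z i k)
        =ᶠ[nhds y] fun z ↦ ((G z)⁻¹ * B z).trace := by
      filter_upwards [hBs] with z hz using trace_eq_sum_inv_mul hz
    rw [pd_congr this, pd_trace (hGi.mul hB), pdM_mul hGi hB, pdM_inv hG hdet.ne',
      Matrix.trace_add, Matrix.neg_mul, Matrix.trace_neg]
  have h4 : ∑ k, ∑ i, (G y)⁻¹ k i * (pd k (fun z ↦ B z i j) y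
      - ∑ l, gamma G l k i y * B y l j - ∑ l, gamma G l k j y * B y i l)
      = ∑ i, ((G y)⁻¹ * pdM i B y) i j
        - (∑ i, ((G y)⁻¹ * pdM i G y * (G y)⁻¹ * B y) i j
          - ∑ i, 1 / 2 * ((G y)⁻¹ * pdM i G y).trace * ((G y)⁻¹ * B y) i j
          + 1 / 2 * ((G y)⁻¹ * pdM j G y * (G y)⁻¹ * B y).trace) := by
    rw [← christoffel_contraction hP hBs.self_of_nhds (fun k ↦ isSymm_pdM hGs k) j]
    have hm : ∀ k, ((G y)⁻¹ * pdM k B y) k j = ∑ i, (G y)⁻¹ k i * pdM k B y i j :=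
      fun k ↦ Matrix.mul_apply
    simp only [hm, ← Finset.sum_sub_distrib]
    refine Finset.sum_congr rfl fun k _ ↦ Finset.sum_congr rfl fun i _ ↦ ?_
    rw [sub_sub, mul_sub]
    rfl
  rw [defect, h3, h4]
  simp only [h1, ← Finset.mul_sum, Finset.sum_add_distrib, Finset.sum_sub_distrib]
  ring

/-- The trace of the Lie derivative along `X` is the sum of a divergence and of the pairing of `X`
with the harmonicity defect. -/
theorem sqrt_det_mul_trLie {G B : Model n → Matrix (Fin n) (Fin n) ℝ} {X : Fin n → Model n → ℝ}
    {y : Model n} (hG : EntryDiff G y) (hB : EntryDiff B y)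
    (hX : ∀ k, DifferentiableAt ℝ (X k) y) (hdet : 0 < (G y).det)
    (hGs : ∀ᶠ z in nhds y, (G z).IsSymm) (hBs : ∀ᶠ z in nhds y, (B z).IsSymm) :
    √(G y).det * trLie G B X y
      = 2 * ∑ i, pd i (fun z ↦ ∑ k, √(G z).det * ((G z)⁻¹ * B z) i k * X k z) y
        + 2 * ∑ k, X k y * (√(G y).det * defect G B k y) := by
  have hGi := hG.inv hdet.ne'
  have hP : (G y)⁻¹.IsSymm := by
    rw [Matrix.IsSymm, Matrix.transpose_nonsing_inv, hGs.self_of_nhds.eq]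
  have hs : DifferentiableAt ℝ (fun z ↦ √(G z).det) y :=
    (differentiableAt_det hG).sqrt hdet.ne'
  have hW : ∀ i k, DifferentiableAt ℝ (fun z ↦ √(G z).det * ((G z)⁻¹ * B z) i k) y :=
    fun i k ↦ hs.mul ((hGi.mul hB) i k)
  have h1 : ∀ i, pd i (fun z ↦ ∑ k, √(G z).det * ((G z)⁻¹ * B z) i k * X k z) y
      = ∑ k, (pd i (fun z ↦ √(G z).det * ((G z)⁻¹ * B z) i k) y * X k y
        + √(G y).det * ((G y)⁻¹ * B y) i k * jac X y k i) := by
    intro i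
    rw [pd_sum fun k _ ↦ (hW i k).fun_mul (hX k)]
    exact Finset.sum_congr rfl fun k _ ↦ pd_mul (hW i k) (hX k)
  have h2 : trLie G B X y = ∑ k, X k y * ((G y)⁻¹ * pdM k B y).trace
      + 2 * ∑ i, ∑ k, ((G y)⁻¹ * B y) i k * jac X y k i := by
    have h3 : ((G y)⁻¹ * ((jac X y)ᵀ * B y)).trace = ((G y)⁻¹ * (B y * jac X y)).trace := by
      rw [← Matrix.trace_transpose, Matrix.transpose_mul, Matrix.transpose_mul,
        Matrix.transpose_transpose, hP.eq, hBs.self_of_nhds.eq, Matrix.trace_mul_comm]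
    rw [trLie, lie, Matrix.mul_add, Matrix.mul_add, Matrix.trace_add, Matrix.trace_add, h3,
      Matrix.mul_sum, Matrix.trace_sum, add_assoc, ← two_mul, ← Matrix.mul_assoc]
    congr 1
    refine Finset.sum_congr rfl fun k _ ↦ ?_
    rw [Matrix.mul_smul, Matrix.trace_smul, smul_eq_mul]
  simp only [sqrt_det_mul_defect hG hB hdet hGs hBs, h1, h2]
  rw [Finset.sum_congr rfl fun i _ ↦ Finset.sum_add_distrib, Finset.sum_add_distrib,
    Finset.sum_comm (f := fun i k ↦ pd i (fun z ↦ √(G z).det * ((G z)⁻¹ * B z) i k) y * X k y)]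
  simp only [mul_sub, Finset.sum_sub_distrib, Finset.mul_sum, mul_add]
  have e1 : ∀ a b c d e f : ℝ, a = d → b = c → e = f → a + b = e + c + (d - f) := by
    intro a b c d e f h1 h2 h3
    rw [h1, h2, h3]
    ring
  refine e1 _ _ _ _ _ _ ?_ ?_ ?_
  · refine Finset.sum_congr rfl fun k _ ↦ ?_
    ring
  · refine Finset.sum_congr rfl fun i _ ↦ Finset.sum_congr rfl fun k _ ↦ ?_
    ring
  · refine Finset.sum_congr rfl fun i _ ↦ Finset.sum_congr rfl fun k _ ↦ ?_
    ring

end LieDerivative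

/-! ### Naturality of the Lie derivative under coordinate changes -/

section Naturality

variable {n : ℕ}

/-- The Jacobian matrix of a map `ℝⁿ → ℝⁿ`. -/
def jacM (ρ : Model n → Model n) (y : Model n) : Matrix (Fin n) (Fin n) ℝ :=
  jac (fun k z ↦ ρ z k) y

theorem fderiv_apply_eq_sum_pd (f : Model n → ℝ) (y v : Model n) :
    fderiv ℝ f y v = ∑ l, pd l f y * v l := by
  have : v = ∑ l, v l • EuclideanSpace.single l (1 : ℝ) := by
    ext k
    simp [Finset.sum_apply, Pi.single_apply]
  conv_lhs => rw [this]
  simp [pd, mul_comm]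

theorem hasFDerivAt_coord {ρ : Model n → Model n} {y : Model n} (hρ : DifferentiableAt ℝ ρ y)
    (k : Fin n) : HasFDerivAt (fun z ↦ ρ z k)
      ((EuclideanSpace.proj k : Model n →L[ℝ] ℝ).comp (fderiv ℝ ρ y)) y :=
  (EuclideanSpace.proj k : Model n →L[ℝ] ℝ).hasFDerivAt.comp y hρ.hasFDerivAt

theorem jacM_apply {ρ : Model n → Model n} {y : Model n} (hρ : DifferentiableAt ℝ ρ y)
    (k i : Fin n) : jacM ρ y k i = fderiv ℝ ρ y (EuclideanSpace.single i 1) k := by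
  simp [jacM, jac, pd, (hasFDerivAt_coord hρ k).fderiv]

theorem det_fderiv {ρ : Model n → Model n} {y : Model n} (hρ : DifferentiableAt ℝ ρ y) :
    (fderiv ℝ ρ y).det = (jacM ρ y).det := by
  rw [ContinuousLinearMap.det, ← LinearMap.det_toMatrix (EuclideanSpace.basisFun (Fin n) ℝ).toBasis]
  congr 1
  ext k i
  rw [LinearMap.toMatrix_apply, jacM_apply hρ]
  simp

/-- The chain rule in coordinates. -/
theorem pd_comp {ρ : Model n → Model n} {f : Model n → ℝ} {y : Model n}
    (hf : DifferentiableAt ℝ f (ρ y)) (hρ : DifferentiableAt ℝ ρ y) (i : Fin n) :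
    pd i (fun z ↦ f (ρ z)) y = ∑ l, pd l f (ρ y) * jacM ρ y l i := by
  have h : HasFDerivAt (fun z ↦ f (ρ z)) _ y := hf.hasFDerivAt.comp y hρ.hasFDerivAt
  rw [pd, h.fderiv, ContinuousLinearMap.comp_apply, fderiv_apply_eq_sum_pd]
  simp only [jacM_apply hρ]

theorem jacM_comp {σ ρ : Model n → Model n} {y : Model n} (hσ : DifferentiableAt ℝ σ (ρ y))
    (hρ : DifferentiableAt ℝ ρ y) : jacM (fun z ↦ σ (ρ z)) y = jacM σ (ρ y) * jacM ρ y := by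
  ext k i
  rw [Matrix.mul_apply]
  exact pd_comp (f := fun z ↦ σ z k) (hasFDerivAt_coord hσ k).differentiableAt hρ i

theorem jacM_congr {σ ρ : Model n → Model n} {y : Model n} (h : σ =ᶠ[nhds y] ρ) :
    jacM σ y = jacM ρ y := by
  ext k i
  refine pd_congr ?_
  filter_upwards [h] with z hz
  rw [hz]

theorem jacM_id (y : Model n) : jacM (fun z ↦ z) y = 1 := by
  ext k i
  rw [jacM_apply differentiableAt_fun_id]
  simp [Matrix.one_apply]

theorem contDiffAt_pd {f : Model n → ℝ} {y : Model n} (hf : ContDiffAt ℝ ∞ f y) (i : Fin n) :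
    ContDiffAt ℝ ∞ (pd i f) y :=
  (hf.fderiv_right (m := ∞) (by simp)).clm_apply contDiffAt_const

theorem contDiffAt_coord {ρ : Model n → Model n} {y : Model n} (hρ : ContDiffAt ℝ ∞ ρ y)
    (k : Fin n) : ContDiffAt ℝ ∞ (fun z ↦ ρ z k) y :=
  (EuclideanSpace.proj k : Model n →L[ℝ] ℝ).contDiff.contDiffAt.comp y hρ

theorem contDiffAt_jacM {ρ : Model n → Model n} {y : Model n} (hρ : ContDiffAt ℝ ∞ ρ y)
    (k i : Fin n) : ContDiffAt ℝ ∞ (fun z ↦ jacM ρ z k i) y :=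
  contDiffAt_pd (contDiffAt_coord hρ k) i

theorem pd_pd_comm {f : Model n → ℝ} {y : Model n} (hf : ContDiffAt ℝ ∞ f y) (i j : Fin n) :
    pd i (pd j f) y = pd j (pd i f) y := by
  have hd : DifferentiableAt ℝ (fderiv ℝ f) y :=
    (hf.fderiv_right (m := ∞) (by simp)).differentiableAt (by simp)
  have h : ∀ a b : Fin n, pd a (pd b f) y
      = fderiv ℝ (fderiv ℝ f) y (EuclideanSpace.single a 1) (EuclideanSpace.single b 1) := by
    intro a b
    have : HasFDerivAt (pd b f) _ y := hd.hasFDerivAt.clm_apply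
      (hasFDerivAt_const (EuclideanSpace.single b (1 : ℝ)) y)
    rw [pd, this.fderiv]
    simp
  rw [h, h]
  have h2 : ((2 : ℕ∞) : WithTop ℕ∞) ≤ ∞ := WithTop.coe_le_coe.mpr le_top
  exact (hf.isSymmSndFDerivAt (by simpa using h2)).eq _ _

/-- Naturality of the Lie derivative: if `B` and `X` are the pullbacks of `B'` and `X'` by `ρ`, then
`L_X B` is the pullback of `L_{X'} B'`. -/
theorem lie_pullback {ρ : Model n → Model n} {y : Model n}
    {B B' : Model n → Matrix (Fin n) (Fin n) ℝ} {X X' : Fin n → Model n → ℝ}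
    (hρ : ContDiffAt ℝ ∞ ρ y) (hB' : EntryDiff B' (ρ y))
    (hX : ∀ k, DifferentiableAt ℝ (X k) y) (hX' : ∀ k, DifferentiableAt ℝ (X' k) (ρ y))
    (hB : ∀ᶠ z in nhds y, B z = (jacM ρ z)ᵀ * B' (ρ z) * jacM ρ z)
    (hXX : ∀ᶠ z in nhds y, ∀ k, X' k (ρ z) = ∑ i, jacM ρ z k i * X i z) :
    lie B X y = (jacM ρ y)ᵀ * lie B' X' (ρ y) * jacM ρ y := by
  have hρd : DifferentiableAt ℝ ρ y := hρ.differentiableAt (by simp)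
  have hJ : EntryDiff (jacM ρ) y := fun k i ↦ (contDiffAt_jacM hρ k i).differentiableAt (by simp)
  have hJt : EntryDiff (fun z ↦ (jacM ρ z)ᵀ) y := fun k i ↦ hJ i k
  have hBρ : EntryDiff (fun z ↦ B' (ρ z)) y := fun k i ↦ (hB' k i).comp y hρd
  set J := jacM ρ y with hJdef
  set H := ∑ k, X k y • pdM k (jacM ρ) y with hH
  have h1 : ∀ k, pdM k B y = (pdM k (jacM ρ) y)ᵀ * B' (ρ y) * J
      + Jᵀ * (∑ l, J l k • pdM l B' (ρ y)) * J + Jᵀ * B' (ρ y) * pdM k (jacM ρ) y := by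
    intro k
    have e1 : pdM k B y = pdM k (fun z ↦ (jacM ρ z)ᵀ * B' (ρ z) * jacM ρ z) y := by
      ext i j
      refine pd_congr ?_
      filter_upwards [hB] with z hz
      rw [hz]
    have e2 : pdM k (fun z ↦ B' (ρ z)) y = ∑ l, J l k • pdM l B' (ρ y) := by
      ext i j
      rw [Matrix.sum_apply]
      refine (pd_comp (hB' i j) hρd k).trans (Finset.sum_congr rfl fun l _ ↦ ?_)
      rw [Matrix.smul_apply, smul_eq_mul, mul_comm]
      rfl
    have e3 : pdM k (fun z ↦ (jacM ρ z)ᵀ) y = (pdM k (jacM ρ) y)ᵀ := rfl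
    rw [e1, pdM_mul (hJt.mul hBρ) hJ, pdM_mul hJt hBρ, e2, e3, Matrix.add_mul]
  have h2 : J * jac X y = jac X' (ρ y) * J - H := by
    rw [eq_sub_iff_add_eq]
    ext k i
    have e1 : pd i (fun z ↦ X' k (ρ z)) y = pd i (fun z ↦ ∑ a, jacM ρ z k a * X a z) y := by
      refine pd_congr ?_
      filter_upwards [hXX] with z hz using hz k
    rw [pd_comp (hX' k) hρd, pd_sum fun a _ ↦ (hJ k a).fun_mul (hX a)] at e1
    have e2 : (jac X' (ρ y) * J) k i = ∑ l, pd l (X' k) (ρ y) * jacM ρ y l i := Matrix.mul_apply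
    rw [e2, e1, Matrix.add_apply, Matrix.mul_apply, hH, Matrix.sum_apply,
      ← Finset.sum_add_distrib]
    refine Finset.sum_congr rfl fun a _ ↦ ?_
    rw [pd_mul (hJ k a) (hX a), Matrix.smul_apply, smul_eq_mul]
    have e3 : pdM a (jacM ρ) y k i = pd i (fun z ↦ jacM ρ z k a) y :=
      pd_pd_comm (contDiffAt_coord hρ k) a i
    rw [e3, hJdef]
    simp only [jac, Matrix.of_apply]
    ring
  have h3 : ∑ k, X k y • (∑ l, J l k • pdM l B' (ρ y)) = ∑ l, X' l (ρ y) • pdM l B' (ρ y) := by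
    simp only [Finset.smul_sum, smul_smul]
    rw [Finset.sum_comm]
    refine Finset.sum_congr rfl fun l _ ↦ ?_
    rw [hXX.self_of_nhds l, Finset.sum_smul]
    exact Finset.sum_congr rfl fun k _ ↦ by rw [mul_comm]
  have h4 : ∑ k, X k y • pdM k B y
      = Hᵀ * B' (ρ y) * J + Jᵀ * (∑ l, X' l (ρ y) • pdM l B' (ρ y)) * J
        + Jᵀ * B' (ρ y) * H := by
    rw [← h3, hH, Matrix.transpose_sum]
    simp only [h1, smul_add, Finset.sum_add_distrib, Matrix.sum_mul, Matrix.mul_sum,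
      Matrix.transpose_smul, Matrix.smul_mul, Matrix.mul_smul]
  have h5 : (jac X y)ᵀ * B y = (J * jac X y)ᵀ * B' (ρ y) * J := by
    rw [hB.self_of_nhds, Matrix.transpose_mul]
    simp only [Matrix.mul_assoc, hJdef]
  have h6 : B y * jac X y = Jᵀ * B' (ρ y) * (J * jac X y) := by
    rw [hB.self_of_nhds]
    simp only [Matrix.mul_assoc, hJdef]
  rw [lie, lie, h4, h5, h6, h2]
  simp only [Matrix.transpose_sub, Matrix.transpose_mul, Matrix.sub_mul, Matrix.mul_sub,
    Matrix.mul_add, Matrix.add_mul, Matrix.mul_assoc]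
  abel

theorem trace_inv_pullback {J G M : Matrix (Fin n) (Fin n) ℝ} (hJ : J.det ≠ 0) :
    ((Jᵀ * G * J)⁻¹ * (Jᵀ * M * J)).trace = (G⁻¹ * M).trace := by
  have hJu : IsUnit J.det := isUnit_iff_ne_zero.mpr hJ
  have hJt : IsUnit Jᵀ.det := by rwa [Matrix.det_transpose]
  have e1 : Jᵀ⁻¹ * (Jᵀ * M * J) = M * J := by
    rw [Matrix.mul_assoc, ← Matrix.mul_assoc Jᵀ⁻¹, Matrix.nonsing_inv_mul _ hJt, Matrix.one_mul]
  rw [Matrix.mul_inv_rev, Matrix.mul_inv_rev, Matrix.mul_assoc, Matrix.mul_assoc, e1,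
    Matrix.trace_mul_comm, Matrix.mul_assoc, Matrix.mul_assoc, Matrix.mul_nonsing_inv _ hJu,
    Matrix.mul_one]

theorem trLie_pullback {ρ : Model n → Model n} {y : Model n}
    {G B G' B' : Model n → Matrix (Fin n) (Fin n) ℝ} {X X' : Fin n → Model n → ℝ}
    (hρ : ContDiffAt ℝ ∞ ρ y) (hB' : EntryDiff B' (ρ y))
    (hX : ∀ k, DifferentiableAt ℝ (X k) y) (hX' : ∀ k, DifferentiableAt ℝ (X' k) (ρ y))
    (hJ : (jacM ρ y).det ≠ 0)
    (hG : G y = (jacM ρ y)ᵀ * G' (ρ y) * jacM ρ y)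
    (hB : ∀ᶠ z in nhds y, B z = (jacM ρ z)ᵀ * B' (ρ z) * jacM ρ z)
    (hXX : ∀ᶠ z in nhds y, ∀ k, X' k (ρ z) = ∑ i, jacM ρ z k i * X i z) :
    trLie G B X y = trLie G' B' X' (ρ y) := by
  rw [trLie, trLie, lie_pullback hρ hB' hX hX' hB hXX, hG, trace_inv_pullback hJ]

theorem sqrt_det_pullback {J G : Matrix (Fin n) (Fin n) ℝ} :
    √(Jᵀ * G * J).det = |J.det| * √G.det := by
  rw [Matrix.det_mul, Matrix.det_mul, Matrix.det_transpose,
    show J.det * G.det * J.det = J.det ^ 2 * G.det by ring, Real.sqrt_mul (sq_nonneg _),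
    Real.sqrt_sq_eq_abs]

end Naturality

/-! ### Test functions and the weak form of harmonicity -/

section TestFunctions

variable {n : ℕ}

/-- Smooth functions with compact support contained in `O`. -/
structure IsTest (O : Set (Model n)) (v : Model n → ℝ) : Prop where
  contDiff : ContDiff ℝ ∞ v
  hasCompactSupport : HasCompactSupport v
  tsupport_subset : tsupport v ⊆ O

theorem IsTest.of_compact {O K : Set (Model n)} {f : Model n → ℝ} (hK : IsCompact K) (hKO : K ⊆ O)
    (hf : ∀ y ∈ O, ContDiffAt ℝ ∞ f y) (h0 : ∀ y ∉ K, f y = 0) : IsTest O f := by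
  have hts : tsupport f ⊆ K := closure_minimal
    (fun y hy ↦ by_contra fun hyK ↦ hy (h0 y hyK)) hK.isClosed
  refine ⟨contDiff_iff_contDiffAt.mpr fun y ↦ ?_, hK.of_isClosed_subset (isClosed_tsupport f) hts,
    hts.trans hKO⟩
  by_cases hy : y ∈ O
  · exact hf y hy
  · have : f =ᶠ[nhds y] fun _ ↦ 0 := by
      filter_upwards [hK.isClosed.isOpen_compl.mem_nhds fun h ↦ hy (hKO h)] with z hz
      exact h0 z hz
    exact contDiffAt_const.congr_of_eventuallyEq this

theorem IsTest.eq_zero {O : Set (Model n)} {v : Model n → ℝ} (hv : IsTest O v) {y : Model n}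
    (hy : y ∉ O) : v y = 0 :=
  image_eq_zero_of_notMem_tsupport fun h ↦ hy (hv.tsupport_subset h)

theorem IsTest.eventually_eq_zero {O : Set (Model n)} {v : Model n → ℝ} (hv : IsTest O v)
    {y : Model n} (hy : y ∉ O) : v =ᶠ[nhds y] fun _ ↦ 0 :=
  notMem_tsupport_iff_eventuallyEq.mp fun h ↦ hy (hv.tsupport_subset h)

theorem IsTest.differentiableAt {O : Set (Model n)} {v : Model n → ℝ} (hv : IsTest O v)
    (y : Model n) : DifferentiableAt ℝ v y :=
  hv.contDiff.contDiffAt.differentiableAt (by simp)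

theorem IsTest.mono {O O' : Set (Model n)} {v : Model n → ℝ} (hv : IsTest O v) (h : O ⊆ O') :
    IsTest O' v :=
  ⟨hv.1, hv.2, hv.3.trans h⟩

theorem IsTest.zero (O : Set (Model n)) : IsTest O (fun _ ↦ 0) :=
  .of_compact isCompact_empty (Set.empty_subset _) (fun _ _ ↦ contDiffAt_const) fun _ _ ↦ rfl

theorem IsTest.add {O : Set (Model n)} {v w : Model n → ℝ} (hv : IsTest O v) (hw : IsTest O w) :
    IsTest O (fun z ↦ v z + w z) :=
  .of_compact (hv.2.isCompact.union hw.2.isCompact) (Set.union_subset hv.3 hw.3)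
    (fun _ _ ↦ (hv.1.add hw.1).contDiffAt) fun y hy ↦ by
      rw [image_eq_zero_of_notMem_tsupport fun h ↦ hy (Or.inl h),
        image_eq_zero_of_notMem_tsupport fun h ↦ hy (Or.inr h), add_zero]

theorem IsTest.mul {O : Set (Model n)} {v f : Model n → ℝ} (hv : IsTest O v)
    (hf : ∀ y ∈ O, ContDiffAt ℝ ∞ f y) : IsTest O (fun z ↦ v z * f z) :=
  .of_compact hv.2.isCompact hv.3 (fun y hy ↦ hv.1.contDiffAt.mul (hf y hy)) fun y hy ↦ by
    rw [image_eq_zero_of_notMem_tsupport hy, zero_mul]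

theorem IsTest.const_mul {O : Set (Model n)} {v : Model n → ℝ} (hv : IsTest O v) (a : ℝ) :
    IsTest O (fun z ↦ a * v z) := by
  simpa only [mul_comm] using hv.mul (f := fun _ ↦ a) fun _ _ ↦ contDiffAt_const

theorem IsTest.sub {O : Set (Model n)} {v w : Model n → ℝ} (hv : IsTest O v) (hw : IsTest O w) :
    IsTest O (fun z ↦ v z - w z) := by
  simpa [sub_eq_add_neg] using hv.add (hw.const_mul (-1))

theorem IsTest.sum {O : Set (Model n)} {ι : Type*} {s : Finset ι} {v : ι → Model n → ℝ}
    (hv : ∀ k ∈ s, IsTest O (v k)) : IsTest O (fun z ↦ ∑ k ∈ s, v k z) := by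
  classical
  induction s using Finset.induction_on with
  | empty => simpa using IsTest.zero O
  | insert a s ha ih =>
    simp only [Finset.sum_insert ha]
    exact (hv a (Finset.mem_insert_self a s)).add
      (ih fun k hk ↦ hv k (Finset.mem_insert_of_mem hk))

theorem IsTest.pd {O : Set (Model n)} {v : Model n → ℝ} (hv : IsTest O v) (i : Fin n) :
    IsTest O (pd i v) :=
  .of_compact hv.2.isCompact hv.3 (fun _ _ ↦ contDiffAt_pd hv.1.contDiffAt i) fun _ hy ↦
    pd_eq_zero_of_eventually (notMem_tsupport_iff_eventuallyEq.mp hy)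

theorem IsTest.integrable {O : Set (Model n)} {v : Model n → ℝ} (hv : IsTest O v) :
    Integrable v :=
  hv.1.continuous.integrable_of_hasCompactSupport hv.2

/-- The divergence theorem for compactly supported functions. -/
theorem IsTest.integral_pd {O : Set (Model n)} {v : Model n → ℝ} (hv : IsTest O v) (i : Fin n) :
    ∫ y, HarmId.pd i v y = 0 := by
  have hi : Integrable (fun x ↦ fderiv ℝ v x (EuclideanSpace.single i 1))
      (volume : Measure (Model n)) := (hv.pd i).integrable
  have h := integral_mul_fderiv_eq_neg_fderiv_mul_of_integrable (μ := (volume : Measure (Model n)))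
    (f := fun _ ↦ (1 : ℝ)) (g := v) (v := EuclideanSpace.single i (1 : ℝ)) (by simp)
    (by simpa using hi) (by simpa using hv.integrable)
    (fun _ _ ↦ differentiableAt_const _) fun y _ ↦ hv.differentiableAt y
  simpa [HarmId.pd] using h

/-- Entrywise smoothness of a matrix field on a set. -/
def SmoothMat (O : Set (Model n)) (A : Model n → Matrix (Fin n) (Fin n) ℝ) : Prop :=
  ∀ y ∈ O, ∀ i j, ContDiffAt ℝ ∞ (fun z ↦ A z i j) y

theorem SmoothMat.entryDiff {O : Set (Model n)} {A : Model n → Matrix (Fin n) (Fin n) ℝ}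
    (hA : SmoothMat O A) {y : Model n} (hy : y ∈ O) : EntryDiff A y :=
  fun i j ↦ (hA y hy i j).differentiableAt (by simp)

theorem contDiffAt_det {A : Model n → Matrix (Fin n) (Fin n) ℝ} {y : Model n}
    (hA : ∀ i j, ContDiffAt ℝ ∞ (fun z ↦ A z i j) y) : ContDiffAt ℝ ∞ (fun z ↦ (A z).det) y := by
  simp only [Matrix.det_apply]
  exact ContDiffAt.sum fun σ _ ↦ ContDiffAt.const_smul _ (contDiffAt_prod fun i _ ↦ hA (σ i) i)

theorem SmoothMat.inv {O : Set (Model n)} {A : Model n → Matrix (Fin n) (Fin n) ℝ}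
    (hA : SmoothMat O A) (h : ∀ y ∈ O, (A y).det ≠ 0) : SmoothMat O (fun z ↦ (A z)⁻¹) := by
  intro y hy i j
  simp only [Matrix.inv_def, Matrix.smul_apply, Ring.inverse_eq_inv', smul_eq_mul,
    Matrix.adjugate_apply]
  refine ((contDiffAt_det (hA y hy)).inv (h y hy)).mul (contDiffAt_det fun k l ↦ ?_)
  by_cases hk : k = j
  · subst hk
    simpa using contDiffAt_const
  · simpa [Matrix.updateRow_ne hk] using hA y hy k l

theorem SmoothMat.mul {O : Set (Model n)} {A B : Model n → Matrix (Fin n) (Fin n) ℝ}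
    (hA : SmoothMat O A) (hB : SmoothMat O B) : SmoothMat O (fun z ↦ A z * B z) := by
  intro y hy i j
  simp only [Matrix.mul_apply]
  exact ContDiffAt.sum fun k _ ↦ (hA y hy i k).mul (hB y hy k j)

theorem SmoothMat.trace {O : Set (Model n)} {A : Model n → Matrix (Fin n) (Fin n) ℝ}
    (hA : SmoothMat O A) {y : Model n} (hy : y ∈ O) :
    ContDiffAt ℝ ∞ (fun z ↦ (A z).trace) y :=
  ContDiffAt.sum fun i _ ↦ hA y hy i i

theorem SmoothMat.pdM {O : Set (Model n)} {A : Model n → Matrix (Fin n) (Fin n) ℝ}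
    (hA : SmoothMat O A) (k : Fin n) : SmoothMat O (pdM k A) :=
  fun y hy i j ↦ contDiffAt_pd (hA y hy i j) k

/-- Smooth Riemannian metrics on a coordinate domain. Of the positivity only `det G > 0` is
recorded, which is what the inverse metric and the volume density need. -/
structure IsMetricOn (O : Set (Model n)) (G : Model n → Matrix (Fin n) (Fin n) ℝ) : Prop where
  smooth : SmoothMat O G
  symm : ∀ y ∈ O, (G y).IsSymm
  det_pos : ∀ y ∈ O, 0 < (G y).det

/-- Smooth symmetric two-tensor fields on a coordinate domain. -/
structure IsTensorOn (O : Set (Model n)) (B : Model n → Matrix (Fin n) (Fin n) ℝ) : Prop where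
  smooth : SmoothMat O B
  symm : ∀ y ∈ O, (B y).IsSymm

theorem IsMetricOn.sqrt_det {O : Set (Model n)} {G : Model n → Matrix (Fin n) (Fin n) ℝ}
    (hG : IsMetricOn O G) {y : Model n} (hy : y ∈ O) :
    ContDiffAt ℝ ∞ (fun z ↦ √(G z).det) y :=
  (contDiffAt_det (hG.smooth y hy)).sqrt (hG.det_pos y hy).ne'

theorem IsMetricOn.inv {O : Set (Model n)} {G : Model n → Matrix (Fin n) (Fin n) ℝ}
    (hG : IsMetricOn O G) : SmoothMat O (fun z ↦ (G z)⁻¹) :=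
  hG.smooth.inv fun y hy ↦ (hG.det_pos y hy).ne'

theorem smooth_sqrt_det_mul_defect {O : Set (Model n)} (hO : IsOpen O)
    {G B : Model n → Matrix (Fin n) (Fin n) ℝ} (hG : IsMetricOn O G) (hB : IsTensorOn O B)
    (j : Fin n) {y : Model n} (hy : y ∈ O) :
    ContDiffAt ℝ ∞ (fun z ↦ √(G z).det * defect G B j z) y := by
  have h : (fun z ↦ √(G z).det * defect G B j z) =ᶠ[nhds y]
      fun z ↦ 1 / 2 * √(G z).det * ((G z)⁻¹ * pdM j B z).trace
        - ∑ i, pd i (fun z ↦ √(G z).det * ((G z)⁻¹ * B z) i j) z := by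
    filter_upwards [hO.mem_nhds hy] with z hz
    exact sqrt_det_mul_defect (hG.smooth.entryDiff hz) (hB.smooth.entryDiff hz) (hG.det_pos z hz)
      (by filter_upwards [hO.mem_nhds hz] with x hx using hG.symm x hx)
      (by filter_upwards [hO.mem_nhds hz] with x hx using hB.symm x hx) j
  refine ContDiffAt.congr_of_eventuallyEq ?_ h
  refine ((contDiffAt_const.mul (hG.sqrt_det hy)).mul
    ((hG.inv.mul (hB.smooth.pdM j)).trace hy)).sub (ContDiffAt.sum fun i _ ↦ contDiffAt_pd ?_ i)
  exact (hG.sqrt_det hy).mul (hG.inv.mul hB.smooth y hy i j)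

theorem trLie_eq_zero {G B : Model n → Matrix (Fin n) (Fin n) ℝ} {X : Fin n → Model n → ℝ}
    {y : Model n} (hX : ∀ k, X k =ᶠ[nhds y] fun _ ↦ 0) : trLie G B X y = 0 := by
  have h1 : jac X y = 0 := by
    ext k i
    exact pd_eq_zero_of_eventually (hX k)
  have h2 : ∀ k, X k y = 0 := fun k ↦ (hX k).self_of_nhds
  simp [trLie, lie, h1, h2]

/-- The first variation formula in a coordinate domain: the compactly supported divergence in
`sqrt_det_mul_trLie` integrates to zero. -/
theorem integral_trLie {O : Set (Model n)} (hO : IsOpen O)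
    {G B : Model n → Matrix (Fin n) (Fin n) ℝ} (hG : IsMetricOn O G) (hB : IsTensorOn O B)
    {X : Fin n → Model n → ℝ} (hX : ∀ k, IsTest O (X k)) :
    ∫ y, √(G y).det * trLie G B X y = 2 * ∫ y, ∑ k, X k y * (√(G y).det * defect G B k y) := by
  have hW : ∀ i, IsTest O (fun z ↦ ∑ k, √(G z).det * ((G z)⁻¹ * B z) i k * X k z) := by
    intro i
    refine IsTest.sum fun k _ ↦ ?_
    have := (hX k).mul (f := fun z ↦ √(G z).det * ((G z)⁻¹ * B z) i k) fun y hy ↦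
      (hG.sqrt_det hy).mul (hG.inv.mul hB.smooth y hy i k)
    simpa only [mul_comm] using this
  have hD : IsTest O (fun y ↦ ∑ k, X k y * (√(G y).det * defect G B k y)) :=
    IsTest.sum fun k _ ↦ (hX k).mul fun y hy ↦ smooth_sqrt_det_mul_defect hO hG hB k hy
  have h : ∀ y, √(G y).det * trLie G B X y
      = 2 * ∑ i, pd i (fun z ↦ ∑ k, √(G z).det * ((G z)⁻¹ * B z) i k * X k z) y
        + 2 * ∑ k, X k y * (√(G y).det * defect G B k y) := by
    intro y
    by_cases hy : y ∈ O
    · exact sqrt_det_mul_trLie (hG.smooth.entryDiff hy) (hB.smooth.entryDiff hy)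
        (fun k ↦ (hX k).differentiableAt y) (hG.det_pos y hy)
        (by filter_upwards [hO.mem_nhds hy] with x hx using hG.symm x hx)
        (by filter_upwards [hO.mem_nhds hy] with x hx using hB.symm x hx)
    · rw [trLie_eq_zero fun k ↦ (hX k).eventually_eq_zero hy]
      have h1 : ∀ i, pd i (fun z ↦ ∑ k, √(G z).det * ((G z)⁻¹ * B z) i k * X k z) y = 0 :=
        fun i ↦ pd_eq_zero_of_eventually ((hW i).eventually_eq_zero hy)
      simp [h1, (hX _).eq_zero hy]
  simp only [h]
  have hs : IsTest O (fun y ↦ ∑ i,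
      pd i (fun z ↦ ∑ k, √(G z).det * ((G z)⁻¹ * B z) i k * X k z) y) :=
    IsTest.sum fun i _ ↦ (hW i).pd i
  rw [integral_add (hs.integrable.const_mul 2) (hD.integrable.const_mul 2), integral_const_mul,
    integral_const_mul, integral_finsetSum _ fun i _ ↦ ((hW i).pd i).integrable]
  simp [(hW _).integral_pd]

/-- The weak form of the harmonicity equation implies the pointwise one. -/
theorem defect_eq_zero_of_integral {O : Set (Model n)} (hO : IsOpen O)
    {G B : Model n → Matrix (Fin n) (Fin n) ℝ} (hG : IsMetricOn O G) (hB : IsTensorOn O B)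
    (h : ∀ X : Fin n → Model n → ℝ, (∀ k, IsTest O (X k)) → ∫ y, √(G y).det * trLie G B X y = 0)
    {y : Model n} (hy : y ∈ O) (j : Fin n) : defect G B j y = 0 := by
  set f : Model n → ℝ := fun y ↦ √(G y).det * defect G B j y with hf
  have hfc : ContinuousOn f O := fun z hz ↦
    (smooth_sqrt_det_mul_defect hO hG hB j hz).continuousAt.continuousWithinAt
  have hae : ∀ᵐ z ∂(volume : Measure (Model n)), z ∈ O → f z = 0 := by
    refine hO.ae_eq_zero_of_integral_contDiff_smul_eq_zero
      (hfc.locallyIntegrableOn hO.measurableSet) fun u hu1 hu2 hu3 ↦ ?_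
    have hu : IsTest O u := ⟨hu1, hu2, hu3⟩
    have hX : ∀ k, IsTest O ((fun k z ↦ if k = j then u z else 0 : Fin n → Model n → ℝ) k) := by
      intro k
      by_cases hk : k = j
      · simpa [hk] using hu
      · simpa [hk] using IsTest.zero O
    have h1 := integral_trLie hO hG hB hX
    rw [h _ hX] at h1
    simp only [ite_mul, zero_mul, Finset.sum_ite_eq', Finset.mem_univ, if_true] at h1
    simpa [hf] using h1.symm
  have h0 : f y = 0 := by
    by_contra hne
    have hev : ∀ᶠ z in nhds y, z ∈ O ∧ f z ≠ 0 := by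
      filter_upwards [hO.mem_nhds hy, (hfc.continuousAt (hO.mem_nhds hy)).eventually_ne hne]
        with z h1 h2 using ⟨h1, h2⟩
    obtain ⟨U, hU, hUo, hyU⟩ := eventually_nhds_iff.mp hev
    have hz : (volume : Measure (Model n)) U = 0 := by
      refine measure_mono_null (fun z hz ↦ ?_) hae
      exact fun hcon ↦ (hU z hz).2 (hcon (hU z hz).1)
    exact (hUo.measure_pos volume ⟨y, hyU⟩).ne' hz
  exact (mul_eq_zero.mp h0).resolve_left (Real.sqrt_pos.mpr (hG.det_pos y hy)).ne'

theorem jacM_symm_mul {e : OpenPartialHomeomorph (Model n) (Model n)} {y : Model n}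
    (hy : y ∈ e.source) (he : DifferentiableAt ℝ e y) (hes : DifferentiableAt ℝ e.symm (e y)) :
    jacM e.symm (e y) * jacM e y = 1 := by
  rw [← jacM_comp hes he, ← jacM_id y]
  refine jacM_congr ?_
  filter_upwards [e.open_source.mem_nhds hy] with z hz using e.left_inv hz

/-- Invariance of the harmonicity equation under a change of coordinates. -/
theorem defect_eq_zero_of_pullback (e : OpenPartialHomeomorph (Model n) (Model n))
    (he : ∀ y ∈ e.source, ContDiffAt ℝ ∞ e y) (hes : ∀ z ∈ e.target, ContDiffAt ℝ ∞ e.symm z)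
    {G B G' B' : Model n → Matrix (Fin n) (Fin n) ℝ}
    (hG' : IsMetricOn e.target G') (hB' : IsTensorOn e.target B')
    (hG : IsMetricOn e.source G) (hB : IsTensorOn e.source B)
    (hGG : ∀ y ∈ e.source, G y = (jacM e y)ᵀ * G' (e y) * jacM e y)
    (hBB : ∀ y ∈ e.source, B y = (jacM e y)ᵀ * B' (e y) * jacM e y)
    (h : ∀ z ∈ e.target, ∀ j, defect G' B' j z = 0) {y : Model n} (hy : y ∈ e.source)
    (j : Fin n) : defect G B j y = 0 := by
  classical
  have hed : ∀ y ∈ e.source, DifferentiableAt ℝ e y := fun y hy ↦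
    (he y hy).differentiableAt (by simp)
  have hesd : ∀ z ∈ e.target, DifferentiableAt ℝ e.symm z := fun y hy ↦
    (hes y hy).differentiableAt (by simp)
  refine defect_eq_zero_of_integral e.open_source hG hB (fun X hX ↦ ?_) hy j
  set X' : Fin n → Model n → ℝ := fun k z ↦ if z ∈ e.target then
    ∑ i, jacM e (e.symm z) k i * X i (e.symm z) else 0 with hX'def
  set K : Set (Model n) := ⋃ i, tsupport (X i) with hK
  have hKc : IsCompact K := isCompact_iUnion fun i ↦ (hX i).hasCompactSupport
  have hKs : K ⊆ e.source := Set.iUnion_subset fun i ↦ (hX i).tsupport_subset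
  have hX' : ∀ k, IsTest e.target (X' k) := by
    intro k
    refine .of_compact (hKc.image_of_continuousOn (e.continuousOn.mono hKs))
      (Set.image_subset_iff.mpr fun z hz ↦ e.map_source (hKs hz)) (fun z hz ↦ ?_) fun z hz ↦ ?_
    · have : X' k =ᶠ[nhds z] fun z ↦ ∑ i, jacM e (e.symm z) k i * X i (e.symm z) := by
        filter_upwards [e.open_target.mem_nhds hz] with x hx
        simp [hX'def, hx]
      refine ContDiffAt.congr_of_eventuallyEq (ContDiffAt.sum fun i _ ↦ ?_) this
      exact ((contDiffAt_jacM (he _ (e.map_target hz)) k i).comp z (hes z hz)).mul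
        ((hX i).contDiff.contDiffAt.comp z (hes z hz))
    · by_cases hzt : z ∈ e.target
      · simp only [hX'def, hzt, if_true]
        refine Finset.sum_eq_zero fun i _ ↦ ?_
        have h0 : X i (e.symm z) = 0 := image_eq_zero_of_notMem_tsupport fun hcon ↦
          hz ⟨e.symm z, Set.mem_iUnion.mpr ⟨i, hcon⟩, e.right_inv hzt⟩
        rw [h0, mul_zero]
      · simp [hX'def, hzt]
  have h1 : ∀ y ∈ e.source, √(G y).det * trLie G B X y
      = |(fderiv ℝ e y).det| • (√(G' (e y)).det * trLie G' B' X' (e y)) := by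
    intro y hy
    have hJ : (jacM e y).det ≠ 0 := by
      intro h0
      have := congrArg Matrix.det
        (jacM_symm_mul hy (hed y hy) (hesd _ (e.map_source hy)))
      rw [Matrix.det_mul, h0, mul_zero, Matrix.det_one] at this
      exact zero_ne_one this
    rw [det_fderiv (hed y hy), smul_eq_mul, ← mul_assoc, ← sqrt_det_pullback, ← hGG y hy,
      trLie_pullback (he y hy) (hB'.smooth.entryDiff (e.map_source hy))
        (fun k ↦ (hX k).differentiableAt y) (fun k ↦ (hX' k).differentiableAt _) hJ (hGG y hy)]
    · filter_upwards [e.open_source.mem_nhds hy] with z hz using hBB z hz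
    · filter_upwards [e.open_source.mem_nhds hy] with z hz k
      simp [hX'def, e.map_source hz, e.left_inv hz]
  have h2 : ∫ y in e.source, √(G y).det * trLie G B X y
      = ∫ y, √(G y).det * trLie G B X y :=
    setIntegral_eq_integral_of_forall_compl_eq_zero fun z hz ↦ by
      rw [trLie_eq_zero fun k ↦ (hX k).eventually_eq_zero hz, mul_zero]
  have h3 : ∫ z in e.target, √(G' z).det * trLie G' B' X' z
      = ∫ z, √(G' z).det * trLie G' B' X' z :=
    setIntegral_eq_integral_of_forall_compl_eq_zero fun z hz ↦ by
      rw [trLie_eq_zero fun k ↦ (hX' k).eventually_eq_zero hz, mul_zero]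
  rw [← h2, setIntegral_congr_fun e.open_source.measurableSet h1,
    ← integral_image_eq_integral_abs_det_fderiv_smul volume e.open_source.measurableSet
      (fun y hy ↦ (hed y hy).hasFDerivAt.hasFDerivWithinAt) e.injOn
      (fun z ↦ √(G' z).det * trLie G' B' X' z), e.image_source_eq_target, h3,
    integral_trLie e.open_target hG' hB' hX']
  have h4 : ∀ z, ∑ k, X' k z * (√(G' z).det * defect G' B' k z) = 0 := by
    intro z
    refine Finset.sum_eq_zero fun k _ ↦ ?_
    by_cases hz : z ∈ e.target
    · rw [h z hz k, mul_zero, mul_zero]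
    · rw [(hX' k).eq_zero hz, zero_mul]
  simp [h4]

end TestFunctions

/-! ### Local flows of smooth vector fields -/

section Flow

universe u

variable {U V W : Type u} [NormedAddCommGroup U] [NormedSpace ℝ U] [NormedAddCommGroup V]
  [NormedSpace ℝ V] [NormedAddCommGroup W] [NormedSpace ℝ W]

/-- The pointwise application `(A, h) ↦ (t ↦ B (A t) (h t))` of a continuous bilinear map to curves,
as a continuous bilinear map. -/
def pointwise (B : U →L[ℝ] V →L[ℝ] W) :
    C(unitInterval, U) →L[ℝ] C(unitInterval, V) →L[ℝ] C(unitInterval, W) :=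
  LinearMap.mkContinuous₂ (E := C(unitInterval, U)) (F := C(unitInterval, V))
    (G := C(unitInterval, W))
    (LinearMap.mk₂ ℝ (fun (A : C(unitInterval, U)) (h : C(unitInterval, V)) ↦
        (⟨fun t ↦ B (A t) (h t), (B.continuous.comp A.continuous).clm_apply h.continuous⟩ :
          C(unitInterval, W)))
      (fun _ _ _ ↦ by ext; simp) (fun _ _ _ ↦ by ext; simp) (fun _ _ _ ↦ by ext; simp)
      (fun _ _ _ ↦ by ext; simp)) ‖B‖ fun A h ↦ by
    rw [ContinuousMap.norm_le _ (by positivity)]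
    exact fun t ↦ B.le_of_opNorm₂_le_of_le le_rfl (A.norm_coe_le_norm t) (h.norm_coe_le_norm t)

/-- The superposition operator `γ ↦ f ∘ γ` on curves. -/
def superposition {V W : Type*} [TopologicalSpace V] [TopologicalSpace W] (f : C(V, W))
    (γ : C(unitInterval, V)) : C(unitInterval, W) := f.comp γ

theorem hasFDerivAt_superposition {f : V → W} (hf : ContDiff ℝ 1 f)
    (hu : UniformContinuous (fderiv ℝ f)) (B : U →L[ℝ] V →L[ℝ] W) (f' : C(V, U))
    (hf' : ∀ x, fderiv ℝ f x = B (f' x)) (γ : C(unitInterval, V)) :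
    HasFDerivAt (superposition ⟨f, hf.continuous⟩) (pointwise B (superposition f' γ)) γ := by
  rw [hasFDerivAt_iff_isLittleO_nhds_zero, Asymptotics.isLittleO_iff]
  intro ε hε
  obtain ⟨δ, hδ, hδ'⟩ := Metric.uniformContinuous_iff.mp hu ε hε
  filter_upwards [Metric.ball_mem_nhds (0 : C(unitInterval, V)) hδ] with h hh
  rw [ContinuousMap.norm_le _ (by positivity)]
  intro t
  have hht : ‖h t‖ < δ := (h.norm_coe_le_norm t).trans_lt (by simpa using hh)
  have key : ‖f (γ t + h t) - f (γ t) - fderiv ℝ f (γ t) (γ t + h t - γ t)‖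
      ≤ ε * ‖γ t + h t - γ t‖ := by
    refine (convex_ball (γ t) δ).norm_image_sub_le_of_norm_fderiv_le' (𝕜 := ℝ)
      (fun x _ ↦ (hf.differentiable one_ne_zero) x) (fun x hx ↦ ?_) (Metric.mem_ball_self hδ)
      (by simpa using hht)
    rw [← dist_eq_norm]
    exact (hδ' (by simpa using hx)).le
  rw [add_sub_cancel_left, hf'] at key
  exact key.trans (mul_le_mul_of_nonneg_left (h.norm_coe_le_norm t) hε.le)

set_option synthInstance.maxHeartbeats 400000 in
theorem contDiff_pointwise_comp {Y : Type u} [NormedAddCommGroup Y] [NormedSpace ℝ Y]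
    {k : WithTop ℕ∞} (B : U →L[ℝ] V →L[ℝ] W)
    {g : Y → C(unitInterval, U)} (hg : ContDiff ℝ k g) :
    ContDiff ℝ k fun γ ↦ pointwise B (g γ) := by
  have h : ContDiff ℝ k fun A : C(unitInterval, U) ↦ pointwise B A := by
    refine IsBoundedLinearMap.contDiff ⟨⟨fun _ _ ↦ map_add _ _ _, fun _ _ ↦ map_smul _ _ _⟩,
      ‖B‖ + 1, by positivity, fun A ↦ ContinuousLinearMap.opNorm_le_bound _ (by positivity)
        fun h ↦ ?_⟩
    rw [ContinuousMap.norm_le _ (by positivity)]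
    intro t
    exact B.le_of_opNorm₂_le_of_le (by linarith) (A.norm_coe_le_norm t) (h.norm_coe_le_norm t)
  exact h.comp hg

theorem contDiff_superposition_nat (k : ℕ) : ∀ {W : Type u} [NormedAddCommGroup W]
    [NormedSpace ℝ W] {f : V → W} (hf : ContDiff ℝ ∞ f) (_ : HasCompactSupport f),
    ContDiff ℝ k (superposition ⟨f, hf.continuous⟩) := by
  induction k with
  | zero =>
    intro W _ _ f hf _
    exact contDiff_zero.mpr (ContinuousMap.continuous_postcomp _)
  | succ k ih =>
    intro W _ _ f hf hs
    have h1 : ContDiff ℝ 1 f := hf.of_le (by simp)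
    have hd : ContDiff ℝ ∞ (fderiv ℝ f) := hf.fderiv_right (by simp)
    rw [Nat.cast_add, Nat.cast_one, contDiff_succ_iff_hasFDerivAt]
    exact ⟨fun γ ↦ pointwise (ContinuousLinearMap.id ℝ (V →L[ℝ] W))
        (superposition ⟨fderiv ℝ f, hd.continuous⟩ γ),
      contDiff_pointwise_comp _ (ih hd (hs.fderiv ℝ)), fun γ ↦ hasFDerivAt_superposition h1
        ((hs.fderiv ℝ).uniformContinuous_of_continuous hd.continuous) _ _ (fun _ ↦ rfl) γ⟩

theorem contDiff_superposition {f : V → W} (hf : ContDiff ℝ ∞ f) (hs : HasCompactSupport f) :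
    ContDiff ℝ ∞ (superposition ⟨f, hf.continuous⟩) :=
  contDiff_infty.mpr fun k ↦ contDiff_superposition_nat k hf hs

theorem continuous_extend {V : Type*} [NormedAddCommGroup V] (η : C(unitInterval, V)) :
    Continuous fun s ↦ η (Set.projIcc 0 1 zero_le_one s) :=
  η.continuous.comp continuous_projIcc

/-- The primitive `t ↦ ∫₀ᵗ η` of a curve. -/
def primitive : C(unitInterval, V) →L[ℝ] C(unitInterval, V) :=
  LinearMap.mkContinuous
    { toFun := fun η ↦ ⟨fun t ↦ ∫ s in (0 : ℝ)..t, η (Set.projIcc 0 1 zero_le_one s),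
        (intervalIntegral.continuous_primitive
          (fun a b ↦ (continuous_extend η).intervalIntegrable a b) 0).comp continuous_subtype_val⟩
      map_add' := fun η ξ ↦ by
        ext t
        exact intervalIntegral.integral_add ((continuous_extend η).intervalIntegrable _ _)
          ((continuous_extend ξ).intervalIntegrable _ _)
      map_smul' := fun a η ↦ by
        ext t
        exact intervalIntegral.integral_smul _ _ } 1 fun η ↦ by
    rw [ContinuousMap.norm_le _ (by positivity), one_mul]
    intro t
    have := intervalIntegral.norm_integral_le_of_norm_le_const (a := 0) (b := (t : ℝ))
      (f := fun s ↦ η (Set.projIcc 0 1 zero_le_one s)) (C := ‖η‖)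
      fun s _ ↦ η.norm_coe_le_norm _
    refine this.trans ?_
    rw [sub_zero, abs_of_nonneg t.2.1]
    exact mul_le_of_le_one_right (norm_nonneg _) t.2.2

theorem primitive_apply (η : C(unitInterval, V)) (t : unitInterval) :
    primitive η t = ∫ s in (0 : ℝ)..t, η (Set.projIcc 0 1 zero_le_one s) := rfl

theorem norm_primitive_le (η : C(unitInterval, V)) : ‖primitive η‖ ≤ ‖η‖ := by
  simpa using LinearMap.mkContinuous_norm_le _ zero_le_one _ |> fun h ↦
    (primitive (V := V)).le_of_opNorm_le h η

/-- The integral equation `γ(t) = x + τ ∫₀ᵗ f(γ)` of the flow of `f`, with the time rescaled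
to `[0, 1]`. -/
def IsFlowCurve (f : C(V, V)) (τ : ℝ) (x : V) (γ : C(unitInterval, V)) : Prop :=
  γ = ContinuousMap.const _ x + τ • primitive (superposition f γ)

theorem norm_superposition_sub_le {V : Type*} [NormedAddCommGroup V] {f : C(V, V)} {L : NNReal}
    (hL : LipschitzWith L f)
    (γ γ' : C(unitInterval, V)) :
    ‖superposition f γ - superposition f γ'‖ ≤ L * ‖γ - γ'‖ := by
  rw [ContinuousMap.norm_le _ (by positivity)]
  intro t
  refine (hL.norm_sub_le (γ t) (γ' t)).trans ?_
  gcongr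
  exact (γ - γ').norm_coe_le_norm t

theorem norm_smul_primitive_sub_le {f : C(V, V)} {L : NNReal} (hL : LipschitzWith L f) (τ : ℝ)
    (γ γ' : C(unitInterval, V)) :
    ‖τ • primitive (superposition f γ) - τ • primitive (superposition f γ')‖
      ≤ |τ| * L * ‖γ - γ'‖ := by
  rw [← smul_sub, ← map_sub, norm_smul, Real.norm_eq_abs, mul_assoc]
  gcongr
  exact (norm_primitive_le _).trans (norm_superposition_sub_le hL γ γ')

theorem IsFlowCurve.unique {f : C(V, V)} {L : NNReal} (hL : LipschitzWith L f) {τ : ℝ}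
    (hτ : |τ| * L < 1) {x : V} {γ γ' : C(unitInterval, V)} (h : IsFlowCurve f τ x γ)
    (h' : IsFlowCurve f τ x γ') : γ = γ' := by
  have h1 : ‖γ - γ'‖ ≤ |τ| * L * ‖γ - γ'‖ := by
    have := norm_smul_primitive_sub_le hL τ γ γ'
    rwa [show τ • primitive (superposition f γ) - τ • primitive (superposition f γ') = γ - γ' by
      conv_rhs => rw [h, h']
      abel] at this
  have h2 : ‖γ - γ'‖ = 0 := by nlinarith [norm_nonneg (γ - γ')]
  exact sub_eq_zero.mp (norm_eq_zero.mp h2)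

theorem exists_isFlowCurve [CompleteSpace V] {f : C(V, V)} {L : NNReal} (hL : LipschitzWith L f)
    {τ : ℝ} (hτ : |τ| * L < 1) (x : V) : ∃ γ, IsFlowCurve f τ x γ := by
  have hc : ContractingWith (⟨|τ|, abs_nonneg τ⟩ * L) (fun γ : C(unitInterval, V) ↦
      ContinuousMap.const _ x + τ • primitive (superposition f γ)) := by
    refine ⟨by exact_mod_cast hτ, LipschitzWith.of_dist_le_mul fun γ γ' ↦ ?_⟩
    rw [dist_eq_norm, dist_eq_norm, add_sub_add_left_eq_sub]
    exact norm_smul_primitive_sub_le hL τ γ γ'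
  exact ⟨hc.fixedPoint _, hc.fixedPoint_isFixedPt.symm⟩

/-- An initial part of a flow curve, reparametrized to the unit interval, is a flow curve. -/
theorem IsFlowCurve.rescale [CompleteSpace V] {f : C(V, V)} {τ : ℝ} {x : V}
    {γ : C(unitInterval, V)} (h : IsFlowCurve f τ x γ) (σ : unitInterval) :
    IsFlowCurve f (σ * τ) x ⟨fun t ↦ γ (σ * t), by fun_prop⟩ := by
  ext t
  have h1 := DFunLike.congr_fun h (σ * t)
  simp only [ContinuousMap.add_apply, ContinuousMap.const_apply, ContinuousMap.smul_apply,
    primitive_apply] at h1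
  simp only [ContinuousMap.coe_mk, ContinuousMap.add_apply, ContinuousMap.const_apply,
    ContinuousMap.smul_apply, primitive_apply]
  rw [h1, mul_comm (σ : ℝ) τ, mul_smul]
  congr 2
  have h2 := intervalIntegral.smul_integral_comp_mul_left (a := 0) (b := (t : ℝ))
    (fun s ↦ superposition f γ (Set.projIcc 0 1 zero_le_one s)) (σ : ℝ)
  rw [mul_zero] at h2
  rw [Set.Icc.coe_mul, ← h2]
  congr 1
  refine intervalIntegral.integral_congr fun s hs ↦ ?_
  rw [Set.uIcc_of_le t.2.1] at hs
  have hs1 : s ∈ Set.Icc (0 : ℝ) 1 := ⟨hs.1, hs.2.trans t.2.2⟩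
  have e1 : Set.projIcc (0 : ℝ) 1 zero_le_one s = ⟨s, hs1⟩ := Set.projIcc_of_mem zero_le_one hs1
  have e2 : Set.projIcc (0 : ℝ) 1 zero_le_one (σ * s) = σ * ⟨s, hs1⟩ :=
    Set.projIcc_of_mem zero_le_one (unitInterval.mul_mem σ.2 hs1)
  simp only [e1, e2]
  rfl

theorem contDiff_const_curve : ContDiff ℝ ∞ (fun x : V ↦ ContinuousMap.const unitInterval x) := by
  let c : V →L[ℝ] C(unitInterval, V) := LinearMap.mkContinuous
    { toFun := fun x ↦ ContinuousMap.const unitInterval x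
      map_add' := fun _ _ ↦ rfl
      map_smul' := fun _ _ ↦ rfl } 1 fun x ↦ by
      rw [ContinuousMap.norm_le _ (by positivity), one_mul]
      exact fun _ ↦ le_rfl
  exact c.contDiff

set_option synthInstance.maxHeartbeats 400000 in
/-- Flow curves depend smoothly on the time and on the initial value, by the implicit function
theorem in the Banach space of curves. The derivative of the integral equation with respect to the
curve is a small perturbation of the identity. -/
theorem contDiffAt_flowCurve [CompleteSpace V] {f : V → V} (hf : ContDiff ℝ ∞ f)
    (hs : HasCompactSupport f) {L : NNReal} (hL : LipschitzWith L f)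
    (hLd : ∀ x, ‖fderiv ℝ f x‖ ≤ L) {Γ : ℝ × V → C(unitInterval, V)}
    (hΓ : ∀ q : ℝ × V, |q.1| * L < 1 → IsFlowCurve ⟨f, hf.continuous⟩ q.1 q.2 (Γ q))
    {q : ℝ × V} (hq : |q.1| * L < 1) : ContDiffAt ℝ ∞ Γ q := by
  set F : C(V, V) := ⟨f, hf.continuous⟩ with hF
  set Ψ : (ℝ × V) × C(unitInterval, V) → C(unitInterval, V) := fun p ↦
    p.2 - ContinuousMap.const _ p.1.2 - p.1.1 • primitive (superposition F p.2) with hΨ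
  have hN : ContDiff ℝ ∞ (superposition F) := contDiff_superposition hf hs
  have hΨc : ContDiff ℝ ∞ Ψ := by
    refine (contDiff_snd.sub (contDiff_const_curve.comp (contDiff_snd.comp contDiff_fst))).sub
      ((contDiff_fst.comp contDiff_fst).smul ((primitive (V := V)).contDiff.comp
        (hN.comp contDiff_snd)))
  have hd : ContDiff ℝ ∞ (fderiv ℝ f) := hf.fderiv_right (by simp)
  set D : C(unitInterval, V) →L[ℝ] C(unitInterval, V) :=
    pointwise (ContinuousLinearMap.id ℝ (V →L[ℝ] V))
      (superposition ⟨fderiv ℝ f, hd.continuous⟩ (Γ q)) with hD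
  have hND : HasFDerivAt (superposition F) D (Γ q) :=
    hasFDerivAt_superposition (hf.of_le (by simp))
      ((hs.fderiv ℝ).uniformContinuous_of_continuous hd.continuous) _ _ (fun _ ↦ rfl) _
  have hpart : HasFDerivAt (fun γ ↦ Ψ (q, γ))
      (ContinuousLinearMap.id ℝ C(unitInterval, V) - q.1 • (primitive.comp D)) (Γ q) := by
    have e1 : HasFDerivAt (fun γ : C(unitInterval, V) ↦ primitive (superposition F γ))
        (primitive.comp D) (Γ q) :=
      (primitive (V := V)).hasFDerivAt.comp (Γ q) hND
    exact ((hasFDerivAt_id (Γ q)).sub_const (ContinuousMap.const _ q.2)).sub (e1.const_smul q.1)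
  have hinr : fderiv ℝ Ψ (q, Γ q) ∘L .inr ℝ (ℝ × V) C(unitInterval, V)
      = ContinuousLinearMap.id ℝ C(unitInterval, V) - q.1 • (primitive.comp D) := by
    refine HasFDerivAt.unique ?_ hpart
    have h1 : HasFDerivAt Ψ (fderiv ℝ Ψ (q, Γ q)) (q, Γ q) :=
      (hΨc.contDiffAt.differentiableAt (by simp)).hasFDerivAt
    exact h1.comp (Γ q) (hasFDerivAt_prodMk_right q (Γ q))
  have hsmall : ‖q.1 • (primitive.comp D)‖ < 1 := by
    refine lt_of_le_of_lt (ContinuousLinearMap.opNorm_le_bound _ (by positivity) fun h ↦ ?_) hq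
    rw [_root_.smul_apply, norm_smul, Real.norm_eq_abs, mul_assoc]
    gcongr
    refine (norm_primitive_le _).trans ?_
    rw [ContinuousMap.norm_le _ (by positivity)]
    intro t
    exact (fderiv ℝ f (Γ q t)).le_of_opNorm_le_of_le (hLd _) (h.norm_coe_le_norm t)
  have hinv : (fderiv ℝ Ψ (q, Γ q) ∘L .inr ℝ (ℝ × V) C(unitInterval, V)).IsInvertible := by
    rw [hinr]
    obtain ⟨u, hu⟩ := isUnit_one_sub_of_norm_lt_one
      (R := C(unitInterval, V) →L[ℝ] C(unitInterval, V)) hsmall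
    exact ⟨ContinuousLinearEquiv.unitsEquiv ℝ _ u, by
      ext1 h
      exact DFunLike.congr_fun hu h⟩
  have hca : ContDiffAt ℝ ∞ Ψ (q, Γ q) := hΨc.contDiffAt
  refine (hca.contDiffAt_implicitFunction (by simp) hinv).congr_of_eventuallyEq ?_
  have h0 : Ψ (q, Γ q) = 0 := by
    rw [hΨ]
    simp only
    rw [sub_sub, sub_eq_zero]
    exact hΓ q hq
  have hcont : Continuous fun p : ℝ × V ↦ |p.1| * (L : ℝ) := by fun_prop
  filter_upwards [hca.eventually_apply_implicitFunction (by simp) hinv,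
    hcont.continuousAt.eventually_lt_const hq] with p hp hp'
  refine (hΓ p hp').unique hL hp' ?_
  rw [h0] at hp
  simp only [hΨ] at hp
  rw [sub_sub, sub_eq_zero] at hp
  exact hp

/-- A smooth vector field with compact support has a smooth flow for small times. -/
theorem exists_flow_of_hasCompactSupport [CompleteSpace V] {f : V → V} (hf : ContDiff ℝ ∞ f)
    (hs : HasCompactSupport f) : ∃ (τ₀ : ℝ) (Φ : ℝ × V → V), 0 < τ₀ ∧ (∀ x, Φ (0, x) = x) ∧
      ∀ q : ℝ × V, |q.1| < τ₀ → ContDiffAt ℝ ∞ Φ q ∧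
        HasDerivAt (fun s ↦ Φ (s, q.2)) (f (Φ q)) q.1 := by
  classical
  have hdc : Continuous (fderiv ℝ f) := hf.continuous_fderiv (by simp)
  obtain ⟨C, hC⟩ := (hs.fderiv ℝ).exists_bound_of_continuous hdc
  have hC0 : 0 ≤ C := (norm_nonneg _).trans (hC 0)
  set L : NNReal := ⟨C, hC0⟩ with hLdef
  have hL : LipschitzWith L f := lipschitzWith_of_nnnorm_fderiv_le
    (hf.differentiable (by simp)) fun x ↦ hC x
  set F : C(V, V) := ⟨f, hf.continuous⟩ with hF
  have hsmall : ∀ τ : ℝ, |τ| < 1 / (C + 1) → |τ| * (L : ℝ) < 1 := by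
    intro τ hτ
    rw [lt_div_iff₀ (by linarith)] at hτ
    have : |τ| * C ≤ |τ| * (C + 1) := by nlinarith [abs_nonneg τ]
    exact this.trans_lt hτ
  have hex : ∀ q : ℝ × V, ∃ γ, |q.1| * (L : ℝ) < 1 → IsFlowCurve F q.1 q.2 γ := by
    intro q
    by_cases hq : |q.1| * (L : ℝ) < 1
    · obtain ⟨γ, hγ⟩ := exists_isFlowCurve (f := F) hL hq q.2
      exact ⟨γ, fun _ ↦ hγ⟩
    · exact ⟨0, fun h ↦ absurd h hq⟩
  choose Γ hΓ using hex
  have hev : ContDiff ℝ ∞ fun γ : C(unitInterval, V) ↦ γ 1 := by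
    refine IsBoundedLinearMap.contDiff ⟨⟨fun _ _ ↦ rfl, fun _ _ ↦ rfl⟩, 1, one_pos, fun γ ↦ ?_⟩
    rw [one_mul]
    exact γ.norm_coe_le_norm 1
  have hsm : ∀ q : ℝ × V, |q.1| * (L : ℝ) < 1 → ContDiffAt ℝ ∞ (fun q ↦ Γ q 1) q := fun q hq ↦
    hev.contDiffAt.comp q (contDiffAt_flowCurve hf hs hL hC hΓ hq)
  have hscale : ∀ (s : ℝ) (x : V), |s| * (L : ℝ) < 1 → ∀ σ : unitInterval,
      Γ (σ * s, x) 1 = Γ (s, x) σ := by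
    intro s x hs σ
    have hσ : |σ * s| * (L : ℝ) < 1 := by
      rw [abs_mul, abs_of_nonneg σ.2.1, mul_assoc]
      exact (mul_le_of_le_one_left (by positivity) σ.2.2).trans_lt hs
    have := (hΓ (σ * s, x) hσ).unique hL hσ ((hΓ (s, x) hs).rescale σ)
    rw [this]
    simp
  have hint : ∀ (s : ℝ) (x : V), |s| * (L : ℝ) < 1 →
      Γ (s, x) 1 = x + ∫ r in (0 : ℝ)..s, f (Γ (r, x) 1) := by
    intro s x hs
    have h1 := DFunLike.congr_fun (hΓ (s, x) hs) 1
    simp only [ContinuousMap.add_apply, ContinuousMap.const_apply, ContinuousMap.smul_apply,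
      primitive_apply] at h1
    rw [h1]
    congr 1
    have h2 := intervalIntegral.smul_integral_comp_mul_right (a := 0) (b := 1)
      (fun r ↦ f (Γ (r, x) 1)) s
    rw [zero_mul, one_mul] at h2
    rw [← h2]
    congr 1
    refine intervalIntegral.integral_congr fun r hr ↦ ?_
    rw [Set.Icc.coe_one, Set.uIcc_of_le zero_le_one] at hr
    have e1 : Set.projIcc (0 : ℝ) 1 zero_le_one r = ⟨r, hr⟩ := Set.projIcc_of_mem zero_le_one hr
    simp only [e1]
    exact congrArg f (hscale s x hs ⟨r, hr⟩).symm
  refine ⟨1 / (C + 1), fun q ↦ Γ q 1, by positivity, fun x ↦ ?_, fun q hq ↦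
    ⟨hsm q (hsmall _ hq), ?_⟩⟩
  · change Γ (0, x) 1 = x
    rw [hint 0 x (by simp)]
    simp
  · have hd : ∀ r : ℝ, |r| < 1 / (C + 1) → ContinuousAt (fun r ↦ f (Γ (r, q.2) 1)) r := by
      intro r hr
      have h1 : ContinuousAt (fun q ↦ Γ q 1) (r, q.2) := (hsm (r, q.2) (hsmall r hr)).continuousAt
      have h2 : ContinuousAt (fun r : ℝ ↦ Γ (r, q.2) 1) r :=
        ContinuousAt.comp (f := fun r : ℝ ↦ (r, q.2)) (g := fun q ↦ Γ q 1) h1 (by fun_prop)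
      exact hf.continuous.continuousAt.comp h2
    have hopen : IsOpen {r : ℝ | |r| < 1 / (C + 1)} := isOpen_lt continuous_abs continuous_const
    have hsub : ∀ r ∈ Set.uIcc 0 q.1, |r| < 1 / (C + 1) := by
      intro r hr
      refine lt_of_le_of_lt ?_ hq
      simpa using Set.abs_sub_left_of_mem_uIcc hr
    have hco : ContinuousOn (fun r ↦ f (Γ (r, q.2) 1)) {r : ℝ | |r| < 1 / (C + 1)} :=
      fun r hr ↦ (hd r hr).continuousWithinAt
    have h1 : HasDerivAt (fun s ↦ ∫ r in (0 : ℝ)..s, f (Γ (r, q.2) 1)) (f (Γ q 1)) q.1 :=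
      intervalIntegral.integral_hasDerivAt_right
        (hco.mono hsub).intervalIntegrable
        (hco.stronglyMeasurableAtFilter hopen _ hq) (hd q.1 hq)
    refine (h1.const_add q.2).congr_of_eventuallyEq ?_
    filter_upwards [hopen.mem_nhds hq] with s hs
    exact hint s q.2 (hsmall s hs)

/-- Existence of smooth local flows of smooth vector fields. -/
theorem exists_local_flow [FiniteDimensional ℝ V] {f : V → V} {O : Set V} (hO : IsOpen O)
    (hf : ∀ x ∈ O, ContDiffAt ℝ ∞ f x) {p : V} (hp : p ∈ O) :
    ∃ (N : Set (ℝ × V)) (Φ : ℝ × V → V), IsOpen N ∧ (0, p) ∈ N ∧ (∀ x, Φ (0, x) = x) ∧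
      ∀ q ∈ N, Φ q ∈ O ∧ ContDiffAt ℝ ∞ Φ q ∧ HasDerivAt (fun s ↦ Φ (s, q.2)) (f (Φ q)) q.1 := by
  have : CompleteSpace V := FiniteDimensional.complete ℝ V
  obtain ⟨r, hr, hrO⟩ := Metric.isOpen_iff.mp hO p hp
  let χ : ContDiffBump p := ⟨r / 4, r / 2, by positivity, by linarith⟩
  have hts : tsupport χ ⊆ O := by
    rw [χ.tsupport_eq]
    exact (Metric.closedBall_subset_ball (by change r / 2 < r; linarith)).trans hrO
  have hF : ContDiff ℝ ∞ fun x ↦ χ x • f x := by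
    refine contDiff_iff_contDiffAt.mpr fun x ↦ ?_
    by_cases hx : x ∈ tsupport χ
    · exact χ.contDiffAt.smul (hf x (hts hx))
    · have : (fun x ↦ χ x • f x) =ᶠ[nhds x] fun _ ↦ 0 := by
        filter_upwards [notMem_tsupport_iff_eventuallyEq.mp hx] with y hy
        simp [hy]
      exact contDiffAt_const.congr_of_eventuallyEq this
  obtain ⟨τ₀, Φ, hτ, h0, hΦ⟩ := exists_flow_of_hasCompactSupport hF χ.hasCompactSupport.smul_right
  have hco : ContinuousOn Φ {q | |q.1| < τ₀} := fun q hq ↦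
    (hΦ q hq).1.continuousAt.continuousWithinAt
  have hopen : IsOpen {q : ℝ × V | |q.1| < τ₀} :=
    isOpen_lt (continuous_abs.comp continuous_fst) continuous_const
  refine ⟨_, Φ, hco.isOpen_inter_preimage hopen (Metric.isOpen_ball (x := p) (ε := r / 4)),
    ⟨by simpa using hτ, ?_⟩, h0, fun q hq ↦ ⟨?_, (hΦ q hq.1).1, ?_⟩⟩
  · simpa [h0] using hr
  · exact hrO (Metric.ball_subset_ball (by linarith) hq.2)
  · have h1 := (hΦ q hq.1).2
    rwa [χ.one_of_mem_closedBall (Metric.ball_subset_closedBall hq.2), one_smul] at h1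

end Flow

/-! ### Hamiltonian flow, the Gauss lemma and Fermi coordinates -/

section Fermi

variable {n : ℕ}

/-- The `i`-th vector of the standard basis of `ℝⁿ`. -/
abbrev basisVec (i : Fin n) : Model n := EuclideanSpace.single i (1 : ℝ)

theorem pd_eq_of_hasDerivAt {f : Model n → ℝ} {z : Model n} (hf : DifferentiableAt ℝ f z)
    {i : Fin n} {d : ℝ} (h : HasDerivAt (fun s : ℝ ↦ f (z + s • basisVec i)) d 0) :
    pd i f z = d := by
  have h1 : HasDerivAt (fun s : ℝ ↦ z + s • basisVec i) (basisVec i) 0 := by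
    simpa using ((hasDerivAt_id (0 : ℝ)).smul_const (basisVec i)).const_add z
  have h2 : HasFDerivAt f (fderiv ℝ f z) (z + (0 : ℝ) • basisVec i) := by
    simpa using hf.hasFDerivAt
  exact (h2.comp_hasDerivAt (0 : ℝ) h1).unique h

/-- The point of the hyperplane `xᵢ = pᵢ` below `z`. -/
def footPoint (p : Model n) (i : Fin n) (z : Model n) : Model n :=
  z - (z i - p i) • basisVec i

theorem footPoint_add (p : Model n) (i : Fin n) (z : Model n) :
    footPoint p i z + (z i - p i) • basisVec i = z := by
  simp [footPoint]

theorem footPoint_add_smul (p : Model n) (i : Fin n) (z : Model n) (s : ℝ) :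
    footPoint p i (z + s • basisVec i) = footPoint p i z := by
  ext k
  by_cases hk : k = i <;> simp [footPoint, hk]

theorem footPoint_eq_self {p : Model n} {i : Fin n} {z : Model n} (h : z i = p i) :
    footPoint p i z = z := by
  simp [footPoint, h]

theorem footPoint_apply_self (p : Model n) (i : Fin n) (z : Model n) :
    footPoint p i z i = p i := by
  simp [footPoint]

theorem norm_footPoint_sub_le (p : Model n) (i : Fin n) (z : Model n) :
    ‖footPoint p i z - p‖ ≤ ‖z - p‖ := by
  rw [EuclideanSpace.norm_eq, EuclideanSpace.norm_eq]
  refine Real.sqrt_le_sqrt (Finset.sum_le_sum fun k _ ↦ ?_)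
  by_cases hk : k = i
  · subst hk
    simp [footPoint, sq_nonneg]
  · simp [footPoint, hk]

theorem contDiff_footPoint (p : Model n) (i : Fin n) : ContDiff ℝ ∞ (footPoint p i) := by
  have h : ContDiff ℝ ∞ fun z : Model n ↦ z i := (EuclideanSpace.proj i : Model n →L[ℝ] ℝ).contDiff
  exact contDiff_id.sub ((h.sub contDiff_const).smul contDiff_const)

/-- A function on a ball with vanishing `i`-th partial derivative is determined by its values on
the central hyperplane `xᵢ = pᵢ`. -/
theorem eq_footPoint_of_pd_eq_zero {p : Model n} {r : ℝ} {i : Fin n} {u : Model n → ℝ}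
    (hu : ∀ z ∈ Metric.ball p r, DifferentiableAt ℝ u z)
    (h : ∀ z ∈ Metric.ball p r, pd i u z = 0) {z : Model n} (hz : z ∈ Metric.ball p r) :
    u z = u (footPoint p i z) := by
  set c : ℝ → Model n := fun s ↦ footPoint p i z + s • basisVec i with hc
  have hcc : Continuous c := by fun_prop
  have hopen : IsOpen (c ⁻¹' Metric.ball p r) := Metric.isOpen_ball.preimage hcc
  have hconv : Convex ℝ (c ⁻¹' Metric.ball p r) := by
    intro a ha b hb s t hs ht hst
    have h1 : c (s • a + t • b) = s • c a + t • c b := by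
      have h2 : footPoint p i z = (s + t) • footPoint p i z := by rw [hst, one_smul]
      simp only [hc]
      nth_rewrite 1 [h2]
      simp only [smul_eq_mul]
      module
    rw [Set.mem_preimage, h1]
    exact convex_ball p r ha hb hs ht hst
  have hd : ∀ s ∈ c ⁻¹' Metric.ball p r, HasDerivAt (u ∘ c) 0 s := by
    intro s hs
    have h1 : HasDerivAt c (basisVec i) s := by
      simpa only [one_smul, id] using
        ((hasDerivAt_id s).smul_const (basisVec i)).const_add (footPoint p i z)
    have h2 := (hu _ hs).hasFDerivAt.comp_hasDerivAt s h1
    rwa [show fderiv ℝ u (c s) (basisVec i) = 0 from h _ hs] at h2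
  have hz0 : (z i - p i) ∈ c ⁻¹' Metric.ball p r := by
    simpa [hc, footPoint_add] using hz
  have h0 : (0 : ℝ) ∈ c ⁻¹' Metric.ball p r := by
    simp only [hc, Set.mem_preimage, zero_smul, add_zero, mem_ball_iff_norm]
    exact (norm_footPoint_sub_le p i z).trans_lt (mem_ball_iff_norm.mp hz)
  have := hopen.is_const_of_deriv_eq_zero hconv.isPreconnected
    (fun s hs ↦ (hd s hs).differentiableAt.differentiableWithinAt)
    (fun s hs ↦ (hd s hs).deriv) hz0 h0
  simpa [hc, footPoint_add] using this

/-- The geodesic equation in Hamiltonian form, solved with initial position on the hyperplane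
`xᵢ₀ = pᵢ₀` and initial momentum the unit conormal of that hyperplane. Here `P` is the inverse
metric, `X` is the position and `Q` the momentum. -/
theorem exists_normal_geodesics {T : Set (Model n)} (hT : IsOpen T)
    {P : Model n → Matrix (Fin n) (Fin n) ℝ} (hP : SmoothMat T P) {i₀ : Fin n}
    (hpos : ∀ x ∈ T, 0 < P x i₀ i₀) {p : Model n} (hp : p ∈ T) :
    ∃ (r : ℝ) (X Q : Model n → Model n), 0 < r ∧
      (∀ z ∈ Metric.ball p r, X z ∈ T ∧ ContDiffAt ℝ ∞ X z ∧ ContDiffAt ℝ ∞ Q z ∧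
        (∀ i, pd i₀ (fun z ↦ X z i) z = ∑ j, P (X z) i j * Q z j) ∧
        ∀ k, pd i₀ (fun z ↦ Q z k) z
          = -(1 / 2) * ∑ i, ∑ j, pd k (fun x ↦ P x i j) (X z) * Q z i * Q z j) ∧
      (∀ z, z i₀ = p i₀ → X z = z ∧ Q z = (√(P z i₀ i₀))⁻¹ • basisVec i₀) := by
  let f : Model n × Model n → Model n × Model n := fun w ↦
    (WithLp.toLp 2 fun i ↦ ∑ j, P w.1 i j * w.2 j,
      WithLp.toLp 2 fun k ↦ -(1 / 2) * ∑ i, ∑ j, pd k (fun x ↦ P x i j) w.1 * w.2 i * w.2 j)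
  have hcoord : ∀ (j : Fin n) (w : Model n × Model n),
      ContDiffAt ℝ ∞ (fun w : Model n × Model n ↦ w.2 j) w := fun j w ↦
    ((EuclideanSpace.proj j : Model n →L[ℝ] ℝ).contDiff.comp contDiff_snd).contDiffAt
  have hf : ∀ w ∈ T ×ˢ (Set.univ : Set (Model n)), ContDiffAt ℝ ∞ f w := by
    intro w hw
    refine ContDiffAt.prodMk (contDiffAt_euclidean.mpr fun i ↦ ?_)
      (contDiffAt_euclidean.mpr fun k ↦ ?_)
    · change ContDiffAt ℝ ∞ (fun w : Model n × Model n ↦ ∑ j, P w.1 i j * w.2 j) w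
      exact ContDiffAt.sum fun j _ ↦
        ((hP w.1 hw.1 i j).comp w contDiffAt_fst).mul (hcoord j w)
    · refine contDiffAt_const.mul (ContDiffAt.sum fun i _ ↦ ContDiffAt.sum fun j _ ↦ ?_)
      exact (((contDiffAt_pd (hP w.1 hw.1 i j) k).comp w contDiffAt_fst).mul (hcoord i w)).mul
        (hcoord j w)
  obtain ⟨N, Φ, hN, hpN, h0, hΦ⟩ := exists_local_flow (hT.prod isOpen_univ) hf
    (p := (p, (√(P p i₀ i₀))⁻¹ • basisVec i₀)) ⟨hp, trivial⟩
  -- initial data over the foot point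
  let ι₂ : Model n → Model n × Model n := fun z ↦
    (footPoint p i₀ z, (√(P (footPoint p i₀ z) i₀ i₀))⁻¹ • basisVec i₀)
  let ι : Model n → ℝ × (Model n × Model n) := fun z ↦ (z i₀ - p i₀, ι₂ z)
  have hq : ContDiff ℝ ∞ (footPoint p i₀) := contDiff_footPoint p i₀
  have hqT : IsOpen (footPoint p i₀ ⁻¹' T) := hT.preimage hq.continuous
  have hι₂ : ∀ z ∈ footPoint p i₀ ⁻¹' T, ContDiffAt ℝ ∞ ι₂ z := by
    intro z hz
    have h1 : ContDiffAt ℝ ∞ (fun z ↦ P (footPoint p i₀ z) i₀ i₀) z :=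
      (hP _ hz i₀ i₀).comp z hq.contDiffAt
    exact hq.contDiffAt.prodMk (((h1.sqrt (hpos _ hz).ne').inv
      (Real.sqrt_pos.mpr (hpos _ hz)).ne').smul contDiffAt_const)
  have hι : ∀ z ∈ footPoint p i₀ ⁻¹' T, ContDiffAt ℝ ∞ ι z := fun z hz ↦
    ((((EuclideanSpace.proj i₀ : Model n →L[ℝ] ℝ).contDiff).contDiffAt).sub
      contDiffAt_const).prodMk (hι₂ z hz)
  have hιc : ContinuousOn ι (footPoint p i₀ ⁻¹' T) := fun z hz ↦
    (hι z hz).continuousAt.continuousWithinAt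
  have hopen := hιc.isOpen_inter_preimage hqT hN
  have hmem : p ∈ footPoint p i₀ ⁻¹' T ∩ ι ⁻¹' N := by
    have hpp : footPoint p i₀ p = p := footPoint_eq_self rfl
    refine ⟨by simpa [hpp] using hp, ?_⟩
    simpa [ι, ι₂, hpp] using hpN
  obtain ⟨r, hr, hrN⟩ := Metric.isOpen_iff.mp hopen p hmem
  refine ⟨r, fun z ↦ (Φ (ι z)).1, fun z ↦ (Φ (ι z)).2, hr, fun z hz ↦ ?_, fun z hz ↦ ?_⟩
  · obtain ⟨hz1, hz2⟩ := hrN hz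
    obtain ⟨hT', hsm, hder⟩ := hΦ _ hz2
    have hsmz : ContDiffAt ℝ ∞ (fun z ↦ Φ (ι z)) z := hsm.comp z (hι z hz1)
    have hX := contDiffAt_fst.comp z hsmz
    have hQ := contDiffAt_snd.comp z hsmz
    have hcurve : HasDerivAt (fun s : ℝ ↦ Φ (ι (z + s • basisVec i₀))) (f (Φ (ι z))) 0 := by
      have h1 : ∀ s : ℝ, ι (z + s • basisVec i₀) = (z i₀ - p i₀ + s, ι₂ z) := by
        intro s
        simp only [ι, ι₂, footPoint_add_smul]
        congr 1
        simp
        ring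
      simp only [h1]
      exact HasDerivAt.comp_const_add (z i₀ - p i₀) 0 (by simpa using hder)
    refine ⟨hT'.1, hX, hQ, fun i ↦ ?_, fun k ↦ ?_⟩
    · refine pd_eq_of_hasDerivAt ((contDiffAt_coord hX i).differentiableAt (by simp)) ?_
      exact ((EuclideanSpace.proj i : Model n →L[ℝ] ℝ).comp
        (ContinuousLinearMap.fst ℝ (Model n) (Model n))).hasFDerivAt.comp_hasDerivAt 0 hcurve
    · refine pd_eq_of_hasDerivAt ((contDiffAt_coord hQ k).differentiableAt (by simp)) ?_
      exact ((EuclideanSpace.proj k : Model n →L[ℝ] ℝ).comp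
        (ContinuousLinearMap.snd ℝ (Model n) (Model n))).hasFDerivAt.comp_hasDerivAt 0 hcurve
  · have h1 : ι z = (0, (z, (√(P z i₀ i₀))⁻¹ • basisVec i₀)) := by
      simp [ι, ι₂, hz, footPoint_eq_self hz]
    simp only [h1, h0]
    exact ⟨trivial, trivial⟩

/-- The Gauss lemma. Along the normal geodesics `X` with momentum `Q`, the energy `P(Q, Q)` and the
pairings of `Q` with `∂ₐ X`, `a ≠ i₀`, are constant. -/
theorem gauss_lemma {T : Set (Model n)} {P : Model n → Matrix (Fin n) (Fin n) ℝ}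
    (hP : SmoothMat T P) (hPs : ∀ x ∈ T, (P x).IsSymm) {i₀ : Fin n}
    (hpos : ∀ x ∈ T, 0 < P x i₀ i₀) {p : Model n} {r : ℝ} {X Q : Model n → Model n}
    (h : ∀ z ∈ Metric.ball p r, X z ∈ T ∧ ContDiffAt ℝ ∞ X z ∧ ContDiffAt ℝ ∞ Q z ∧
        (∀ i, pd i₀ (fun z ↦ X z i) z = ∑ j, P (X z) i j * Q z j) ∧
        ∀ k, pd i₀ (fun z ↦ Q z k) z
          = -(1 / 2) * ∑ i, ∑ j, pd k (fun x ↦ P x i j) (X z) * Q z i * Q z j)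
    (h0 : ∀ z, z i₀ = p i₀ → X z = z ∧ Q z = (√(P z i₀ i₀))⁻¹ • basisVec i₀)
    {z : Model n} (hz : z ∈ Metric.ball p r) (a : Fin n) :
    ∑ k, Q z k * jacM X z k a = if a = i₀ then 1 else 0 := by
  set u : Fin n → Model n → ℝ := fun k z ↦ ∑ j, P (X z) k j * Q z j with hu
  have hXd : ∀ z ∈ Metric.ball p r, DifferentiableAt ℝ X z := fun z hz ↦
    (h z hz).2.1.differentiableAt (by simp)
  have hQd : ∀ z ∈ Metric.ball p r, ∀ k, DifferentiableAt ℝ (fun z ↦ Q z k) z := fun z hz k ↦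
    (contDiffAt_coord (h z hz).2.2.1 k).differentiableAt (by simp)
  have hPd : ∀ z ∈ Metric.ball p r, ∀ i j, DifferentiableAt ℝ (fun x ↦ P x i j) (X z) :=
    fun z hz ↦ hP.entryDiff (h z hz).1
  have hPXd : ∀ z ∈ Metric.ball p r, ∀ i j, DifferentiableAt ℝ (fun z ↦ P (X z) i j) z :=
    fun z hz i j ↦ (hPd z hz i j).comp z (hXd z hz)
  have hud : ∀ z ∈ Metric.ball p r, ∀ k, DifferentiableAt ℝ (u k) z := fun z hz k ↦
    DifferentiableAt.fun_sum fun j _ ↦ (hPXd z hz k j).mul (hQd z hz j)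
  have hupd : ∀ z ∈ Metric.ball p r, ∀ k a, pd a (u k) z
      = ∑ j, ((∑ l, pd l (fun x ↦ P x k j) (X z) * jacM X z l a) * Q z j
        + P (X z) k j * pd a (fun z ↦ Q z j) z) := by
    intro z hz k a
    rw [hu]
    simp only
    rw [pd_sum fun j _ ↦ (hPXd z hz k j).fun_mul (hQd z hz j)]
    refine Finset.sum_congr rfl fun j _ ↦ ?_
    rw [pd_mul (hPXd z hz k j) (hQd z hz j),
      pd_comp (f := fun x ↦ P x k j) (hPd z hz k j) (hXd z hz)]
  -- `S k` is the derivative of the energy with respect to the position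
  set S : Fin n → Model n → ℝ := fun k z ↦
    ∑ i, ∑ j, pd k (fun x ↦ P x i j) (X z) * Q z i * Q z j with hS
  set A : Fin n → Model n → ℝ := fun a z ↦ ∑ k, S k z * jacM X z k a with hA
  set C : Fin n → Model n → ℝ := fun a z ↦ ∑ k, pd a (fun z ↦ Q z k) z * u k z with hC
  have hQu : ∀ z ∈ Metric.ball p r, ∀ a, ∑ k, Q z k * pd a (u k) z = A a z + C a z := by
    intro z hz a
    simp only [hupd z hz, Finset.sum_add_distrib, mul_add]
    congr 1
    · simp only [hA, hS, Finset.mul_sum, Finset.sum_mul]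
      have : ∀ F : Fin n → Fin n → Fin n → ℝ, ∑ k, ∑ j, ∑ l, F k j l = ∑ l, ∑ k, ∑ j, F k j l := by
        intro F
        rw [Finset.sum_comm' (t' := Finset.univ) (s' := fun _ ↦ Finset.univ) (by simp)]
        rw [Finset.sum_congr rfl fun j _ ↦ Finset.sum_comm, Finset.sum_comm]
        exact Finset.sum_congr rfl fun l _ ↦ Finset.sum_comm
      rw [this]
      refine Finset.sum_congr rfl fun l _ ↦ Finset.sum_congr rfl fun k _ ↦
        Finset.sum_congr rfl fun j _ ↦ ?_
      ring
    · simp only [hC, hu, Finset.mul_sum]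
      rw [Finset.sum_comm]
      refine Finset.sum_congr rfl fun j _ ↦ Finset.sum_congr rfl fun k _ ↦ ?_
      rw [(hPs _ (h z hz).1).apply j k]
      ring
  -- the energy is constant
  set E : Model n → ℝ := fun z ↦ ∑ k, Q z k * u k z with hE
  have hEd : ∀ z ∈ Metric.ball p r, DifferentiableAt ℝ E z := fun z hz ↦
    DifferentiableAt.fun_sum fun k _ ↦ (hQd z hz k).mul (hud z hz k)
  have hEpd : ∀ z ∈ Metric.ball p r, ∀ a, pd a E z = A a z + 2 * C a z := by
    intro z hz a
    rw [hE]
    simp only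
    rw [pd_sum fun k _ ↦ (hQd z hz k).fun_mul (hud z hz k),
      Finset.sum_congr rfl fun k _ ↦ pd_mul (hQd z hz k) (hud z hz k), Finset.sum_add_distrib,
      hQu z hz a]
    ring
  have hE0 : ∀ z ∈ Metric.ball p r, pd i₀ E z = 0 := by
    intro z hz
    have h1 : ∀ k, jacM X z k i₀ = u k z := (h z hz).2.2.2.1
    have h2 : ∀ k, pd i₀ (fun z ↦ Q z k) z = -(1 / 2) * S k z := (h z hz).2.2.2.2
    rw [hEpd z hz]
    simp only [hA, hC, h1, h2, Finset.mul_sum, ← Finset.sum_add_distrib]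
    refine Finset.sum_eq_zero fun k _ ↦ ?_
    ring
  have hfoot : ∀ z ∈ Metric.ball p r, footPoint p i₀ z ∈ Metric.ball p r := fun z hz ↦
    mem_ball_iff_norm.mpr ((norm_footPoint_sub_le p i₀ z).trans_lt (mem_ball_iff_norm.mp hz))
  have hinit : ∀ z ∈ Metric.ball p r, z i₀ = p i₀ → E z = 1 := by
    intro z hz hzi
    obtain ⟨hX0, hQ0⟩ := h0 z hzi
    have hT : z ∈ T := hX0 ▸ (h z hz).1
    have hs := Real.sqrt_pos.mpr (hpos z hT)
    have hss := Real.mul_self_sqrt (hpos z hT).le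
    simp only [hE, hu, hX0, hQ0, PiLp.smul_apply, smul_eq_mul, PiLp.single_apply,
      mul_ite, mul_one, mul_zero, Finset.sum_ite_eq', Finset.mem_univ, if_true, ite_mul, zero_mul]
    field_simp
    rw [sq, hss]
  have hE1 : ∀ z ∈ Metric.ball p r, E z = 1 := fun z hz ↦ by
    rw [eq_footPoint_of_pd_eq_zero hEd hE0 hz]
    exact hinit _ (hfoot z hz) (footPoint_apply_self p i₀ z)
  have hAC : ∀ z ∈ Metric.ball p r, ∀ a, A a z + 2 * C a z = 0 := by
    intro z hz a
    rw [← hEpd z hz a]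
    rw [pd_congr (v := fun _ ↦ 1), pd_const]
    filter_upwards [Metric.isOpen_ball.mem_nhds hz] with x hx using hE1 x hx
  by_cases ha : a = i₀
  · subst ha
    rw [if_pos rfl, ← hE1 z hz]
    exact Finset.sum_congr rfl fun k _ ↦ by rw [show jacM X z k a = u k z from (h z hz).2.2.2.1 k]
  · rw [if_neg ha]
    have hJd : ∀ z ∈ Metric.ball p r, ∀ k, DifferentiableAt ℝ (fun z ↦ jacM X z k a) z :=
      fun z hz k ↦ (contDiffAt_jacM (h z hz).2.1 k a).differentiableAt (by simp)
    have hw : ∀ z ∈ Metric.ball p r, pd i₀ (fun z ↦ ∑ k, Q z k * jacM X z k a) z = 0 := by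
      intro z hz
      rw [pd_sum fun k _ ↦ (hQd z hz k).fun_mul (hJd z hz k),
        Finset.sum_congr rfl fun k _ ↦ pd_mul (hQd z hz k) (hJd z hz k), Finset.sum_add_distrib]
      have h2 : ∀ k, pd i₀ (fun z ↦ Q z k) z = -(1 / 2) * S k z := (h z hz).2.2.2.2
      have h3 : ∀ k, pd i₀ (fun z ↦ jacM X z k a) z = pd a (u k) z := by
        intro k
        have := pd_pd_comm (contDiffAt_coord (h z hz).2.1 k) i₀ a
        refine Eq.trans this (pd_congr ?_)
        filter_upwards [Metric.isOpen_ball.mem_nhds hz] with x hx using (h x hx).2.2.2.1 k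
      simp only [h2, h3, hQu z hz a]
      have h4 : ∑ k, -(1 / 2) * S k z * jacM X z k a = -(1 / 2) * A a z := by
        simp only [hA, Finset.mul_sum, mul_assoc]
      rw [h4]
      linarith [hAC z hz a]
    rw [eq_footPoint_of_pd_eq_zero (u := fun z ↦ ∑ k, Q z k * jacM X z k a)
      (fun z hz ↦ DifferentiableAt.fun_sum fun k _ ↦ (hQd z hz k).mul (hJd z hz k)) hw hz]
    set y := footPoint p i₀ z with hy
    have hyb : y ∈ Metric.ball p r := hfoot z hz
    have hyi : y i₀ = p i₀ := footPoint_apply_self p i₀ z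
    rw [(h0 y hyi).2]
    simp only [PiLp.smul_apply, smul_eq_mul, PiLp.single_apply, mul_ite, mul_one,
      mul_zero, ite_mul, zero_mul, Finset.sum_ite_eq', Finset.mem_univ, if_true]
    refine mul_eq_zero_of_right _ ?_
    -- moving in the direction `a ≠ i₀` keeps the point on the hyperplane, where `X z = z`
    refine pd_eq_of_hasDerivAt
      ((contDiffAt_coord (h y hyb).2.1 i₀).differentiableAt (by simp)) ?_
    have h5 : ∀ s : ℝ, X (y + s • basisVec a) i₀ = p i₀ := by
      intro s
      have h6 : (y + s • basisVec a) i₀ = p i₀ := by simp [hyi, Ne.symm ha]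
      rw [(h0 _ h6).1, h6]
    simp only [h5]
    exact hasDerivAt_const _ _

/-- Fermi coordinates: around each point there are coordinates in which `G(∂ᵢ₀, ∂ᵢ₀) = 1` and
`G(∂ᵢ₀, ∂ₐ) = 0` for `a ≠ i₀`. -/
theorem exists_fermi {T : Set (Model n)} (hT : IsOpen T)
    {G : Model n → Matrix (Fin n) (Fin n) ℝ} (hG : IsMetricOn T G) {i₀ : Fin n}
    (hpos : ∀ x ∈ T, 0 < (G x)⁻¹ i₀ i₀) {p : Model n} (hp : p ∈ T) :
    ∃ e : OpenPartialHomeomorph (Model n) (Model n), p ∈ e.source ∧ e.target ⊆ T ∧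
      (∀ z ∈ e.source, ContDiffAt ℝ ∞ e z) ∧ (∀ z ∈ e.target, ContDiffAt ℝ ∞ e.symm z) ∧
      ∀ z ∈ e.source, ∀ a,
        ((jacM e z)ᵀ * G (e z) * jacM e z) i₀ a = if a = i₀ then 1 else 0 := by
  have hPs : ∀ x ∈ T, ((G x)⁻¹).IsSymm := fun x hx ↦ by
    rw [Matrix.IsSymm, Matrix.transpose_nonsing_inv, (hG.symm x hx).eq]
  obtain ⟨r, X, Q, hr, h, h0⟩ := exists_normal_geodesics hT hG.inv hpos hp
  have hpb : p ∈ Metric.ball p r := Metric.mem_ball_self hr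
  have hgauss := fun z (hz : z ∈ Metric.ball p r) a ↦ gauss_lemma hG.inv hPs hpos h h0 hz a
  have hXd : ∀ z ∈ Metric.ball p r, DifferentiableAt ℝ X z := fun z hz ↦
    (h z hz).2.1.differentiableAt (by simp)
  -- the Jacobian matrix in direction `i₀`
  have hJ0 : ∀ z ∈ Metric.ball p r, ∀ i, jacM X z i i₀ = ∑ j, (G (X z))⁻¹ i j * Q z j :=
    fun z hz ↦ (h z hz).2.2.2.1
  have hdet : (jacM X p).det ≠ 0 := by
    intro hd
    obtain ⟨v, hv0, hv⟩ := Matrix.exists_mulVec_eq_zero_iff.mpr hd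
    have hrow : ∀ k, ∑ a, jacM X p k a * v a = 0 := fun k ↦ congrFun hv k
    have hcol : ∀ k a, a ≠ i₀ → jacM X p k a = if k = a then 1 else 0 := by
      intro k a ha
      refine pd_eq_of_hasDerivAt
        ((contDiffAt_coord (h p hpb).2.1 k).differentiableAt (by simp)) ?_
      have h5 : ∀ s : ℝ, X (p + s • basisVec a) k = p k + s * if k = a then 1 else 0 := by
        intro s
        have h6 : (p + s • basisVec a) i₀ = p i₀ := by simp [Ne.symm ha]
        rw [(h0 _ h6).1]
        simp
      simp only [h5]
      simpa using ((hasDerivAt_id (0 : ℝ)).mul_const (if k = a then (1 : ℝ) else 0)).const_add (p k)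
    have hX0 := (h0 p rfl).1
    have hi₀ : jacM X p i₀ i₀ ≠ 0 := by
      rw [hJ0 p hpb, hX0, (h0 p rfl).2]
      have := hpos p hp
      have hs := Real.sqrt_pos.mpr this
      simp only [PiLp.smul_apply, smul_eq_mul, PiLp.single_apply, mul_ite, mul_one,
        mul_zero, Finset.sum_ite_eq', Finset.mem_univ, if_true]
      positivity
    have hvi : v i₀ = 0 := by
      have h1 := hrow i₀
      rw [Finset.sum_eq_single i₀] at h1
      · exact (mul_eq_zero.mp h1).resolve_left hi₀
      · intro a _ ha
        rw [hcol i₀ a ha, if_neg (Ne.symm ha), zero_mul]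
      · simp
    refine hv0 (funext fun k ↦ ?_)
    have h1 := hrow k
    by_cases hk : k = i₀
    · rw [hk, hvi, Pi.zero_apply]
    · rw [Finset.sum_eq_single k] at h1
      · rwa [hcol k k hk, if_pos rfl, one_mul] at h1
      · intro a _ ha
        by_cases hai : a = i₀
        · rw [hai, hvi, mul_zero]
        · rw [hcol k a hai, if_neg (Ne.symm ha), zero_mul]
      · simp
  have hequiv : ∀ z ∈ Metric.ball p r, (jacM X z).det ≠ 0 →
      ∃ L : Model n ≃L[ℝ] Model n, HasFDerivAt X (L : Model n →L[ℝ] Model n) z := by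
    intro z hz hd
    rw [← det_fderiv (hXd z hz)] at hd
    exact ⟨ContinuousLinearEquiv.ofBijective (fderiv ℝ X z)
        (LinearMap.ker_eq_bot.mpr ((LinearMap.equivOfDetNeZero _ hd).injective))
        (LinearMap.range_eq_top.mpr ((LinearMap.equivOfDetNeZero _ hd).surjective)), by
      rw [ContinuousLinearEquiv.coe_ofBijective]
      exact (hXd z hz).hasFDerivAt⟩
  obtain ⟨L, hL⟩ := hequiv p hpb hdet
  set e₁ := (h p hpb).2.1.toOpenPartialHomeomorph X hL (by simp) with he₁
  have hdc : ContinuousOn (fun z ↦ (jacM X z).det) (Metric.ball p r) := fun z hz ↦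
    (contDiffAt_det fun i j ↦ contDiffAt_jacM (h z hz).2.1 i j).continuousAt.continuousWithinAt
  have hopen : IsOpen (Metric.ball p r ∩ (fun z ↦ (jacM X z).det) ⁻¹' {0}ᶜ) :=
    hdc.isOpen_inter_preimage Metric.isOpen_ball isOpen_compl_singleton
  refine ⟨e₁.restrOpen _ hopen, ⟨?_, hpb, hdet⟩, ?_, ?_, ?_, ?_⟩
  · exact (h p hpb).2.1.mem_toOpenPartialHomeomorph_source hL (by simp)
  · intro y hy
    have := (e₁.restrOpen _ hopen).map_target hy
    have h2 := (h _ this.2.1).1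
    have h3 : X ((e₁.restrOpen _ hopen).symm y) = y := (e₁.restrOpen _ hopen).right_inv hy
    rwa [h3] at h2
  · exact fun z hz ↦ (h z hz.2.1).2.1
  · intro y hy
    have hs := (e₁.restrOpen _ hopen).map_target hy
    obtain ⟨L', hL'⟩ := hequiv _ hs.2.1 hs.2.2
    exact (e₁.restrOpen _ hopen).contDiffAt_symm hy hL' (h _ hs.2.1).2.1
  · intro z hz a
    change ((jacM X z)ᵀ * G (X z) * jacM X z) i₀ a = _
    rw [← hgauss z hz.2.1 a]
    have h1 : ∀ k, ((jacM X z)ᵀ * G (X z)) i₀ k = Q z k := by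
      intro k
      have h2 : ((jacM X z)ᵀ * G (X z)) i₀ k = ((G (X z)) *ᵥ ((G (X z))⁻¹ *ᵥ (Q z).ofLp)) k := by
        rw [Matrix.mul_apply]
        refine Finset.sum_congr rfl fun i _ ↦ ?_
        rw [Matrix.transpose_apply, hJ0 z hz.2.1, mul_comm,
          (hG.symm _ (h z hz.2.1).1).apply k i]
        rfl
      rw [h2, Matrix.mulVec_mulVec, Matrix.mul_nonsing_inv _
        (isUnit_iff_ne_zero.mpr (hG.det_pos _ (h z hz.2.1).1).ne'), Matrix.one_mulVec]
    rw [Matrix.mul_apply]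
    exact Finset.sum_congr rfl fun k _ ↦ by rw [h1]

end Fermi

/-! ### Primitives with compact support in one coordinate direction -/

section Primitives

variable {n : ℕ}

theorem exists_isTest_ne_zero {O : Set (Model n)} (hO : IsOpen O) {p : Model n} (hp : p ∈ O) :
    ∃ v, IsTest O v ∧ v p = 1 := by
  obtain ⟨r, hr, hrO⟩ := Metric.isOpen_iff.mp hO p hp
  let χ : ContDiffBump p := ⟨r / 4, r / 2, by positivity, by linarith⟩
  refine ⟨χ, ⟨χ.contDiff, χ.hasCompactSupport, ?_⟩,
    χ.one_of_mem_closedBall (Metric.mem_closedBall_self (by change 0 ≤ r / 4; positivity))⟩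
  rw [χ.tsupport_eq]
  exact (Metric.closedBall_subset_ball (by change r / 2 < r; linarith)).trans hrO

theorem IsTest.eq_zero_of_pd_eq_zero {O : Set (Model n)} {v : Model n → ℝ} (hv : IsTest O v)
    {i : Fin n} (h : ∀ z, HarmId.pd i v z = 0) (z : Model n) : v z = 0 := by
  obtain ⟨R, hR⟩ := hv.hasCompactSupport.isCompact.isBounded.exists_norm_le
  set s : ℝ := ‖z‖ + |R| + 1 with hs
  set p : Model n := z + s • basisVec i with hp
  have hs0 : 0 < s := by positivity
  have h1 : footPoint p i z = p := by
    ext k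
    by_cases hk : k = i <;> simp [footPoint, hp, hk]
  rw [eq_footPoint_of_pd_eq_zero (p := p) (r := s + 1) (i := i)
    (fun y _ ↦ hv.differentiableAt y) (fun y _ ↦ h y)
    (by simp [hp, norm_smul, abs_of_pos hs0]), h1]
  refine image_eq_zero_of_notMem_tsupport fun hcon ↦ ?_
  have h2 := hR p hcon
  have h3 : s ≤ ‖p‖ + ‖z‖ := by
    have h4 : s • basisVec i = p - z := by simp [hp]
    have h5 : ‖s • basisVec i‖ = s := by simp [norm_smul, abs_of_pos hs0]
    rw [← h5, h4]
    exact norm_sub_le p z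
  linarith [le_abs_self R]

/-- A differential operator `A` on test functions such that each `A v * w`, for `w` in a given list,
is a derivative in the direction `i₀` of a test function. More generally `A v * w` is `v * f` up to
such derivatives, for every smooth `w`. The operator is built by composing factors
`v ↦ f⁻¹ ∂ᵢ₀ (f v)`, one for each function of the list, on a domain where `f` does not vanish. -/
theorem exists_annihilating_operator (i₀ : Fin n) (ws : List (Model n → ℝ)) {O : Set (Model n)}
    (hO : IsOpen O) (hne : O.Nonempty) (hws : ∀ w ∈ ws, ∀ y ∈ O, ContDiffAt ℝ ∞ w y) :
    ∃ O' ⊆ O, IsOpen O' ∧ O'.Nonempty ∧ ∃ A : (Model n → ℝ) → Model n → ℝ,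
      (∀ U ⊆ O', ∀ v, IsTest U v → IsTest U (A v) ∧ ((∀ z, A v z = 0) → ∀ z, v z = 0)) ∧
      (∀ w : Model n → ℝ, (∀ y ∈ O, ContDiffAt ℝ ∞ w y) → ∃ f : Model n → ℝ,
        (∀ y ∈ O', ContDiffAt ℝ ∞ f y) ∧ ∀ U ⊆ O', ∀ v, IsTest U v →
          ∃ y, IsTest U y ∧ ∀ z, A v z * w z = v z * f z + pd i₀ y z) ∧
      ∀ w ∈ ws, ∀ U ⊆ O', ∀ v, IsTest U v → ∃ y, IsTest U y ∧ ∀ z, A v z * w z = pd i₀ y z := by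
  induction ws with
  | nil =>
    refine ⟨O, subset_rfl, hO, hne, id, fun U _ v hv ↦ ⟨hv, id⟩, fun w hw ↦ ⟨w, hw, ?_⟩, by simp⟩
    exact fun U _ v hv ↦ ⟨fun _ ↦ 0, IsTest.zero U, fun z ↦ by simp [pd_const]⟩
  | cons w ws ih =>
    obtain ⟨O', hO'O, hO', hne', A, hA, hAw, hAws⟩ :=
      ih fun w hw ↦ hws w (List.mem_cons_of_mem _ hw)
    obtain ⟨f, hf, hfA⟩ := hAw w (hws w List.mem_cons_self)
    by_cases hf0 : ∀ y ∈ O', f y = 0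
    · refine ⟨O', hO'O, hO', hne', A, hA, hAw, fun w' hw' U hU v hv ↦ ?_⟩
      rcases List.mem_cons.mp hw' with rfl | hw'
      · obtain ⟨y, hy, hyz⟩ := hfA U hU v hv
        refine ⟨y, hy, fun z ↦ ?_⟩
        rw [hyz z]
        by_cases hz : z ∈ U
        · rw [hf0 z (hU hz), mul_zero, zero_add]
        · rw [hv.eq_zero hz, zero_mul, zero_add]
      · exact hAws w' hw' U hU v hv
    · push Not at hf0
      obtain ⟨y₀, hy₀, hfy₀⟩ := hf0
      have hfc : ContinuousOn f O' := fun y hy ↦ (hf y hy).continuousAt.continuousWithinAt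
      have hO'' : IsOpen (O' ∩ f ⁻¹' {0}ᶜ) :=
        hfc.isOpen_inter_preimage hO' isOpen_compl_singleton
      have hfi : ∀ y ∈ O' ∩ f ⁻¹' {0}ᶜ, ContDiffAt ℝ ∞ (fun z ↦ (f z)⁻¹) y :=
        fun y hy ↦ (hf y hy.1).inv hy.2
      have hvf : ∀ U ⊆ O' ∩ f ⁻¹' {0}ᶜ, ∀ v, IsTest U v → ∀ f' : Model n → ℝ,
          (∀ y ∈ O', ContDiffAt ℝ ∞ f' y) → IsTest U fun z ↦ v z * f' z :=
        fun U hU v hv f' hf' ↦ hv.mul fun y hy ↦ hf' y (hU hy).1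
      have hv1 : ∀ U ⊆ O' ∩ f ⁻¹' {0}ᶜ, ∀ v, IsTest U v →
          IsTest U fun z ↦ pd i₀ (fun z ↦ v z * f z) z * (f z)⁻¹ :=
        fun U hU v hv ↦ ((hvf U hU v hv f hf).pd i₀).mul fun y hy ↦ hfi y (hU hy)
      refine ⟨O' ∩ f ⁻¹' {0}ᶜ, Set.inter_subset_left.trans hO'O, hO'', ⟨y₀, hy₀, hfy₀⟩,
        fun v ↦ A fun z ↦ pd i₀ (fun z ↦ v z * f z) z * (f z)⁻¹, fun U hU v hv ↦ ?_,
        fun w' hw' ↦ ?_, fun w' hw' U hU v hv ↦ ?_⟩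
      · have hU' : U ⊆ O' := hU.trans Set.inter_subset_left
        obtain ⟨h1, h2⟩ := hA U hU' _ (hv1 U hU v hv)
        refine ⟨h1, fun h3 z ↦ ?_⟩
        by_cases hz : z ∈ U
        · have h4 : ∀ x, pd i₀ (fun z ↦ v z * f z) x = 0 := by
            intro x
            by_cases hx : x ∈ U
            · exact (mul_eq_zero.mp (h2 h3 x)).resolve_right (inv_ne_zero (hU hx).2)
            · exact ((hvf U hU v hv f hf).pd i₀).eq_zero hx
          have h5 := (hvf U hU v hv f hf).eq_zero_of_pd_eq_zero h4 z
          exact (mul_eq_zero.mp h5).resolve_right (hU hz).2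
        · exact hv.eq_zero hz
      · obtain ⟨f', hf', hf'A⟩ := hAw w' hw'
        refine ⟨fun z ↦ -(f z * pd i₀ (fun z ↦ f' z * (f z)⁻¹) z), fun y hy ↦ ?_,
          fun U hU v hv ↦ ?_⟩
        · exact ((hf y hy.1).mul (contDiffAt_pd ((hf' y hy.1).mul (hfi y hy)) i₀)).neg
        · have hU' : U ⊆ O' := hU.trans Set.inter_subset_left
          obtain ⟨y, hy, hyz⟩ := hf'A U hU' _ (hv1 U hU v hv)
          refine ⟨fun z ↦ y z + v z * f' z, hy.add (hvf U hU v hv f' hf'), fun z ↦ ?_⟩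
          rw [hyz z, pd_add (hy.differentiableAt z)
            ((hvf U hU v hv f' hf').differentiableAt z)]
          by_cases hz : z ∈ U
          · have hfz : f z ≠ 0 := (hU hz).2
            have hfd : DifferentiableAt ℝ f z := (hf z (hU hz).1).differentiableAt (by simp)
            have hfd' : DifferentiableAt ℝ f' z := (hf' z (hU hz).1).differentiableAt (by simp)
            have hq : DifferentiableAt ℝ (fun z ↦ f' z * (f z)⁻¹) z :=
              ((hf' z (hU hz).1).mul (hfi z (hU hz))).differentiableAt (by simp)
            have h6 : pd i₀ f' z = pd i₀ (fun z ↦ f' z * (f z)⁻¹) z * f z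
                + f' z * (f z)⁻¹ * pd i₀ f z := by
              rw [← pd_mul hq hfd]
              refine pd_congr ?_
              filter_upwards [hO''.mem_nhds (hU hz)] with x hx
              rw [mul_assoc, inv_mul_cancel₀ hx.2, mul_one]
            rw [pd_mul (hv.differentiableAt z) hfd, pd_mul (hv.differentiableAt z) hfd', h6]
            field_simp
            ring
          · rw [hv.eq_zero hz, (hvf U hU v hv f' hf').pd i₀ |>.eq_zero hz,
              (hvf U hU v hv f hf).pd i₀ |>.eq_zero hz]
            ring
      · have hU' : U ⊆ O' := hU.trans Set.inter_subset_left
        rcases List.mem_cons.mp hw' with rfl | hw'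
        · obtain ⟨y, hy, hyz⟩ := hfA U hU' _ (hv1 U hU v hv)
          refine ⟨fun z ↦ y z + v z * f z, hy.add (hvf U hU v hv f hf), fun z ↦ ?_⟩
          rw [hyz z, pd_add (hy.differentiableAt z) ((hvf U hU v hv f hf).differentiableAt z),
            add_comm]
          congr 1
          by_cases hz : z ∈ U
          · rw [mul_assoc, inv_mul_cancel₀ (hU hz).2, mul_one]
          · rw [(hvf U hU v hv f hf).pd i₀ |>.eq_zero hz]
            ring
        · exact hAws w' hw' U hU' _ (hv1 U hU v hv)

/-- A nonzero test function `u` such that `u * w`, for finitely many given smooth functions `w`, are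
derivatives in the direction `i₀` of test functions. -/
theorem exists_test_with_primitives (i₀ : Fin n) {ι : Type*} [Finite ι] (w : ι → Model n → ℝ)
    {O : Set (Model n)} (hO : IsOpen O) (hne : O.Nonempty)
    (hw : ∀ l, ∀ y ∈ O, ContDiffAt ℝ ∞ (w l) y) :
    ∃ u, IsTest O u ∧ (∃ z, u z ≠ 0) ∧
      ∀ l, ∃ y, IsTest O y ∧ ∀ z, u z * w l z = pd i₀ y z := by
  have := Fintype.ofFinite ι
  obtain ⟨O', hO'O, hO', ⟨p, hp⟩, A, hA, -, hAws⟩ := exists_annihilating_operator i₀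
    (Finset.univ.toList.map w) hO hne (by
      intro w' hw'
      obtain ⟨l, -, rfl⟩ := List.mem_map.mp hw'
      exact hw l)
  obtain ⟨v, hv, hvp⟩ := exists_isTest_ne_zero hO' hp
  obtain ⟨h1, h2⟩ := hA O' subset_rfl v hv
  refine ⟨A v, h1.mono hO'O, ?_, fun l ↦ ?_⟩
  · by_contra! hcon
    have := h2 hcon p
    rw [hvp] at this
    exact one_ne_zero this
  · obtain ⟨y, hy, hyz⟩ := hAws (w l) (List.mem_map.mpr ⟨l, by simp, rfl⟩) O' subset_rfl v hv
    exact ⟨y, hy.mono hO'O, hyz⟩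

/-- Local smooth primitives in the direction `i₀`. They are obtained by adding the equation
`k' = g` to the flow of the `i₀`-th coordinate field. -/
theorem exists_local_primitive (i₀ : Fin n) {g : Fin n → Fin n → Model n → ℝ} {O : Set (Model n)}
    (hO : IsOpen O) (hg : ∀ a b, ∀ y ∈ O, ContDiffAt ℝ ∞ (g a b) y) {p : Model n} (hp : p ∈ O) :
    ∃ O' ⊆ O, IsOpen O' ∧ p ∈ O' ∧ ∃ K : Fin n → Fin n → Model n → ℝ,
      ∀ a b, ∀ y ∈ O', ContDiffAt ℝ ∞ (K a b) y ∧ pd i₀ (K a b) y = g a b y := by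
  let f : Model n × (Fin n → Fin n → ℝ) → Model n × (Fin n → Fin n → ℝ) := fun w ↦
    (basisVec i₀, fun a b ↦ g a b w.1)
  have hf : ∀ w ∈ O ×ˢ (Set.univ : Set (Fin n → Fin n → ℝ)), ContDiffAt ℝ ∞ f w := fun w hw ↦
    contDiffAt_const.prodMk (contDiffAt_pi.mpr fun a ↦ contDiffAt_pi.mpr fun b ↦
      (hg a b w.1 hw.1).comp w contDiffAt_fst)
  obtain ⟨N, Φ, hN, hpN, h0, hΦ⟩ := exists_local_flow (hO.prod isOpen_univ) hf
    (p := (p, 0)) ⟨hp, trivial⟩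
  let ι : Model n → ℝ × (Model n × (Fin n → Fin n → ℝ)) := fun z ↦
    (z i₀ - p i₀, (footPoint p i₀ z, 0))
  have hι : ContDiff ℝ ∞ ι := ((EuclideanSpace.proj i₀ : Model n →L[ℝ] ℝ).contDiff.sub
    contDiff_const).prodMk ((contDiff_footPoint p i₀).prodMk contDiff_const)
  have hmem : p ∈ ι ⁻¹' N := by simpa [ι, footPoint_eq_self] using hpN
  obtain ⟨r, hr, hrN⟩ := Metric.isOpen_iff.mp (hN.preimage hι.continuous) p hmem
  have hsm : ∀ z ∈ Metric.ball p r, ContDiffAt ℝ ∞ (fun z ↦ Φ (ι z)) z := fun z hz ↦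
    (hΦ _ (hrN hz)).2.1.comp z hι.contDiffAt
  have hcurve : ∀ z ∈ Metric.ball p r,
      HasDerivAt (fun s : ℝ ↦ Φ (ι (z + s • basisVec i₀))) (f (Φ (ι z))) 0 := by
    intro z hz
    have h1 : ∀ s : ℝ, ι (z + s • basisVec i₀) = (z i₀ - p i₀ + s, (footPoint p i₀ z, 0)) := by
      intro s
      simp only [ι, footPoint_add_smul]
      congr 1
      simp
      ring
    simp only [h1]
    exact HasDerivAt.comp_const_add (z i₀ - p i₀) 0 (by simpa using (hΦ _ (hrN hz)).2.2)
  have hX : ∀ z ∈ Metric.ball p r, (Φ (ι z)).1 = z := by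
    intro z hz
    have hXs : ∀ z ∈ Metric.ball p r, ContDiffAt ℝ ∞ (fun z ↦ (Φ (ι z)).1) z := fun z hz ↦
      contDiffAt_fst.comp z (hsm z hz)
    ext k
    have hd : ∀ z ∈ Metric.ball p r, DifferentiableAt ℝ (fun z ↦ (Φ (ι z)).1 k) z := fun z hz ↦
      (contDiffAt_coord (hXs z hz) k).differentiableAt (by simp)
    have hd' : ∀ z, DifferentiableAt ℝ (fun z : Model n ↦ z k) z := fun z ↦
      (EuclideanSpace.proj k : Model n →L[ℝ] ℝ).differentiableAt
    have h2 : (Φ (ι z)).1 k - z k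
        = (Φ (ι (footPoint p i₀ z))).1 k - footPoint p i₀ z k :=
      eq_footPoint_of_pd_eq_zero (u := fun z ↦ (Φ (ι z)).1 k - z k) (i := i₀)
      (fun z hz ↦ (hd z hz).sub (hd' z)) (fun z hz ↦ by
        rw [pd_sub (hd z hz) (hd' z), sub_eq_zero]
        have h3 : pd i₀ (fun z ↦ (Φ (ι z)).1 k) z = basisVec i₀ k := by
          refine pd_eq_of_hasDerivAt (hd z hz) ?_
          exact ((EuclideanSpace.proj k : Model n →L[ℝ] ℝ).comp
            (ContinuousLinearMap.fst ℝ (Model n) (Fin n → Fin n → ℝ))).hasFDerivAt.comp_hasDerivAt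
            0 (hcurve z hz)
        have h4 : pd i₀ (fun z : Model n ↦ z k) z = basisVec i₀ k := by
          rw [pd, show (fun z : Model n ↦ z k) = (EuclideanSpace.proj k : Model n →L[ℝ] ℝ) from rfl,
            ContinuousLinearMap.fderiv]
          rfl
        rw [h3, h4]) hz
    have h5 : ι (footPoint p i₀ z) = (0, (footPoint p i₀ z, 0)) := by
      have h6 := footPoint_apply_self p i₀ z
      simp only [ι, h6, sub_self, footPoint_eq_self h6]
    rw [h5, h0] at h2
    simpa [sub_eq_zero] using h2
  refine ⟨Metric.ball p r, fun z hz ↦ ?_, Metric.isOpen_ball, Metric.mem_ball_self hr,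
    fun a b z ↦ (Φ (ι z)).2 a b, fun a b z hz ↦ ?_⟩
  · have := (hΦ _ (hrN hz)).1.1
    rwa [hX z hz] at this
  · have h1 : ContDiffAt ℝ ∞ (fun z ↦ (Φ (ι z)).2 a b) z := contDiffAt_pi.mp
      (contDiffAt_pi.mp (contDiffAt_snd.comp z (hsm z hz)) a) b
    refine ⟨h1, pd_eq_of_hasDerivAt (h1.differentiableAt (by simp)) ?_⟩
    have h2 := hasDerivAt_pi.mp (hasDerivAt_pi.mp (hcurve z hz).snd a) b
    have h3 : (f (Φ (ι z))).2 a b = g a b z := by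
      change g a b (Φ (ι z)).1 = g a b z
      rw [hX z hz]
    rw [← h3]
    exact h2

end Primitives

/-! ### Divergence-free fields with compact support -/

section CompactSolutions

variable {n : ℕ}

/-- In Fermi coordinates for the direction `i₀`, there is a nonzero symmetric `S` with compact
support and `∂ᵢ (S G)ᵢₖ = ½ tr (S ∂ₖ G)`, that is, `S / √(det G)` is divergence free. The component
`S i₁ i₁` is the test function `u`, the other components with both indices different from `i₀`
vanish, and the equations for `k ≠ i₀` and for `k = i₀` determine successively the components
`S i₀ a` and `S i₀ i₀` by integration in the direction `i₀`. The results have compact support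
because `u` is chosen such that all products that have to be integrated have primitives with
compact support. -/
theorem exists_divergence_free {O : Set (Model n)} (hO : IsOpen O) (hne : O.Nonempty)
    {G : Model n → Matrix (Fin n) (Fin n) ℝ} (hG : IsMetricOn O G) {i₀ i₁ : Fin n} (hi : i₁ ≠ i₀)
    (hF : ∀ z ∈ O, ∀ a, G z i₀ a = if a = i₀ then 1 else 0) :
    ∃ S : Model n → Matrix (Fin n) (Fin n) ℝ, (∀ i j, IsTest O fun z ↦ S z i j) ∧
      (∀ z, (S z).IsSymm) ∧ (∃ z, S z i₁ i₁ ≠ 0) ∧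
      ∀ z ∈ O, ∀ k, ∑ i, pd i (fun z ↦ (S z * G z) i k) z = 1 / 2 * (S z * pdM k G z).trace := by
  obtain ⟨p, hp⟩ := hne
  obtain ⟨O', hO'O, hO', hpO', K, hK⟩ := exists_local_primitive i₀
    (g := fun a b z ↦ (G z)⁻¹ a b) hO (fun a b y hy ↦ hG.inv y hy a b) hp
  have hGs : ∀ z ∈ O', ∀ a b, ContDiffAt ℝ ∞ (fun z ↦ G z a b) z := fun z hz ↦
    hG.smooth z (hO'O hz)
  -- the functions whose products with `u` have to be integrated
  let w : (Fin n ⊕ Fin n) ⊕ (Fin n × Fin n ⊕ Fin n × Fin n ⊕ Fin n × Fin n) → Model n → ℝ :=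
    Sum.elim (Sum.elim (fun a ↦ pd a fun z ↦ G z i₁ i₁) (fun a z ↦ G z i₁ a))
      (Sum.elim (fun q z ↦ K q.1 q.2 z * pd q.2 (fun z ↦ G z i₁ i₁) z)
        (Sum.elim (fun q z ↦ K q.1 q.2 z * G z i₁ q.2)
          (fun q z ↦ pd i₁ (K q.1 q.2) z * G z i₁ q.2)))
  obtain ⟨u, hu, hune, hprim⟩ := exists_test_with_primitives i₀ w hO' ⟨p, hpO'⟩ (by
    rintro ((a | a) | ⟨a, b⟩ | ⟨a, b⟩ | ⟨a, b⟩) z hz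
    · exact contDiffAt_pd (hGs z hz _ _) a
    · exact hGs z hz _ _
    · exact (hK a b z hz).1.mul (contDiffAt_pd (hGs z hz _ _) b)
    · exact (hK a b z hz).1.mul (hGs z hz _ _)
    · exact (contDiffAt_pd (hK a b z hz).1 i₁).mul (hGs z hz _ _))
  choose y hy hyu using hprim
  set y₁ : Fin n → Model n → ℝ := fun a ↦ y (.inl (.inl a)) with hy₁
  set y₂ : Fin n → Model n → ℝ := fun a ↦ y (.inl (.inr a)) with hy₂
  set y₃ : Fin n → Fin n → Model n → ℝ := fun a b ↦ y (.inr (.inl (a, b))) with hy₃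
  set y₄ : Fin n → Fin n → Model n → ℝ := fun a b ↦ y (.inr (.inr (.inl (a, b)))) with hy₄
  set y₅ : Fin n → Fin n → Model n → ℝ := fun a b ↦ y (.inr (.inr (.inr (a, b)))) with hy₅
  have e₁ : ∀ a z, pd i₀ (y₁ a) z = u z * pd a (fun z ↦ G z i₁ i₁) z := fun a z ↦ (hyu _ z).symm
  have e₂ : ∀ a z, pd i₀ (y₂ a) z = u z * G z i₁ a := fun a z ↦ (hyu _ z).symm
  have e₃ : ∀ a b z, pd i₀ (y₃ a b) z = u z * (K a b z * pd b (fun z ↦ G z i₁ i₁) z) :=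
    fun a b z ↦ (hyu _ z).symm
  have e₄ : ∀ a b z, pd i₀ (y₄ a b) z = u z * (K a b z * G z i₁ b) := fun a b z ↦ (hyu _ z).symm
  have e₅ : ∀ a b z, pd i₀ (y₅ a b) z = u z * (pd i₁ (K a b) z * G z i₁ b) :=
    fun a b z ↦ (hyu _ z).symm
  have t₁ : ∀ a, IsTest O' (y₁ a) := fun a ↦ hy _
  have t₂ : ∀ a, IsTest O' (y₂ a) := fun a ↦ hy _
  have t₃ : ∀ a b, IsTest O' (y₃ a b) := fun a b ↦ hy _
  have t₄ : ∀ a b, IsTest O' (y₄ a b) := fun a b ↦ hy _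
  have t₅ : ∀ a b, IsTest O' (y₅ a b) := fun a b ↦ hy _
  -- the covariant components `S i₀ k`, for `k ≠ i₀`
  set B : Fin n → Model n → ℝ := fun b ↦
    if b = i₀ then fun _ ↦ 0 else fun z ↦ 1 / 2 * y₁ b z - pd i₁ (y₂ b) z with hBdef
  have hB0 : B i₀ = fun _ ↦ 0 := if_pos rfl
  have hBne : ∀ b, b ≠ i₀ → B b = fun z ↦ 1 / 2 * y₁ b z - pd i₁ (y₂ b) z := fun b hb ↦ if_neg hb
  have tB : ∀ b, IsTest O' (B b) := by
    intro b
    by_cases hb : b = i₀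
    · rw [hb, hB0]
      exact IsTest.zero O'
    · rw [hBne b hb]
      exact ((t₁ b).const_mul _).sub ((t₂ b).pd i₁)
  have huG : ∀ a, IsTest O' fun z ↦ u z * G z i₁ a := fun a ↦ hu.mul fun z hz ↦ hGs z hz _ _
  have dB : ∀ b, b ≠ i₀ → ∀ z, pd i₀ (B b) z
      = 1 / 2 * (u z * pd b (fun z ↦ G z i₁ i₁) z) - pd i₁ (fun z ↦ u z * G z i₁ b) z := by
    intro b hb z
    rw [hBne b hb, pd_sub (((t₁ b).const_mul _).differentiableAt z)
      (((t₂ b).pd i₁).differentiableAt z), pd_const_mul _ ((t₁ b).differentiableAt z), e₁,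
      pd_pd_comm (t₂ b).contDiff.contDiffAt]
    rw [show pd i₀ (y₂ b) = fun z ↦ u z * G z i₁ b from funext (e₂ b)]
  -- the contravariant components, and their primitives
  set R : Fin n → Model n → ℝ := fun a z ↦ ∑ b, B b z * (G z)⁻¹ a b with hRdef
  have tR : ∀ a, IsTest O' (R a) := fun a ↦ IsTest.sum fun b _ ↦
    (tB b).mul fun z hz ↦ hG.inv z (hO'O hz) a b
  set Z : Fin n → Model n → ℝ := fun a z ↦ ∑ b, if b = i₀ then 0 else
    (B b z * K a b z - 1 / 2 * y₃ a b z) + (pd i₁ (y₄ a b) z - y₅ a b z) with hZdef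
  have tZ' : ∀ a b, IsTest O' fun z ↦
      (B b z * K a b z - 1 / 2 * y₃ a b z) + (pd i₁ (y₄ a b) z - y₅ a b z) := fun a b ↦
    (((tB b).mul fun z hz ↦ (hK a b z hz).1).sub ((t₃ a b).const_mul _)).add
      (((t₄ a b).pd i₁).sub (t₅ a b))
  have tZ'' : ∀ a b, IsTest O' fun z ↦ if b = i₀ then 0 else
      (B b z * K a b z - 1 / 2 * y₃ a b z) + (pd i₁ (y₄ a b) z - y₅ a b z) := by
    intro a b
    by_cases hb : b = i₀
    · simpa [hb] using IsTest.zero O'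
    · simpa only [hb, if_false] using tZ' a b
  have tZ : ∀ a, IsTest O' (Z a) := fun a ↦ IsTest.sum fun b _ ↦ tZ'' a b
  have dZ : ∀ a z, pd i₀ (Z a) z = R a z := by
    intro a z
    rw [hZdef, hRdef]
    simp only
    rw [pd_sum fun b _ ↦ (tZ'' a b).differentiableAt z]
    refine Finset.sum_congr rfl fun b _ ↦ ?_
    by_cases hb : b = i₀
    · simp [hb, hB0, pd_const]
    · simp only [hb, if_false]
      have tBK : IsTest O' fun z ↦ B b z * K a b z := (tB b).mul fun z hz ↦ (hK a b z hz).1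
      rw [pd_add ((tBK.sub ((t₃ a b).const_mul _)).differentiableAt z)
          ((((t₄ a b).pd i₁).sub (t₅ a b)).differentiableAt z),
        pd_sub (tBK.differentiableAt z) (((t₃ a b).const_mul _).differentiableAt z),
        pd_sub (((t₄ a b).pd i₁).differentiableAt z) ((t₅ a b).differentiableAt z),
        pd_const_mul _ ((t₃ a b).differentiableAt z), e₃, e₅,
        pd_pd_comm (t₄ a b).contDiff.contDiffAt,
        show pd i₀ (y₄ a b) = fun z ↦ u z * (K a b z * G z i₁ b) from funext (e₄ a b)]
      by_cases hz : z ∈ O'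
      · have hKd := (hK a b z hz).1.differentiableAt (by simp)
        have h1 : pd i₁ (fun z ↦ u z * (K a b z * G z i₁ b)) z
            = pd i₁ (K a b) z * (u z * G z i₁ b) + K a b z * pd i₁ (fun z ↦ u z * G z i₁ b) z := by
          rw [← pd_mul hKd ((huG b).differentiableAt z)]
          congr 1
          funext x
          ring
        rw [pd_mul ((tB b).differentiableAt z) hKd, (hK a b z hz).2, dB b hb, h1]
        ring
      · have h1 : pd i₁ (fun z ↦ u z * (K a b z * G z i₁ b)) z = 0 := by
          rw [← show pd i₀ (y₄ a b) = fun z ↦ u z * (K a b z * G z i₁ b) from funext (e₄ a b)]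
          exact (((t₄ a b).pd i₀).pd i₁).eq_zero hz
        rw [h1, (tBK.pd i₀).eq_zero hz, hu.eq_zero hz, (tB b).eq_zero hz]
        ring
  -- the component `S i₀ i₀`
  set C : Model n → ℝ := fun z ↦ 1 / 2 * y₁ i₀ z - ∑ a, pd a (Z a) z with hCdef
  have tdZ : IsTest O' fun z ↦ ∑ a, pd a (Z a) z := IsTest.sum fun a _ ↦ (tZ a).pd a
  have tC : IsTest O' C := ((t₁ i₀).const_mul _).sub tdZ
  have dC : ∀ z, pd i₀ C z = 1 / 2 * (u z * pd i₀ (fun z ↦ G z i₁ i₁) z) - ∑ a, pd a (R a) z := by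
    intro z
    rw [hCdef, pd_sub (((t₁ i₀).const_mul _).differentiableAt z) (tdZ.differentiableAt z),
      pd_const_mul _ ((t₁ i₀).differentiableAt z), e₁,
      pd_sum fun a _ ↦ ((tZ a).pd a).differentiableAt z]
    congr 1
    refine Finset.sum_congr rfl fun a _ ↦ ?_
    rw [pd_pd_comm (tZ a).contDiff.contDiffAt, show pd i₀ (Z a) = R a from funext (dZ a)]
  set d₀ : Fin n → ℝ := fun i ↦ if i = i₀ then 1 else 0 with hd₀
  set d₁ : Fin n → ℝ := fun i ↦ if i = i₁ then 1 else 0 with hd₁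
  have hFs : ∀ z ∈ O', ∀ a, G z a i₀ = d₀ a := fun z hz a ↦ by
    rw [(hG.symm z (hO'O hz)).apply i₀ a, hF z (hO'O hz)]
  have hFr : ∀ z ∈ O', ∀ a, G z i₀ a = d₀ a := fun z hz a ↦ hF z (hO'O hz) a
  have hRG : ∀ z ∈ O', ∀ k, ∑ a, R a z * G z a k = B k z := by
    intro z hz k
    have hPs : ((G z)⁻¹).IsSymm := by
      rw [Matrix.IsSymm, Matrix.transpose_nonsing_inv, (hG.symm z (hO'O hz)).eq]
    have h1 : ∑ a, R a z * G z a k = ((fun b ↦ B b z) ᵥ* ((G z)⁻¹ * G z)) k := by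
      rw [← Matrix.vecMul_vecMul]
      refine Finset.sum_congr rfl fun a _ ↦ ?_
      congr 1
      exact Finset.sum_congr rfl fun b _ ↦ by rw [hPs.apply b a]
    rw [h1, Matrix.nonsing_inv_mul _ (isUnit_iff_ne_zero.mpr (hG.det_pos z (hO'O hz)).ne'),
      Matrix.vecMul_one]
  have hR0 : ∀ z, R i₀ z = 0 := by
    intro z
    by_cases hz : z ∈ O'
    · have h1 := hRG z hz i₀
      simp only [hFs z hz, hd₀, hB0, mul_ite, mul_one, mul_zero, Finset.sum_ite_eq',
        Finset.mem_univ, if_true] at h1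
      exact h1
    · exact (tR i₀).eq_zero hz
  set S : Model n → Matrix (Fin n) (Fin n) ℝ := fun z ↦ Matrix.of fun i j ↦
    (C z * (d₀ i * d₀ j) + u z * (d₁ i * d₁ j)) + (R j z * d₀ i + R i z * d₀ j) with hSdef
  have tS : ∀ i j, IsTest O' fun z ↦ S z i j := fun i j ↦
    ((tC.mul fun _ _ ↦ contDiffAt_const).add (hu.mul fun _ _ ↦ contDiffAt_const)).add
      (((tR j).mul fun _ _ ↦ contDiffAt_const).add ((tR i).mul fun _ _ ↦ contDiffAt_const))
  refine ⟨S, fun i j ↦ (tS i j).mono hO'O, fun z ↦ Matrix.IsSymm.ext fun i j ↦ ?_, ?_,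
    fun z hzO k ↦ ?_⟩
  · simp only [hSdef, Matrix.of_apply]
    ring
  · obtain ⟨z, hz⟩ := hune
    refine ⟨z, ?_⟩
    simpa [hSdef, hd₀, hd₁, hi] using hz
  by_cases hz : z ∈ O'
  · have hSG : ∀ i, pd i (fun z ↦ (S z * G z) i k) z = pd i (fun z ↦ (C z * (d₀ i * d₀ k)
        + B k z * d₀ i) + (R i z * d₀ k + u z * G z i₁ k * d₁ i)) z := by
      intro i
      refine pd_congr ?_
      filter_upwards [hO'.mem_nhds hz] with x hx
      simp only [Matrix.mul_apply, hSdef, Matrix.of_apply, add_mul, Finset.sum_add_distrib]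
      have s1 : ∑ j, C x * (d₀ i * d₀ j) * G x j k = C x * (d₀ i * d₀ k) := by
        rw [← hFr x hx k, Finset.sum_eq_single i₀ (fun j _ hj ↦ by simp [hd₀, hj]) (by simp)]
        simp only [hd₀, if_true]
        ring
      have s2 : ∑ j, u x * (d₁ i * d₁ j) * G x j k = u x * G x i₁ k * d₁ i := by
        simp [hd₁]
      have s3 : ∑ j, R j x * d₀ i * G x j k = B k x * d₀ i := by
        rw [← hRG x hx, Finset.sum_mul]
        exact Finset.sum_congr rfl fun j _ ↦ by ring
      have s4 : ∑ j, R i x * d₀ j * G x j k = R i x * d₀ k := by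
        simp [hd₀, hFr x hx]
      rw [s1, s2, s3, s4]
      ring
    have hd : ∀ i, pd i (fun z ↦ (C z * (d₀ i * d₀ k)
        + B k z * d₀ i) + (R i z * d₀ k + u z * G z i₁ k * d₁ i)) z
        = pd i C z * (d₀ i * d₀ k) + pd i (B k) z * d₀ i + pd i (R i) z * d₀ k
          + pd i (fun z ↦ u z * G z i₁ k) z * d₁ i := by
      intro i
      have c1 := (tC.mul (f := fun _ ↦ d₀ i * d₀ k) fun _ _ ↦ contDiffAt_const).differentiableAt z
      have c2 := ((tB k).mul (f := fun _ ↦ d₀ i) fun _ _ ↦ contDiffAt_const).differentiableAt z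
      have c3 := ((tR i).mul (f := fun _ ↦ d₀ k) fun _ _ ↦ contDiffAt_const).differentiableAt z
      have c4 := ((huG k).mul (f := fun _ ↦ d₁ i) fun _ _ ↦ contDiffAt_const).differentiableAt z
      rw [pd_add (c1.fun_add c2) (c3.fun_add c4), pd_add c1 c2, pd_add c3 c4,
        pd_mul (tC.differentiableAt z) (differentiableAt_const _),
        pd_mul ((tB k).differentiableAt z) (differentiableAt_const _),
        pd_mul ((tR i).differentiableAt z) (differentiableAt_const _),
        pd_mul ((huG k).differentiableAt z) (differentiableAt_const _)]
      simp only [pd_const]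
      ring
    have hrhs : (S z * pdM k G z).trace = u z * pd k (fun z ↦ G z i₁ i₁) z := by
      have hD0 : ∀ a, pdM k G z i₀ a = 0 := fun a ↦ by
        change pd k (fun z ↦ G z i₀ a) z = 0
        rw [← pd_const k (d₀ a) z]
        refine pd_congr ?_
        filter_upwards [hO'.mem_nhds hz] with x hx using hFr x hx a
      have hD0' : ∀ a, pdM k G z a i₀ = 0 := fun a ↦ by
        change pd k (fun z ↦ G z a i₀) z = 0
        rw [← pd_const k (d₀ a) z]
        refine pd_congr ?_
        filter_upwards [hO'.mem_nhds hz] with x hx using hFs x hx a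
      have h2 : ∀ i j, S z i j * pdM k G z j i = u z * (d₁ i * d₁ j) * pdM k G z j i := by
        intro i j
        simp only [hSdef, Matrix.of_apply, hd₀]
        by_cases h3 : i = i₀
        · rw [h3, hD0', mul_zero, mul_zero]
        · by_cases h4 : j = i₀
          · rw [h4, hD0, mul_zero, mul_zero]
          · simp [h3, h4]
      simp only [Matrix.trace, Matrix.diag, Matrix.mul_apply, h2]
      simp [hd₁, pdM]
    rw [Finset.sum_congr rfl fun i _ ↦ (hSG i).trans (hd i), hrhs]
    simp only [Finset.sum_add_distrib, ← Finset.sum_mul, ← mul_assoc]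
    have q1 : ∑ i, pd i C z * d₀ i = pd i₀ C z := by simp [hd₀]
    have q2 : ∑ i, pd i (B k) z * d₀ i = pd i₀ (B k) z := by simp [hd₀]
    have q3 : ∑ i, pd i (fun z ↦ u z * G z i₁ k) z * d₁ i = pd i₁ (fun z ↦ u z * G z i₁ k) z := by
      simp [hd₁]
    rw [q1, q2, q3, dC]
    by_cases hk : k = i₀
    · have h5 : pd i₁ (fun z ↦ u z * G z i₁ k) z = 0 := by
        refine pd_eq_zero_of_eventually ?_
        filter_upwards [hO'.mem_nhds hz] with x hx
        rw [hk, hFs x hx]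
        simp [hd₀, hi]
      rw [h5, hk, hB0, pd_const]
      simp only [hd₀, if_true]
      ring
    · rw [dB k hk]
      simp only [hd₀, hk, if_false]
      ring
  · have h1 : ∀ i j, S z i j = 0 := fun i j ↦ (tS i j).eq_zero hz
    have h2 : ∀ i, pd i (fun z ↦ (S z * G z) i k) z = 0 := by
      intro i
      refine pd_eq_zero_of_eventually ?_
      have h3 : ∀ᶠ x in nhds z, ∀ j, S x i j = 0 :=
        Filter.eventually_all.mpr fun j ↦ (tS i j).eventually_eq_zero hz
      filter_upwards [h3] with x hx
      rw [Matrix.mul_apply]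
      exact Finset.sum_eq_zero fun j _ ↦ by rw [hx j, zero_mul]
    have h4 : S z = 0 := by
      ext i j
      exact h1 i j
    simp [h2, h4]

end CompactSolutions

/-! ### Harmonic tensors with compact support in coordinates -/

section LocalTensor

variable {n : ℕ}

/-- The tensor field `B` with `√(det G) G⁻¹ B = S G + σ`. -/
def tensorOf (G S : Model n → Matrix (Fin n) (Fin n) ℝ) (σ : Model n → ℝ) (z : Model n) :
    Matrix (Fin n) (Fin n) ℝ :=
  (√(G z).det)⁻¹ • (G z * (S z * G z + σ z • (1 : Matrix (Fin n) (Fin n) ℝ)))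

theorem SmoothMat.add_smul_one {O : Set (Model n)} {A : Model n → Matrix (Fin n) (Fin n) ℝ}
    {σ : Model n → ℝ} (hA : SmoothMat O A) (hσ : ∀ z ∈ O, ContDiffAt ℝ ∞ σ z) :
    SmoothMat O (fun z ↦ A z + σ z • (1 : Matrix (Fin n) (Fin n) ℝ)) := by
  intro z hz i j
  simp only [Matrix.add_apply, Matrix.smul_apply, smul_eq_mul]
  exact (hA z hz i j).add ((hσ z hz).mul contDiffAt_const)

theorem isTensorOn_tensorOf {O : Set (Model n)} {G S : Model n → Matrix (Fin n) (Fin n) ℝ}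
    {σ : Model n → ℝ} (hG : IsMetricOn O G) (hS : IsTensorOn O S)
    (hσ : ∀ z ∈ O, ContDiffAt ℝ ∞ σ z) : IsTensorOn O (tensorOf G S σ) := by
  refine ⟨fun z hz i j ↦ ?_, fun z hz ↦ ?_⟩
  · exact ((hG.sqrt_det hz).inv (Real.sqrt_pos.mpr (hG.det_pos z hz)).ne').mul
      (hG.smooth.mul ((hS.smooth.mul hG.smooth).add_smul_one hσ) z hz i j)
  · have h1 := (hG.symm z hz).eq
    have h2 := (hS.symm z hz).eq
    simp [tensorOf, Matrix.IsSymm, Matrix.mul_add, Matrix.transpose_mul, Matrix.mul_assoc, h1, h2]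

theorem sqrt_det_smul_inv_mul_tensorOf {G S : Model n → Matrix (Fin n) (Fin n) ℝ} {σ : Model n → ℝ}
    {z : Model n} (h : 0 < (G z).det) :
    √(G z).det • ((G z)⁻¹ * tensorOf G S σ z)
      = S z * G z + σ z • (1 : Matrix (Fin n) (Fin n) ℝ) := by
  rw [tensorOf, Matrix.mul_smul, smul_smul, mul_inv_cancel₀ (Real.sqrt_pos.mpr h).ne', one_smul,
    ← Matrix.mul_assoc, Matrix.nonsing_inv_mul _ (isUnit_iff_ne_zero.mpr h.ne'), Matrix.one_mul]

/-- The tensor field of a divergence free `S / √(det G)` is harmonic when `σ` is such that the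
terms with the derivatives of `σ` and of `det G` cancel. -/
theorem defect_tensorOf {O : Set (Model n)} (hO : IsOpen O)
    {G S : Model n → Matrix (Fin n) (Fin n) ℝ} {σ : Model n → ℝ} (hG : IsMetricOn O G)
    (hS : IsTensorOn O S) (hσ : ∀ z ∈ O, ContDiffAt ℝ ∞ σ z)
    (htr : ∀ z ∈ O, (S z * G z).trace = (2 - n) * σ z)
    (hdiv : ∀ z ∈ O, ∀ k,
      ∑ i, pd i (fun z ↦ (S z * G z) i k) z = 1 / 2 * (S z * pdM k G z).trace)
    {y : Model n} (hy : y ∈ O) (j : Fin n) : defect G (tensorOf G S σ) j y = 0 := by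
  have hB := isTensorOn_tensorOf hG hS hσ
  have hd := hG.det_pos y hy
  have hs0 : √(G y).det ≠ 0 := (Real.sqrt_pos.mpr hd).ne'
  have hGe := hG.smooth.entryDiff hy
  have hSe := hS.smooth.entryDiff hy
  have hBe := hB.smooth.entryDiff hy
  have hσd : DifferentiableAt ℝ σ y := (hσ y hy).differentiableAt (by simp)
  have hnhds := hO.mem_nhds hy
  set W : Model n → Matrix (Fin n) (Fin n) ℝ := fun z ↦ S z * G z + σ z • 1 with hW
  have hWs : SmoothMat O W := (hS.smooth.mul hG.smooth).add_smul_one hσ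
  have hWe := hWs.entryDiff hy
  have h1 := sqrt_det_mul_defect hGe hBe hd
    (by filter_upwards [hnhds] with x hx using hG.symm x hx)
    (by filter_upwards [hnhds] with x hx using hB.symm x hx) j
  -- the derivative of `√(det G) B = G W`
  have h2 : pd j (fun z ↦ √(G z).det) y • tensorOf G S σ y
      + √(G y).det • pdM j (tensorOf G S σ) y = pdM j G y * W y + G y * pdM j W y := by
    rw [← pdM_mul hGe hWe]
    ext a b
    have := pd_mul (i := j) ((hG.sqrt_det hy).differentiableAt (by simp)) (hBe a b)
    simp only [Matrix.add_apply, Matrix.smul_apply, smul_eq_mul, pdM, Matrix.of_apply]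
    rw [← this]
    refine pd_congr ?_
    filter_upwards [hnhds] with z hz
    simp only [tensorOf, Matrix.smul_apply, smul_eq_mul]
    rw [mul_inv_cancel_left₀ (Real.sqrt_pos.mpr (hG.det_pos z hz)).ne']
  have h3 : √(G y).det * ((G y)⁻¹ * pdM j (tensorOf G S σ) y).trace
      = ((G y)⁻¹ * pdM j G y * W y).trace + (pdM j W y).trace
        - 1 / 2 * ((G y)⁻¹ * pdM j G y).trace * (W y).trace := by
    have := congrArg (fun A ↦ ((G y)⁻¹ * A).trace) h2
    simp only [Matrix.mul_add, Matrix.trace_add, Matrix.mul_smul, Matrix.trace_smul, smul_eq_mul,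
      ← Matrix.mul_assoc] at this
    rw [Matrix.nonsing_inv_mul _ (isUnit_iff_ne_zero.mpr hd.ne'), Matrix.one_mul,
      pd_sqrt_det hGe hd] at this
    have h4 := congrArg Matrix.trace (sqrt_det_smul_inv_mul_tensorOf (S := S) (σ := σ) hd)
    rw [Matrix.trace_smul, smul_eq_mul] at h4
    change _ = (W y).trace at h4
    rw [← h4]
    linear_combination this
  have h5 : ∀ i, pd i (fun z ↦ √(G z).det * ((G z)⁻¹ * tensorOf G S σ z) i j) y
      = pd i (fun z ↦ (S z * G z) i j) y + if i = j then pd i σ y else 0 := by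
    intro i
    have h6 : (fun z ↦ √(G z).det * ((G z)⁻¹ * tensorOf G S σ z) i j)
        =ᶠ[nhds y] fun z ↦ (S z * G z) i j + (if i = j then 1 else 0) * σ z := by
      filter_upwards [hnhds] with z hz
      have := congrFun (congrFun
        (sqrt_det_smul_inv_mul_tensorOf (S := S) (σ := σ) (hG.det_pos z hz)) i) j
      simpa [Matrix.one_apply] using this
    rw [pd_congr h6, pd_add ((hSe.mul hGe) i j) (hσd.const_mul _), pd_const_mul _ hσd]
    simp
  have h7 : (pdM j W y).trace = (2 - n) * pd j σ y + n * pd j σ y := by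
    rw [← pd_trace hWe, ← add_mul, ← pd_const_mul _ hσd]
    refine pd_congr ?_
    filter_upwards [hnhds] with z hz
    simp only [hW, Matrix.trace_add, htr z hz, Matrix.trace_smul, Matrix.trace_one, smul_eq_mul,
      Fintype.card_fin]
    ring
  have h8 : (W y).trace = (2 - n) * σ y + n * σ y := by
    simp only [hW, Matrix.trace_add, htr y hy, Matrix.trace_smul, Matrix.trace_one, smul_eq_mul,
      Fintype.card_fin]
    ring
  have h9 : ((G y)⁻¹ * pdM j G y * W y).trace
      = (S y * pdM j G y).trace + σ y * ((G y)⁻¹ * pdM j G y).trace := by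
    simp only [hW, Matrix.mul_add, Matrix.trace_add, Matrix.mul_smul, Matrix.mul_one,
      Matrix.trace_smul, smul_eq_mul]
    congr 1
    rw [Matrix.trace_mul_comm, Matrix.mul_assoc, ← Matrix.mul_assoc (G y),
      Matrix.mul_nonsing_inv _ (isUnit_iff_ne_zero.mpr hd.ne'), Matrix.one_mul]
  simp only [h5, Finset.sum_add_distrib, Finset.sum_ite_eq', Finset.mem_univ, if_true] at h1
  rw [hdiv y hy j, mul_assoc, h3, h7, h8, h9] at h1
  refine (mul_eq_zero.mp (h1.trans ?_)).resolve_left hs0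
  ring

theorem isTest_of_eq {O : Set (Model n)} {K : Set (Model n)} (hK : IsCompact K) (hKO : K ⊆ O)
    {B : Model n → Matrix (Fin n) (Fin n) ℝ} (hB : SmoothMat O B) (h0 : ∀ z ∉ K, B z = 0)
    (i j : Fin n) : IsTest O fun z ↦ B z i j :=
  .of_compact hK hKO (fun z hz ↦ hB z hz i j) fun z hz ↦ by simp [h0 z hz]

/-- In dimension at least three, in Fermi coordinates, there are nonzero harmonic tensors with
compact support. -/
theorem exists_harmonic_of_fermi (hn : 3 ≤ n) {O : Set (Model n)} (hO : IsOpen O)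
    (hne : O.Nonempty) {G : Model n → Matrix (Fin n) (Fin n) ℝ} (hG : IsMetricOn O G)
    {i₀ i₁ : Fin n} (hi : i₁ ≠ i₀) (hF : ∀ z ∈ O, ∀ a, G z i₀ a = if a = i₀ then 1 else 0) :
    ∃ B : Model n → Matrix (Fin n) (Fin n) ℝ, (∀ i j, IsTest O fun z ↦ B z i j) ∧
      (∀ z ∈ O, (B z).IsSymm) ∧ (∃ z, B z ≠ 0) ∧ ∀ z ∈ O, ∀ j, defect G B j z = 0 := by
  obtain ⟨S, hS, hSs, ⟨z₀, hz₀⟩, hdiv⟩ := exists_divergence_free hO hne hG hi hF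
  have hST : IsTensorOn O S := ⟨fun _ _ i j ↦ (hS i j).contDiff.contDiffAt, fun z _ ↦ hSs z⟩
  have hn2 : (n : ℝ) - 2 ≠ 0 := by
    have : (3 : ℝ) ≤ n := by exact_mod_cast hn
    intro h
    linarith
  set σ : Model n → ℝ := fun z ↦ -(1 / (n - 2)) * (S z * G z).trace with hσ
  have hσs : ∀ z ∈ O, ContDiffAt ℝ ∞ σ z := fun z hz ↦
    contDiffAt_const.mul ((hST.smooth.mul hG.smooth).trace hz)
  have htr : ∀ z, (S z * G z).trace = (2 - n) * σ z := fun z ↦ by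
    simp only [hσ]
    field_simp
    ring
  set K : Set (Model n) := ⋃ i, ⋃ j, tsupport fun z ↦ S z i j with hK
  have hKc : IsCompact K := isCompact_iUnion fun i ↦ isCompact_iUnion fun j ↦
    (hS i j).hasCompactSupport
  have hKO : K ⊆ O := Set.iUnion_subset fun i ↦ Set.iUnion_subset fun j ↦ (hS i j).tsupport_subset
  have hS0 : ∀ z ∉ K, S z = 0 := fun z hz ↦ by
    ext i j
    exact image_eq_zero_of_notMem_tsupport (f := fun z ↦ S z i j) fun h ↦
      hz (Set.mem_iUnion.mpr ⟨i, Set.mem_iUnion.mpr ⟨j, h⟩⟩)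
  have hBT := isTensorOn_tensorOf hG hST hσs
  refine ⟨tensorOf G S σ, isTest_of_eq hKc hKO hBT.smooth fun z hz ↦ ?_, hBT.symm, ⟨z₀, fun h ↦ ?_⟩,
    fun z hz j ↦ defect_tensorOf hO hG hST hσs (fun z _ ↦ htr z) hdiv hz j⟩
  · simp [tensorOf, hσ, hS0 z hz]
  · have hz : z₀ ∈ O := by_contra fun h ↦ hz₀ ((hS i₁ i₁).eq_zero h)
    have h1 := sqrt_det_smul_inv_mul_tensorOf (S := S) (σ := σ) (hG.det_pos z₀ hz)
    rw [h, Matrix.mul_zero, smul_zero] at h1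
    -- the trace of `S G + σ` is `2 σ`
    have h2 := congrArg Matrix.trace h1
    rw [Matrix.trace_zero, Matrix.trace_add, htr, Matrix.trace_smul, Matrix.trace_one,
      Fintype.card_fin, smul_eq_mul] at h2
    have h3 : σ z₀ = 0 := by linarith
    rw [h3, zero_smul, add_zero] at h1
    have h4 := congrArg (· * (G z₀)⁻¹) h1
    simp only [Matrix.zero_mul, Matrix.mul_assoc] at h4
    rw [Matrix.mul_nonsing_inv _ (isUnit_iff_ne_zero.mpr (hG.det_pos z₀ hz).ne'),
      Matrix.mul_one] at h4
    exact hz₀ (by rw [← h4]; rfl)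

/-- On surfaces, all conformal multiples of the metric are harmonic. -/
theorem exists_harmonic_of_two {O : Set (Model 2)} (hO : IsOpen O) (hne : O.Nonempty)
    {G : Model 2 → Matrix (Fin 2) (Fin 2) ℝ} (hG : IsMetricOn O G) :
    ∃ B : Model 2 → Matrix (Fin 2) (Fin 2) ℝ, (∀ i j, IsTest O fun z ↦ B z i j) ∧
      (∀ z ∈ O, (B z).IsSymm) ∧ (∃ z, B z ≠ 0) ∧ ∀ z ∈ O, ∀ j, defect G B j z = 0 := by
  obtain ⟨p, hp⟩ := hne
  obtain ⟨u, hu, hup⟩ := exists_isTest_ne_zero hO hp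
  have hS : IsTensorOn O (fun _ ↦ (0 : Matrix (Fin 2) (Fin 2) ℝ)) :=
    ⟨fun _ _ _ _ ↦ contDiffAt_const, fun _ _ ↦ Matrix.isSymm_zero⟩
  have hus : ∀ z ∈ O, ContDiffAt ℝ ∞ u z := fun z _ ↦ hu.contDiff.contDiffAt
  have hBT := isTensorOn_tensorOf hG hS hus
  refine ⟨tensorOf G (fun _ ↦ 0) u, isTest_of_eq hu.hasCompactSupport hu.tsupport_subset hBT.smooth
    fun z hz ↦ ?_, hBT.symm, ⟨p, fun h ↦ ?_⟩, fun z hz j ↦ defect_tensorOf hO hG hS hus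
      (fun z _ ↦ by simp) (fun z _ k ↦ by simp [pd_const]) hz j⟩
  · simp [tensorOf, image_eq_zero_of_notMem_tsupport hz]
  · have h1 := sqrt_det_smul_inv_mul_tensorOf (S := fun _ ↦ 0) (σ := u) (hG.det_pos p hp)
    rw [h, Matrix.mul_zero, smul_zero, Matrix.zero_mul, zero_add, hup, one_smul] at h1
    exact zero_ne_one h1

theorem defect_eq_zero_of_eventually {G B : Model n → Matrix (Fin n) (Fin n) ℝ} {z : Model n}
    (h0 : ∀ a b, (fun x ↦ B x a b) =ᶠ[nhds z] fun _ ↦ 0) (j : Fin n) : defect G B j z = 0 := by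
  have h1 : ∀ k a b, pd k (fun x ↦ B x a b) z = 0 := fun k a b ↦
    pd_eq_zero_of_eventually (h0 a b)
  have h2 : ∀ a b, B z a b = 0 := fun a b ↦ (h0 a b).self_of_nhds
  have h3 : pd j (fun z ↦ ∑ i, ∑ k, (G z)⁻¹ i k * B z i k) z = 0 := by
    refine pd_eq_zero_of_eventually ?_
    have : ∀ᶠ x in nhds z, ∀ a b, B x a b = 0 :=
      Filter.eventually_all.mpr fun a ↦ Filter.eventually_all.mpr fun b ↦ h0 a b
    filter_upwards [this] with x hx
    simp [hx]
  simp [defect, h1, h2, h3]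

/-- Compactly supported harmonic tensors in a coordinate domain, in dimension at least two. In
dimension two these are conformal multiples of the metric; from dimension three on they are
transported from Fermi coordinates. -/
theorem exists_local_harmonic (hn : 2 ≤ n) {T : Set (Model n)} (hT : IsOpen T) (hne : T.Nonempty)
    {G : Model n → Matrix (Fin n) (Fin n) ℝ} (hG : IsMetricOn T G)
    (hpos : ∀ x ∈ T, ∀ i, 0 < (G x)⁻¹ i i) :
    ∃ B : Model n → Matrix (Fin n) (Fin n) ℝ, (∀ i j, IsTest T fun z ↦ B z i j) ∧
      (∀ z ∈ T, (B z).IsSymm) ∧ (∃ z, B z ≠ 0) ∧ ∀ z ∈ T, ∀ j, defect G B j z = 0 := by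
  classical
  obtain rfl | hn3 : n = 2 ∨ 3 ≤ n := by omega
  · exact exists_harmonic_of_two hT hne hG
  obtain ⟨p, hp⟩ := hne
  let i₀ : Fin n := ⟨0, by omega⟩
  let i₁ : Fin n := ⟨1, by omega⟩
  have hi : i₁ ≠ i₀ := by simp [i₀, i₁]
  obtain ⟨e, hpe, heT, he, hes, hF⟩ := exists_fermi hT hG (fun x hx ↦ hpos x hx i₀) hp
  have hed : ∀ y ∈ e.source, DifferentiableAt ℝ e y := fun y hy ↦
    (he y hy).differentiableAt (by simp)
  have hesd : ∀ z ∈ e.target, DifferentiableAt ℝ e.symm z := fun y hy ↦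
    (hes y hy).differentiableAt (by simp)
  have hJJ : ∀ y ∈ e.source, jacM e.symm (e y) * jacM e y = 1 := fun y hy ↦
    jacM_symm_mul hy (hed y hy) (hesd _ (e.map_source hy))
  have hJJ' : ∀ z ∈ e.target, jacM e (e.symm z) * jacM e.symm z = 1 := fun z hz ↦
    jacM_symm_mul (e := e.symm) hz (hesd z hz) (hed _ (e.map_target hz))
  set G' : Model n → Matrix (Fin n) (Fin n) ℝ := fun z ↦ (jacM e z)ᵀ * G (e z) * jacM e z with hG'
  have hJs : SmoothMat e.source (jacM e) := fun z hz i j ↦ contDiffAt_jacM (he z hz) i j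
  have hJs' : SmoothMat e.target (jacM e.symm) := fun z hz i j ↦ contDiffAt_jacM (hes z hz) i j
  have hG'm : IsMetricOn e.source G' := by
    refine ⟨SmoothMat.mul (SmoothMat.mul (fun z hz i j ↦ hJs z hz j i)
      fun z hz i j ↦ (hG.smooth _ (heT (e.map_source hz)) i j).comp z (he z hz)) hJs, fun z hz ↦ ?_,
      fun z hz ↦ ?_⟩
    · simp [hG', Matrix.IsSymm, Matrix.transpose_mul, Matrix.mul_assoc,
        (hG.symm _ (heT (e.map_source hz))).eq]
    · have hJ : (jacM e z).det ≠ 0 := fun h0 ↦ by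
        have := congrArg Matrix.det (hJJ z hz)
        rw [Matrix.det_mul, h0, mul_zero, Matrix.det_one] at this
        exact zero_ne_one this
      simp only [hG', Matrix.det_mul, Matrix.det_transpose]
      have := hG.det_pos _ (heT (e.map_source hz))
      have h2 : 0 < (jacM e z).det * (jacM e z).det := mul_self_pos.mpr hJ
      nlinarith [mul_pos h2 this]
  obtain ⟨B, hB, hBs, ⟨z₀, hz₀⟩, hBd⟩ :=
    exists_harmonic_of_fermi hn3 e.open_source ⟨p, hpe⟩ hG'm hi hF
  have hBT : IsTensorOn e.source B := ⟨fun _ _ i j ↦ (hB i j).contDiff.contDiffAt, hBs⟩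
  set K : Set (Model n) := ⋃ i, ⋃ j, tsupport fun z ↦ B z i j with hK
  have hKc : IsCompact K := isCompact_iUnion fun i ↦ isCompact_iUnion fun j ↦
    (hB i j).hasCompactSupport
  have hKO : K ⊆ e.source :=
    Set.iUnion_subset fun i ↦ Set.iUnion_subset fun j ↦ (hB i j).tsupport_subset
  have hB0 : ∀ z ∉ K, B z = 0 := fun z hz ↦ by
    ext i j
    exact image_eq_zero_of_notMem_tsupport (f := fun z ↦ B z i j) fun h ↦
      hz (Set.mem_iUnion.mpr ⟨i, Set.mem_iUnion.mpr ⟨j, h⟩⟩)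
  -- the tensor in the original coordinates
  set B' : Model n → Matrix (Fin n) (Fin n) ℝ := fun z ↦ if z ∈ e.target then
    (jacM e.symm z)ᵀ * B (e.symm z) * jacM e.symm z else 0 with hB'
  have hB't : ∀ z ∈ e.target, B' z = (jacM e.symm z)ᵀ * B (e.symm z) * jacM e.symm z :=
    fun z hz ↦ by simp [hB', hz]
  have hB'T : IsTensorOn e.target B' := by
    refine ⟨fun z hz i j ↦ ?_, fun z hz ↦ ?_⟩
    · have h1 : SmoothMat e.target fun z ↦ (jacM e.symm z)ᵀ * B (e.symm z) * jacM e.symm z :=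
        SmoothMat.mul (SmoothMat.mul (fun z hz i j ↦ hJs' z hz j i) fun z hz i j ↦
          ((hB i j).contDiff.contDiffAt.comp z (hes z hz))) hJs'
      refine (h1 z hz i j).congr_of_eventuallyEq ?_
      filter_upwards [e.open_target.mem_nhds hz] with x hx
      rw [hB't x hx]
    · rw [hB't z hz]
      simp [Matrix.IsSymm, Matrix.transpose_mul, Matrix.mul_assoc, (hBs _ (e.map_target hz)).eq]
  have hB'0 : ∀ z ∉ e '' K, B' z = 0 := fun z hz ↦ by
    by_cases hzt : z ∈ e.target
    · rw [hB't z hzt, hB0 _ fun h ↦ hz ⟨_, h, e.right_inv hzt⟩]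
      simp
    · simp [hB', hzt]
  have hB'test := isTest_of_eq (hKc.image_of_continuousOn (e.continuousOn.mono hKO))
    (Set.image_subset_iff.mpr fun z hz ↦ e.map_source (hKO hz)) hB'T.smooth hB'0
  refine ⟨B', fun i j ↦ (hB'test i j).mono heT, fun z hz ↦ ?_, ⟨e z₀, fun h ↦ hz₀ ?_⟩,
    fun z hz j ↦ ?_⟩
  · by_cases hzt : z ∈ e.target
    · exact hB'T.symm z hzt
    · simp [hB', hzt]
  · have hzK : z₀ ∈ K := by_contra fun h ↦ hz₀ (hB0 z₀ h)
    have hzs := hKO hzK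
    rw [hB't _ (e.map_source hzs), e.left_inv hzs] at h
    have h1 := congrArg (fun A ↦ (jacM e z₀)ᵀ * A * jacM e z₀) h
    simp only [Matrix.mul_zero, Matrix.zero_mul, Matrix.mul_assoc] at h1
    rw [hJJ _ hzs, Matrix.mul_one, ← Matrix.mul_assoc, ← Matrix.transpose_mul, hJJ _ hzs,
      Matrix.transpose_one, Matrix.one_mul] at h1
    exact h1
  · by_cases hzt : z ∈ e.target
    · refine defect_eq_zero_of_pullback e.symm hes he hG'm hBT
        ⟨fun z hz ↦ hG.smooth z (heT hz), fun z hz ↦ hG.symm z (heT hz),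
          fun z hz ↦ hG.det_pos z (heT hz)⟩ hB'T (fun y hy ↦ ?_) hB't hBd hzt j
      simp only [hG', e.right_inv hy, Matrix.mul_assoc]
      rw [hJJ' _ hy, Matrix.mul_one, ← Matrix.mul_assoc, ← Matrix.transpose_mul, hJJ' _ hy,
        Matrix.transpose_one, Matrix.one_mul]
    · have h0 : ∀ a b, (fun x ↦ B' x a b) =ᶠ[nhds z] fun _ ↦ 0 := fun a b ↦
        (hB'test a b).eventually_eq_zero hzt
      exact defect_eq_zero_of_eventually h0 j

end LocalTensor

/-! ### Coordinate expressions of tensors on a manifold -/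

section Charts

theorem bilin_change_of_basis {n : ℕ} (A : Model n →L[ℝ] Model n →L[ℝ] ℝ)
    {J : Matrix (Fin n) (Fin n) ℝ} {v w : Fin n → Model n} (h : ∀ i, v i = ∑ k, J k i • w k) :
    (Matrix.of fun i j ↦ A (v i) (v j)) = Jᵀ * (Matrix.of fun i j ↦ A (w i) (w j)) * J := by
  ext i j
  simp only [Matrix.of_apply, h, map_sum, map_smul, _root_.sum_apply, _root_.smul_apply,
    smul_eq_mul, Matrix.mul_apply, Matrix.transpose_apply, Finset.sum_mul, Finset.mul_sum]
  refine Finset.sum_congr rfl fun k _ ↦ Finset.sum_congr rfl fun l _ ↦ ?_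
  ring

theorem bilin_quadratic {n : ℕ} (A : Model n →L[ℝ] Model n →L[ℝ] ℝ) (v : Fin n → ℝ)
    (w : Fin n → Model n) : v ⬝ᵥ (Matrix.of fun i j ↦ A (w i) (w j)) *ᵥ v
      = A (∑ i, v i • w i) (∑ i, v i • w i) := by
  simp only [map_sum, map_smul, _root_.sum_apply, _root_.smul_apply, smul_eq_mul,
    Matrix.mulVec, dotProduct, Matrix.of_apply, Finset.mul_sum]
  rw [Finset.sum_comm]
  refine Finset.sum_congr rfl fun i _ ↦ Finset.sum_congr rfl fun j _ ↦ ?_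
  ring

variable {n : ℕ} {M : Type*} [TopologicalSpace M] [ChartedSpace (Model n) M]

/-- A field of bilinear forms on the tangent spaces, without any regularity. -/
abbrev BilinField (n : ℕ) (M : Type*) [TopologicalSpace M] [ChartedSpace (Model n) M] : Type _ :=
  (x : M) → TangentSpace (𝓡 n) x →L[ℝ] TangentSpace (𝓡 n) x →L[ℝ] ℝ

/-- The components of a field of bilinear forms in the chart around `c`. -/
abbrev bcomp (T : BilinField n M) (c : M) (y : Model n) : Matrix (Fin n) (Fin n) ℝ :=
  comp (fun x v w ↦ T x v w) c y

/-- The transition map from the chart around `c` to the chart around `c'`. -/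
def transition (c c' : M) : OpenPartialHomeomorph (Model n) (Model n) :=
  (chartAt (Model n) c).symm.trans (chartAt (Model n) c')

theorem mem_transition_source {c c' : M} {y : Model n} : y ∈ (transition c c').source ↔
    y ∈ (extChartAt (𝓡 n) c).target ∧
      (extChartAt (𝓡 n) c).symm y ∈ (extChartAt (𝓡 n) c').source := by
  simp [transition]

theorem transition_apply (c c' : M) (y : Model n) :
    transition c c' y = extChartAt (𝓡 n) c' ((extChartAt (𝓡 n) c).symm y) := by
  simp [transition]

theorem transition_symm (c c' : M) :
    (transition c c' : OpenPartialHomeomorph (Model n) (Model n)).symm = transition c' c := by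
  simp [transition, OpenPartialHomeomorph.trans_symm_eq_symm_trans_symm]

theorem mem_transition_target {c c' : M} {y : Model n} : y ∈ (transition c c').target ↔
    y ∈ (extChartAt (𝓡 n) c').target ∧
      (extChartAt (𝓡 n) c').symm y ∈ (extChartAt (𝓡 n) c).source := by
  rw [← OpenPartialHomeomorph.symm_source, transition_symm, mem_transition_source]

theorem symm_transition {c c' : M} {y : Model n} (hy : y ∈ (transition c c').source) :
    (extChartAt (𝓡 n) c').symm (transition c c' y) = (extChartAt (𝓡 n) c).symm y := by
  rw [transition_apply, (extChartAt (𝓡 n) c').left_inv (mem_transition_source.mp hy).2]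

theorem bcomp_quadratic (T : BilinField n M) (c : M) (y : Model n) (v : Fin n → ℝ) :
    v ⬝ᵥ bcomp T c y *ᵥ v = (T ((extChartAt (𝓡 n) c).symm y) : Model n →L[ℝ] Model n →L[ℝ] ℝ)
      (∑ i, v i • (coordVec c y i : Model n)) (∑ i, v i • (coordVec c y i : Model n)) :=
  bilin_quadratic (T ((extChartAt (𝓡 n) c).symm y)) v (coordVec c y)

theorem bcomp_isSymm {T : BilinField n M} (hT : ∀ x v w, T x v w = T x w v) (c : M)
    (y : Model n) : (bcomp T c y).IsSymm :=
  Matrix.IsSymm.ext fun _ _ ↦ hT _ _ _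

variable [IsManifold (𝓡 n) ∞ M]

theorem contDiffAt_transition {c c' : M} {y : Model n} (hy : y ∈ (transition c c').source) :
    ContDiffAt ℝ ∞ (transition c c') y := by
  have h := contDiffOn_ext_coord_change (I := 𝓡 n) (n := ∞) c' c
  have hs : ((extChartAt (𝓡 n) c).symm ≫ extChartAt (𝓡 n) c').source
      = (transition c c').source := by
    ext z
    rw [mem_transition_source]
    simp
  rw [hs] at h
  refine (h.contDiffAt ((transition c c').open_source.mem_nhds hy)).congr_of_eventuallyEq ?_
  exact Filter.Eventually.of_forall fun z ↦ transition_apply c c' z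

theorem contDiffAt_transition_symm {c c' : M} {y : Model n} (hy : y ∈ (transition c c').target) :
    ContDiffAt ℝ ∞ (transition c c').symm y := by
  rw [transition_symm]
  apply contDiffAt_transition
  rw [← transition_symm]
  exact hy

theorem det_jacM_transition {c c' : M} {y : Model n} (hy : y ∈ (transition c c').source) :
    (jacM (transition c c') y).det ≠ 0 := by
  intro h0
  have := congrArg Matrix.det (jacM_symm_mul hy
    ((contDiffAt_transition hy).differentiableAt (by simp))
    ((contDiffAt_transition_symm ((transition c c').map_source hy)).differentiableAt (by simp)))
  rw [Matrix.det_mul, h0, mul_zero, Matrix.det_one] at this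
  exact zero_ne_one this

theorem mdifferentiableAt_symm {c : M} {y : Model n} (hy : y ∈ (extChartAt (𝓡 n) c).target) :
    MDifferentiableAt 𝓘(ℝ, Model n) (𝓡 n) (extChartAt (𝓡 n) c).symm y :=
  ((contMDiffOn_extChartAt_symm (n := ∞) c).contMDiffAt
    ((isOpen_extChartAt_target c).mem_nhds hy)).mdifferentiableAt (by simp)

theorem sum_single (v : Model n) : ∑ k, v k • EuclideanSpace.single k (1 : ℝ) = v := by
  ext k
  simp [Finset.sum_apply, Pi.single_apply]

theorem coordVec_transition {c c' : M} {y : Model n} (hy : y ∈ (transition c c').source)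
    (i : Fin n) : (coordVec c y i : Model n)
      = ∑ k, jacM (transition c c') y k i • (coordVec c' (transition c c' y) k : Model n) := by
  have hd := (contDiffAt_transition hy).differentiableAt (by simp)
  have ht : transition c c' y ∈ (extChartAt (𝓡 n) c').target :=
    (mem_transition_target.mp ((transition c c').map_source hy)).1
  have h1 : (extChartAt (𝓡 n) c).symm
      =ᶠ[nhds y] (extChartAt (𝓡 n) c').symm ∘ transition c c' := by
    filter_upwards [(transition c c').open_source.mem_nhds hy] with z hz
    exact (symm_transition hz).symm
  have h2 : mfderiv 𝓘(ℝ, Model n) (𝓡 n) (extChartAt (𝓡 n) c).symm y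
      = (mfderiv 𝓘(ℝ, Model n) (𝓡 n) ((extChartAt (𝓡 n) c').symm ∘ transition c c') y :) :=
    h1.mfderiv_eq
  have h3 := mfderiv_comp y (mdifferentiableAt_symm ht) hd.mdifferentiableAt
  have h4 : (coordVec c y i : Model n) =
      mfderiv 𝓘(ℝ, Model n) (𝓡 n) (extChartAt (𝓡 n) c').symm (transition c c' y)
        (fderiv ℝ (transition c c') y (EuclideanSpace.single i (1 : ℝ))) := by
    rw [← mfderiv_eq_fderiv]
    exact congrArg (fun L : Model n →L[ℝ] Model n ↦ L (EuclideanSpace.single i (1 : ℝ)))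
      (h2.trans h3)
  rw [h4]
  have h5 := sum_single (fderiv ℝ (transition c c') y (EuclideanSpace.single i (1 : ℝ)))
  rw [← h5]
  simp only [← jacM_apply hd]
  let L : Model n →L[ℝ] Model n :=
    mfderiv 𝓘(ℝ, Model n) (𝓡 n) (extChartAt (𝓡 n) c').symm (transition c c' y)
  change L _ = ∑ k, jacM (transition c c') y k i • L _
  simp only [map_sum, map_smul]

/-- The transformation rule for the components of a bilinear form. -/
theorem bcomp_transition (T : BilinField n M) {c c' : M} {y : Model n}
    (hy : y ∈ (transition c c').source) :
    bcomp T c y = (jacM (transition c c') y)ᵀ * bcomp T c' (transition c c' y)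
      * jacM (transition c c') y := by
  have key : ∀ x x' : M, x = x' → ∀ (J : Matrix (Fin n) (Fin n) ℝ) (v w : Fin n → Model n),
      (∀ i, v i = ∑ k, J k i • w k) → (Matrix.of fun i j ↦ T x (v i) (v j))
      = Jᵀ * (Matrix.of fun i j ↦ T x' (w i) (w j)) * J := by
    rintro x _ rfl J v w h
    exact bilin_change_of_basis (T x) h
  exact key _ _ (symm_transition hy).symm _ _ _ (coordVec_transition hy)

theorem smoothMat_bcomp {T : BilinField n M}
    (hT : ContMDiff (𝓡 n) ((𝓡 n).prod 𝓘(ℝ, Model n →L[ℝ] Model n →L[ℝ] ℝ)) ∞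
      (fun x ↦ TotalSpace.mk' (Model n →L[ℝ] Model n →L[ℝ] ℝ) x (T x))) (c : M) :
    SmoothMat (extChartAt (𝓡 n) c).target (bcomp T c) := by
  intro y hy i j
  have hs : ContMDiffAt 𝓘(ℝ, Model n) (𝓡 n) ∞ (extChartAt (𝓡 n) c).symm y :=
    (contMDiffOn_extChartAt_symm c).contMDiffAt ((isOpen_extChartAt_target c).mem_nhds hy)
  have h1 := (hT.contMDiffAt (x := (extChartAt (𝓡 n) c).symm y)).comp y hs
  have : ContMDiffAt 𝓘(ℝ, Model n) ((𝓡 n).prod 𝓘(ℝ, ℝ)) ∞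
      (fun z ↦ TotalSpace.mk' ℝ (E := Bundle.Trivial M ℝ) ((extChartAt (𝓡 n) c).symm z)
        (T ((extChartAt (𝓡 n) c).symm z) (coordVec c z i) (coordVec c z j))) y :=
    ContMDiffAt.clm_bundle_apply₂ (F₁ := Model n) (F₂ := Model n) h1
      (contMDiffAt_coordVec hy i) (contMDiffAt_coordVec hy j)
  simp only [contMDiffAt_totalSpace] at this
  exact this.2.contDiffAt

/-- The coordinate vectors are linearly independent. -/
theorem sum_smul_coordVec_ne_zero {c : M} {y : Model n} (hy : y ∈ (extChartAt (𝓡 n) c).target)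
    {v : Fin n → ℝ} (hv : v ≠ 0) : ∑ i, v i • (coordVec c y i : Model n) ≠ 0 := by
  have hinv := isInvertible_mfderivWithin_extChartAt_symm (I := 𝓡 n) hy
  rw [ModelWithCorners.range_eq_univ, mfderivWithin_univ] at hinv
  let L : Model n →L[ℝ] Model n :=
    mfderiv 𝓘(ℝ, Model n) (𝓡 n) (extChartAt (𝓡 n) c).symm y
  have hL : Function.Injective L := hinv.injective
  have h : ∑ i, v i • (coordVec c y i : Model n) = L (WithLp.toLp 2 v) := by
    rw [← sum_single (WithLp.toLp 2 v)]
    simp only [map_sum, map_smul]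
    rfl
  rw [h]
  intro h0
  have h3 : (WithLp.toLp 2 v : Model n) = 0 := hL (h0.trans (map_zero L).symm)
  exact hv (by ext k; simpa using congrArg (fun w : Model n ↦ w k) h3)

theorem posDef_gram (g : Metric n M) {c : M} {y : Model n}
    (hy : y ∈ (extChartAt (𝓡 n) c).target) : (gram g c y).PosDef := by
  refine Matrix.PosDef.of_dotProduct_mulVec_pos ?_ fun v hv ↦ ?_
  · rw [Matrix.IsHermitian, Matrix.conjTranspose_eq_transpose_of_trivial]
    exact bcomp_isSymm g.symm c y
  · rw [star_trivial]
    refine (bcomp_quadratic g.inner c y v).symm ▸ ?_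
    exact g.pos _ _ (sum_smul_coordVec_ne_zero hy hv)

theorem isMetricOn_gram (g : Metric n M) (c : M) :
    IsMetricOn (extChartAt (𝓡 n) c).target (gram g c) :=
  ⟨smoothMat_bcomp g.contMDiff c, fun y _ ↦ bcomp_isSymm g.symm c y,
    fun _ hy ↦ (posDef_gram g hy).det_pos⟩

theorem gram_transition (g : Metric n M) {c c' : M} {y : Model n}
    (hy : y ∈ (transition c c').source) :
    gram g c y = (jacM (transition c c') y)ᵀ * gram g c' (transition c c' y)
      * jacM (transition c c') y :=
  bcomp_transition g.inner hy

theorem isTensorOn_comp {φ : TwoTensor n M} (hφ : ∀ x v w, φ x v w = φ x w v) (c : M) :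
    IsTensorOn (extChartAt (𝓡 n) c).target (comp (TwoTensor.form φ) c) :=
  ⟨smoothMat_bcomp φ.contMDiff c, fun y _ ↦ bcomp_isSymm hφ c y⟩

theorem isHarmonicTensor_iff {g : Metric n M} {φ : TwoTensor n M} :
    IsHarmonicTensor g φ ↔ (∀ (x : M) (v w : TangentSpace (𝓡 n) x), φ x v w = φ x w v) ∧
      ∀ (c : M), ∀ y ∈ (extChartAt (𝓡 n) c).target, ∀ j : Fin n,
        defect (gram g c) (comp (TwoTensor.form φ) c) j y = 0 := by
  have h : ∀ (c : M) (y : Model n) (j : Fin n),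
      defect (gram g c) (comp (TwoTensor.form φ) c) j y
        = divergence g (TwoTensor.form φ) c j y
          + 1 / 2 * pd j (coordTrace g (TwoTensor.form φ) c) y := fun _ _ _ ↦ rfl
  refine and_congr_right fun _ ↦ forall_congr' fun c ↦ forall₂_congr fun y _ ↦
    forall_congr' fun j ↦ ?_
  rw [h]
  constructor <;> intro h <;> linarith

/-- The trace of a symmetric bilinear form does not depend on the chart. -/
theorem coordTrace_transition (g : Metric n M) {T : BilinField n M}
    (hT : ∀ x v w, T x v w = T x w v) {c c' : M} {y : Model n}
    (hy : y ∈ (transition c c').source) :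
    coordTrace g (fun x v w ↦ T x v w) c y
      = coordTrace g (fun x v w ↦ T x v w) c' (transition c c' y) := by
  have h : ∀ c y, coordTrace g (fun x v w ↦ T x v w) c y = ((gram g c y)⁻¹ * bcomp T c y).trace :=
    fun c y ↦ trace_eq_sum_inv_mul (bcomp_isSymm hT c y)
  rw [h, h, gram_transition g hy, bcomp_transition T hy,
    trace_inv_pullback (det_jacM_transition hy)]

end Charts

/-! ### Extension of coordinate tensors by zero -/

section Extension

variable {n : ℕ}

/-- The bilinear form with the matrix `A`. -/
def bilinOf (A : Matrix (Fin n) (Fin n) ℝ) : Model n →L[ℝ] Model n →L[ℝ] ℝ :=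
  ∑ i, ∑ j, A i j • (EuclideanSpace.proj i : Model n →L[ℝ] ℝ).smulRight
    (EuclideanSpace.proj j : Model n →L[ℝ] ℝ)

theorem bilinOf_apply (A : Matrix (Fin n) (Fin n) ℝ) (v w : Model n) :
    bilinOf A v w = ∑ i, ∑ j, A i j * (v i * w j) := by
  simp [bilinOf]

theorem bilinOf_single (A : Matrix (Fin n) (Fin n) ℝ) (i j : Fin n) :
    bilinOf A (EuclideanSpace.single i 1) (EuclideanSpace.single j 1) = A i j := by
  simp [bilinOf_apply]

theorem bilinOf_symm {A : Matrix (Fin n) (Fin n) ℝ} (hA : A.IsSymm) (v w : Model n) :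
    bilinOf A v w = bilinOf A w v := by
  rw [bilinOf_apply, bilinOf_apply, Finset.sum_comm]
  refine Finset.sum_congr rfl fun i _ ↦ Finset.sum_congr rfl fun j _ ↦ ?_
  rw [hA.apply i j, mul_comm (v j)]

set_option synthInstance.maxHeartbeats 400000 in
theorem contDiff_bilinOf {B : Model n → Matrix (Fin n) (Fin n) ℝ}
    (hB : ∀ i j, ContDiff ℝ ∞ fun z ↦ B z i j) : ContDiff ℝ ∞ fun z ↦ bilinOf (B z) := by
  refine contDiff_clm_apply_iff.mpr fun v ↦ contDiff_clm_apply_iff.mpr fun w ↦ ?_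
  simp only [bilinOf_apply]
  exact ContDiff.sum fun i _ ↦ ContDiff.sum fun j _ ↦ (hB i j).mul contDiff_const

variable {M : Type*} [TopologicalSpace M] [ChartedSpace (Model n) M] [IsManifold (𝓡 n) ∞ M]

/-- The differential of the chart around `c`, at `x`. -/
def chartDeriv (c x : M) : Model n →L[ℝ] Model n :=
  (trivializationAt (Model n) (TangentSpace (𝓡 n)) c).continuousLinearMapAt ℝ x

theorem chartDeriv_coordVec {c : M} {y : Model n} (hy : y ∈ (extChartAt (𝓡 n) c).target)
    (i : Fin n) : chartDeriv c ((extChartAt (𝓡 n) c).symm y) (coordVec c y i)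
      = EuclideanSpace.single i 1 := by
  have hx : (extChartAt (𝓡 n) c).symm y ∈ (chartAt (Model n) c).source := by
    rw [← extChartAt_source (I := 𝓡 n)]
    exact (extChartAt (𝓡 n) c).map_target hy
  have h := mfderiv_extChartAt_comp_mfderivWithin_extChartAt_symm (I := 𝓡 n) hy
  rw [ModelWithCorners.range_eq_univ, mfderivWithin_univ] at h
  have h2 : chartDeriv c ((extChartAt (𝓡 n) c).symm y) = _ :=
    TangentBundle.continuousLinearMapAt_trivializationAt (I := 𝓡 n) hx
  rw [h2]
  exact congrArg (fun L : Model n →L[ℝ] Model n ↦ L (EuclideanSpace.single i 1)) h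

theorem chartDeriv_symm {c x : M} (hx : x ∈ (extChartAt (𝓡 n) c).source) (v : Model n) :
    chartDeriv c x
      ((trivializationAt (Model n) (TangentSpace (𝓡 n) : M → Type _) c).symm x v) = v := by
  have hx' : x ∈ (trivializationAt (Model n) (TangentSpace (𝓡 n) : M → Type _) c).baseSet := by
    rw [TangentBundle.trivializationAt_baseSet]
    rwa [← extChartAt_source (I := 𝓡 n)]
  have h := Trivialization.continuousLinearMapAt_symmL (R := ℝ)
    (trivializationAt (Model n) (TangentSpace (𝓡 n) : M → Type _) c) hx' v
  rw [Trivialization.symmL_apply _ hx'] at h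
  exact h

/-- The field of bilinear forms that has components `B` in the chart around `c` and vanishes outside
the domain of this chart. -/
def extendForm (c : M) (B : Model n → Matrix (Fin n) (Fin n) ℝ) : BilinField n M :=
  open Classical in fun x ↦ (bilinOf (if x ∈ (extChartAt (𝓡 n) c).source then
    B (extChartAt (𝓡 n) c x) else 0)).bilinearComp (chartDeriv c x) (chartDeriv c x)

open Classical in
theorem extendForm_apply' (c : M) (B : Model n → Matrix (Fin n) (Fin n) ℝ) (x : M)
    (v w : TangentSpace (𝓡 n) x) : extendForm c B x v w = bilinOf (if x ∈
      (extChartAt (𝓡 n) c).source then B (extChartAt (𝓡 n) c x) else 0)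
      (chartDeriv c x v) (chartDeriv c x w) := rfl

theorem extendForm_apply {c x : M} (B : Model n → Matrix (Fin n) (Fin n) ℝ)
    (hx : x ∈ (extChartAt (𝓡 n) c).source) (v w : TangentSpace (𝓡 n) x) : extendForm c B x v w
      = bilinOf (B (extChartAt (𝓡 n) c x)) (chartDeriv c x v) (chartDeriv c x w) := by
  rw [extendForm_apply', if_pos hx]

theorem extendForm_eq_zero {c x : M} {B : Model n → Matrix (Fin n) (Fin n) ℝ}
    (h : x ∈ (extChartAt (𝓡 n) c).source → B (extChartAt (𝓡 n) c x) = 0) :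
    extendForm c B x = 0 := by
  refine ContinuousLinearMap.ext fun v ↦ ContinuousLinearMap.ext fun w ↦ ?_
  have : ∀ v w : Model n, bilinOf 0 v w = 0 := fun v w ↦ by simp [bilinOf_apply]
  refine Eq.trans ?_ (this (chartDeriv c x v) (chartDeriv c x w))
  rw [extendForm_apply']
  congr 3
  split_ifs with hx
  · exact h hx
  · rfl

theorem extendForm_symm {c : M} {B : Model n → Matrix (Fin n) (Fin n) ℝ}
    (hB : ∀ y ∈ (extChartAt (𝓡 n) c).target, (B y).IsSymm) (x : M) (v w : TangentSpace (𝓡 n) x) :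
    extendForm c B x v w = extendForm c B x w v := by
  rw [extendForm_apply', extendForm_apply']
  refine bilinOf_symm ?_ _ _
  split_ifs with hx
  · exact hB _ ((extChartAt (𝓡 n) c).map_source hx)
  · exact Matrix.isSymm_zero

theorem bcomp_extendForm {c : M} (B : Model n → Matrix (Fin n) (Fin n) ℝ) {y : Model n}
    (hy : y ∈ (extChartAt (𝓡 n) c).target) : bcomp (extendForm c B) c y = B y := by
  ext i j
  have h := extendForm_apply B ((extChartAt (𝓡 n) c).map_target hy) (coordVec c y i)
    (coordVec c y j)
  rw [chartDeriv_coordVec hy, chartDeriv_coordVec hy, bilinOf_single,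
    (extChartAt (𝓡 n) c).right_inv hy] at h
  exact h

set_option synthInstance.maxHeartbeats 400000 in
theorem contMDiffAt_extendForm {c x : M} {B : Model n → Matrix (Fin n) (Fin n) ℝ}
    (hB : ∀ i j, ContDiff ℝ ∞ fun z ↦ B z i j) (hx : x ∈ (extChartAt (𝓡 n) c).source) :
    ContMDiffAt (𝓡 n) ((𝓡 n).prod 𝓘(ℝ, Model n →L[ℝ] Model n →L[ℝ] ℝ)) ∞
      (fun x ↦ TotalSpace.mk' (Model n →L[ℝ] Model n →L[ℝ] ℝ)
        (E := fun x : M ↦ TangentSpace (𝓡 n) x →L[ℝ] TangentSpace (𝓡 n) x →L[ℝ] ℝ)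
        x (extendForm c B x)) x := by
  have hbase : ∀ z ∈ (extChartAt (𝓡 n) c).source,
      z ∈ (trivializationAt (Model n) (TangentSpace (𝓡 n) : M → Type _) c).baseSet := by
    intro z hz
    rw [TangentBundle.trivializationAt_baseSet]
    rwa [← extChartAt_source (I := 𝓡 n)]
  rw [(trivializationAt (Model n →L[ℝ] Model n →L[ℝ] ℝ)
    (fun x : M ↦ TangentSpace (𝓡 n) x →L[ℝ] TangentSpace (𝓡 n) x →L[ℝ] ℝ)
    c).contMDiffAt_section_iff]
  · have h1 : ContMDiffAt (𝓡 n) 𝓘(ℝ, Model n →L[ℝ] Model n →L[ℝ] ℝ) ∞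
        (fun z ↦ bilinOf (B (extChartAt (𝓡 n) c z))) x :=
      (contDiff_bilinOf hB).contMDiff.contMDiffAt.comp x
        (contMDiffAt_extChartAt' (by rwa [← extChartAt_source (I := 𝓡 n)]))
    refine h1.congr_of_eventuallyEq ?_
    filter_upwards [(isOpen_extChartAt_source c).mem_nhds hx] with z hz
    refine ContinuousLinearMap.ext fun v ↦ ContinuousLinearMap.ext fun w ↦ ?_
    rw [hom_trivializationAt_apply]
    refine (inCoordinates_apply_eq₂ (hbase z hz) (hbase z hz) (Set.mem_univ _)).trans ?_
    have htriv : ∀ u : ℝ, (trivializationAt ℝ (Bundle.Trivial M ℝ) c).linearMapAt ℝ z u = u :=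
      fun u ↦ by simp
    refine (htriv _).trans ?_
    refine (extendForm_apply B hz _ _).trans ?_
    rw [chartDeriv_symm hz, chartDeriv_symm hz]
  · exact ⟨hbase x hx, hbase x hx, Set.mem_univ _⟩

set_option synthInstance.maxHeartbeats 400000 in
/-- A compactly supported tensor field in a chart, extended by zero to the manifold. -/
def extendTensor [T2Space M] (c : M) (B : Model n → Matrix (Fin n) (Fin n) ℝ)
    (hB : ∀ i j, IsTest (extChartAt (𝓡 n) c).target fun z ↦ B z i j) : TwoTensor n M where
  toFun := extendForm c B
  contMDiff_toFun := by
    intro x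
    by_cases hx : x ∈ (extChartAt (𝓡 n) c).source
    · exact contMDiffAt_extendForm (fun i j ↦ (hB i j).contDiff) hx
    · set K : Set (Model n) := ⋃ i, ⋃ j, tsupport fun z ↦ B z i j with hK
      have hKc : IsCompact K := isCompact_iUnion fun i ↦ isCompact_iUnion fun j ↦
        (hB i j).hasCompactSupport
      have hKt : K ⊆ (extChartAt (𝓡 n) c).target :=
        Set.iUnion_subset fun i ↦ Set.iUnion_subset fun j ↦ (hB i j).tsupport_subset
      have hK' : IsClosed ((extChartAt (𝓡 n) c).symm '' K) :=
        (hKc.image_of_continuousOn ((continuousOn_extChartAt_symm c).mono hKt)).isClosed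
      have hxK : x ∉ (extChartAt (𝓡 n) c).symm '' K := by
        rintro ⟨y, hy, rfl⟩
        exact hx ((extChartAt (𝓡 n) c).map_target (hKt hy))
      have h0 : ContMDiffAt (𝓡 n) ((𝓡 n).prod 𝓘(ℝ, Model n →L[ℝ] Model n →L[ℝ] ℝ)) ∞
        (fun x ↦ TotalSpace.mk' (Model n →L[ℝ] Model n →L[ℝ] ℝ)
        (E := fun x : M ↦ TangentSpace (𝓡 n) x →L[ℝ] TangentSpace (𝓡 n) x →L[ℝ] ℝ) x 0) x :=
        (contMDiff_zeroSection ℝ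
          (fun x : M ↦ TangentSpace (𝓡 n) x →L[ℝ] TangentSpace (𝓡 n) x →L[ℝ] ℝ)) x
      refine h0.congr_of_eventuallyEq ?_
      filter_upwards [hK'.isOpen_compl.mem_nhds hxK] with z hz
      congr 1
      refine extendForm_eq_zero fun hzs ↦ ?_
      ext i j
      refine image_eq_zero_of_notMem_tsupport (f := fun z ↦ B z i j) fun h ↦
        hz ⟨_, ?_, (extChartAt (𝓡 n) c).left_inv hzs⟩
      exact Set.mem_iUnion.mpr ⟨i, Set.mem_iUnion.mpr ⟨j, h⟩⟩

end Extension

/-! ### Infinite-dimensional spaces of localized tensors -/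

section DisjointOpen

variable {n : ℕ} {M : Type*} [TopologicalSpace M] [ChartedSpace (Model n) M] [T2Space M]

/-- A manifold of positive dimension has infinitely many disjoint nonempty open subsets. -/
theorem exists_disjoint_open (hn : 2 ≤ n) [Nonempty M] :
    ∃ O : ℕ → Set M, (∀ k, IsOpen (O k)) ∧ (∀ k, (O k).Nonempty) ∧
      Pairwise fun k l ↦ Disjoint (O k) (O l) := by
  have : Infinite M := by
    obtain ⟨c⟩ := ‹Nonempty M›
    have hpos : 0 < n := by omega
    have : Nontrivial (Model n) := ⟨⟨EuclideanSpace.single ⟨0, hpos⟩ 1, 0, by simp⟩⟩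
    have h1 : (extChartAt (𝓡 n) c).target.Infinite :=
      infinite_of_mem_nhds _ ((isOpen_extChartAt_target c).mem_nhds (mem_extChartAt_target c))
    exact Set.infinite_univ_iff.mp
      ((h1.image (extChartAt (𝓡 n) c).symm.injOn).mono (Set.subset_univ _))
  obtain ⟨O, h1, h2, h3⟩ := exists_seq_infinite_isOpen_pairwise_disjoint M
  exact ⟨O, h2, fun k ↦ (h1 k).nonempty, h3⟩

end DisjointOpen

section Localized

variable {n : ℕ} {M : Type*} [TopologicalSpace M] [ChartedSpace (Model n) M]
  [IsManifold (𝓡 n) ∞ M] [T2Space M]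

/-- A tensor field with compact support in a chart that is harmonic in this chart is harmonic in all
charts. -/
theorem isHarmonicTensor_extendTensor {g : Metric n M} {c : M}
    {B : Model n → Matrix (Fin n) (Fin n) ℝ}
    (hB : ∀ i j, IsTest (extChartAt (𝓡 n) c).target fun z ↦ B z i j)
    (hBs : ∀ z ∈ (extChartAt (𝓡 n) c).target, (B z).IsSymm)
    (hd : ∀ z ∈ (extChartAt (𝓡 n) c).target, ∀ j, defect (gram g c) B j z = 0) :
    IsHarmonicTensor g (extendTensor c B hB) := by
  have hsymm : ∀ (x : M) (v w : TangentSpace (𝓡 n) x),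
      extendTensor c B hB x v w = extendTensor c B hB x w v := extendForm_symm hBs
  refine isHarmonicTensor_iff.mpr ⟨hsymm, fun c' y hy j ↦ ?_⟩
  by_cases hyc : (extChartAt (𝓡 n) c').symm y ∈ (extChartAt (𝓡 n) c).source
  · have hys : y ∈ (transition c' c).source := mem_transition_source.mpr ⟨hy, hyc⟩
    have hst : ∀ z ∈ (transition c' c).source, z ∈ (extChartAt (𝓡 n) c').target := fun z hz ↦
      (mem_transition_source.mp hz).1
    have htt : ∀ z ∈ (transition c' c).target, z ∈ (extChartAt (𝓡 n) c).target := fun z hz ↦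
      (mem_transition_target.mp hz).1
    have hg := isMetricOn_gram g c
    have hg' := isMetricOn_gram g c'
    have hT := isTensorOn_comp hsymm c'
    refine defect_eq_zero_of_pullback (transition c' c) (fun z hz ↦ contDiffAt_transition hz)
      (fun z hz ↦ contDiffAt_transition_symm hz) (G' := gram g c) (B' := B)
      ⟨fun z hz ↦ hg.smooth z (htt z hz), fun z hz ↦ hg.symm z (htt z hz),
        fun z hz ↦ hg.det_pos z (htt z hz)⟩
      ⟨fun z _ i j ↦ (hB i j).contDiff.contDiffAt, fun z hz ↦ hBs z (htt z hz)⟩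
      ⟨fun z hz ↦ hg'.smooth z (hst z hz), fun z hz ↦ hg'.symm z (hst z hz),
        fun z hz ↦ hg'.det_pos z (hst z hz)⟩
      ⟨fun z hz ↦ hT.smooth z (hst z hz), fun z hz ↦ hT.symm z (hst z hz)⟩
      (fun z hz ↦ gram_transition g hz) (fun z hz ↦ ?_) (fun z hz ↦ hd z (htt z hz)) hys j
    have := bcomp_transition (extendForm c B) hz
    rw [bcomp_extendForm B (htt _ ((transition c' c).map_source hz))] at this
    exact this
  · -- the tensor vanishes near points outside the domain of the chart around `c`
    set K : Set (Model n) := ⋃ i, ⋃ j, tsupport fun z ↦ B z i j with hK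
    have hKc : IsCompact K := isCompact_iUnion fun i ↦ isCompact_iUnion fun j ↦
      (hB i j).hasCompactSupport
    have hKt : K ⊆ (extChartAt (𝓡 n) c).target :=
      Set.iUnion_subset fun i ↦ Set.iUnion_subset fun j ↦ (hB i j).tsupport_subset
    have hK' : IsClosed ((extChartAt (𝓡 n) c).symm '' K) :=
      (hKc.image_of_continuousOn ((continuousOn_extChartAt_symm c).mono hKt)).isClosed
    have hyK : (extChartAt (𝓡 n) c').symm y ∉ (extChartAt (𝓡 n) c).symm '' K := by
      rintro ⟨z, hz, hzy⟩
      exact hyc (hzy ▸ (extChartAt (𝓡 n) c).map_target (hKt hz))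
    refine defect_eq_zero_of_eventually (fun a b ↦ ?_) j
    have hcont : ContinuousAt (extChartAt (𝓡 n) c').symm y :=
      continuousAt_extChartAt_symm'' hy
    filter_upwards [hcont (hK'.isOpen_compl.mem_nhds hyK)] with z hz
    have h0 : extendForm c B ((extChartAt (𝓡 n) c').symm z) = 0 := by
      refine extendForm_eq_zero fun hzs ↦ ?_
      ext i j
      refine image_eq_zero_of_notMem_tsupport (f := fun z ↦ B z i j) fun h ↦
        hz ⟨_, ?_, (extChartAt (𝓡 n) c).left_inv hzs⟩
      exact Set.mem_iUnion.mpr ⟨i, Set.mem_iUnion.mpr ⟨j, h⟩⟩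
    have h1 := congrArg (fun L : Model n →L[ℝ] Model n →L[ℝ] ℝ ↦
      L (coordVec c' z a) (coordVec c' z b)) h0
    exact h1

/-- Every nonempty open set contains the support of a nonzero harmonic tensor. -/
theorem exists_harmonicTensor_supported (hn : 2 ≤ n) (g : Metric n M) {O : Set M} (hO : IsOpen O)
    (hne : O.Nonempty) : ∃ φ ∈ harmonicTensors g, φ ≠ 0 ∧ ∀ x ∉ O, φ x = 0 := by
  obtain ⟨c, hc⟩ := hne
  set T : Set (Model n) := (extChartAt (𝓡 n) c).target ∩ (extChartAt (𝓡 n) c).symm ⁻¹' O with hT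
  have hTo : IsOpen T :=
    (continuousOn_extChartAt_symm c).isOpen_inter_preimage (isOpen_extChartAt_target c) hO
  have hTne : T.Nonempty := ⟨extChartAt (𝓡 n) c c, mem_extChartAt_target c, by
    rw [Set.mem_preimage, extChartAt_to_inv]; exact hc⟩
  have hg := isMetricOn_gram g c
  obtain ⟨B, hB, hBs, ⟨z₀, hz₀⟩, hBd⟩ := exists_local_harmonic hn hTo hTne (G := gram g c)
    ⟨fun z hz ↦ hg.smooth z hz.1, fun z hz ↦ hg.symm z hz.1, fun z hz ↦ hg.det_pos z hz.1⟩
    (fun x hx i ↦ (posDef_gram g hx.1).inv.diag_pos)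
  have hB0 : ∀ z ∉ T, B z = 0 := fun z hz ↦ by
    ext i j
    exact (hB i j).eq_zero hz
  have hBt : ∀ i j, IsTest (extChartAt (𝓡 n) c).target fun z ↦ B z i j := fun i j ↦
    (hB i j).mono Set.inter_subset_left
  refine ⟨extendTensor c B hBt, isHarmonicTensor_extendTensor hBt (fun z hz ↦ ?_)
    (fun z hz j ↦ ?_), fun h ↦ ?_, fun x hx ↦ ?_⟩
  · by_cases hzT : z ∈ T
    · exact hBs z hzT
    · rw [hB0 z hzT]
      exact Matrix.isSymm_zero
  · by_cases hzT : z ∈ T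
    · exact hBd z hzT j
    · exact defect_eq_zero_of_eventually (fun a b ↦ (hB a b).eventually_eq_zero hzT) j
  · have hzT : z₀ ∈ T := by_contra fun h ↦ hz₀ (hB0 z₀ h)
    refine hz₀ ?_
    rw [← bcomp_extendForm B hzT.1]
    ext i j
    have h1 := congrArg (fun ψ : TwoTensor n M ↦ TwoTensor.form ψ _ (coordVec c z₀ i)
      (coordVec c z₀ j)) h
    exact h1
  · refine extendForm_eq_zero fun hxs ↦ hB0 _ fun hxT ↦ hx ?_
    have := hxT.2
    rwa [Set.mem_preimage, (extChartAt (𝓡 n) c).left_inv hxs] at this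

/-- Evaluation of two-tensors at two tangent vectors. -/
def evalAt (x : M) (v w : TangentSpace (𝓡 n) x) : TwoTensor n M →ₗ[ℝ] ℝ where
  toFun φ := φ x v w
  map_add' _ _ := rfl
  map_smul' _ _ := rfl

/-- Nonzero elements supported in pairwise disjoint open sets are linearly independent, and in
positive dimension there are infinitely many such sets. -/
theorem not_finiteDimensional_of_localized (hn : 2 ≤ n) [Nonempty M]
    {W : Submodule ℝ (TwoTensor n M)} (h : ∀ O : Set M, IsOpen O → O.Nonempty →
      ∃ φ ∈ W, φ ≠ 0 ∧ ∀ x ∉ O, φ x = 0) : ¬ FiniteDimensional ℝ W := by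
  obtain ⟨O, hO, hne, hdisj⟩ := exists_disjoint_open (n := n) (M := M) hn
  choose φ hφ hφ0 hφO using fun k ↦ h (O k) (hO k) (hne k)
  have hex : ∀ k, ∃ x v w, evalAt x v w (φ k) ≠ 0 := by
    intro k
    by_contra! hcon
    refine hφ0 k (ContMDiffSection.ext fun x ↦ ContinuousLinearMap.ext fun v ↦
      ContinuousLinearMap.ext fun w ↦ hcon x v w)
  have hzero : ∀ k x v w, x ∉ O k → evalAt x v w (φ k) = 0 := fun k x v w hx ↦ by
    change φ k x v w = 0
    rw [hφO k x hx]
    rfl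
  have hli : LinearIndependent ℝ fun k ↦ (⟨φ k, hφ k⟩ : W) := by
    refine linearIndependent_iff'.mpr fun s a hs i hi ↦ ?_
    obtain ⟨x, v, w, hx⟩ := hex i
    have hxO : x ∈ O i := by_contra fun hx' ↦ hx (hzero i x v w hx')
    have h1 := congrArg (fun ψ : W ↦ (evalAt x v w ∘ₗ W.subtype) ψ) hs
    simp only [map_sum, map_smul, map_zero] at h1
    rw [Finset.sum_eq_single i] at h1
    · exact (mul_eq_zero.mp h1).resolve_right hx
    · intro k _ hki
      have : x ∉ O k := fun hxk ↦ Set.disjoint_left.mp (hdisj hki) hxk hxO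
      change a k * evalAt x v w (φ k) = 0
      rw [hzero k x v w this, mul_zero]
    · exact fun hni ↦ (hni hi).elim
  intro hfin
  exact not_finite_iff_infinite.mpr inferInstance (hli.finite : Finite ℕ)

end Localized

/-! ### The Riemannian volume in charts -/

section Volume

variable {n : ℕ} {M : Type*} [TopologicalSpace M] [ChartedSpace (Model n) M]
  [MeasurableSpace M] [BorelSpace M]

theorem measurableSet_preimage_symm (c : M) {A : Set M} (hA : MeasurableSet A) :
    MeasurableSet ((extChartAt (𝓡 n) c).target ∩ (extChartAt (𝓡 n) c).symm ⁻¹' A) := by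
  classical
  have h := (continuousOn_extChartAt_symm (I := 𝓡 n) c).measurable_piecewise
    (g := fun _ ↦ c) (continuousOn_const) (isOpen_extChartAt_target (I := 𝓡 n) c).measurableSet
  have h2 := (isOpen_extChartAt_target (I := 𝓡 n) c).measurableSet.inter (h hA)
  convert h2 using 1
  ext y
  simp only [Set.mem_inter_iff, Set.mem_preimage]
  refine and_congr_right fun hy ↦ ?_
  rw [Set.piecewise_eq_of_mem _ _ _ hy]

theorem aemeasurable_symm (c : M) (f : Model n → ENNReal) : AEMeasurable (extChartAt (𝓡 n) c).symm
    ((volume.restrict (extChartAt (𝓡 n) c).target).withDensity f) := by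
  refine AEMeasurable.mono_ac ?_ (withDensity_absolutelyContinuous _ _)
  exact (continuousOn_extChartAt_symm c).aemeasurable (isOpen_extChartAt_target c).measurableSet

variable [IsManifold (𝓡 n) ∞ M]

theorem chartVolume_apply (g : Metric n M) (c : M) {A : Set M} (hA : MeasurableSet A) :
    chartVolume g c A = ∫⁻ y in (extChartAt (𝓡 n) c).target ∩ (extChartAt (𝓡 n) c).symm ⁻¹' A,
      ENNReal.ofReal √(gram g c y).det := by
  have ht := (isOpen_extChartAt_target (I := 𝓡 n) c).measurableSet
  have hP := measurableSet_preimage_symm (n := n) c hA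
  rw [chartVolume, Measure.map_apply_of_aemeasurable (aemeasurable_symm c _) hA]
  have h1 : ∀ ν : Measure (Model n), ν (extChartAt (𝓡 n) c).targetᶜ = 0 →
      ν ((extChartAt (𝓡 n) c).symm ⁻¹' A)
        = ν ((extChartAt (𝓡 n) c).target ∩ (extChartAt (𝓡 n) c).symm ⁻¹' A) := by
    intro ν hν
    refine le_antisymm ?_ (measure_mono Set.inter_subset_right)
    refine (measure_mono (t := (extChartAt (𝓡 n) c).target ∩ (extChartAt (𝓡 n) c).symm ⁻¹' A
      ∪ (extChartAt (𝓡 n) c).targetᶜ) fun y hy ↦ ?_).trans ((measure_union_le _ _).trans ?_)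
    · by_cases h : y ∈ (extChartAt (𝓡 n) c).target
      exacts [Or.inl ⟨h, hy⟩, Or.inr h]
    · rw [hν, add_zero]
  rw [h1, withDensity_apply _ hP, Measure.restrict_restrict hP]
  · congr 2
    rw [Set.inter_right_comm, Set.inter_self]
  · exact withDensity_absolutelyContinuous _ _ (by
      rw [Measure.restrict_apply ht.compl, Set.compl_inter_self, measure_empty])

/-- The chart volumes agree on the overlap of two charts. -/
theorem chartVolume_eq_of_subset (g : Metric n M) {c c' : M} {A : Set M} (hA : MeasurableSet A)
    (hc : A ⊆ (extChartAt (𝓡 n) c).source) (hc' : A ⊆ (extChartAt (𝓡 n) c').source) :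
    chartVolume g c A = chartVolume g c' A := by
  rw [chartVolume_apply g c hA, chartVolume_apply g c' hA]
  set S := (extChartAt (𝓡 n) c).target ∩ (extChartAt (𝓡 n) c).symm ⁻¹' A with hS
  have hSs : S ⊆ (transition c c').source := fun y hy ↦ mem_transition_source.mpr ⟨hy.1, hc' hy.2⟩
  have himg : (transition c c') '' S
      = (extChartAt (𝓡 n) c').target ∩ (extChartAt (𝓡 n) c').symm ⁻¹' A := by
    ext z
    constructor
    · rintro ⟨y, hy, rfl⟩
      refine ⟨(mem_transition_target.mp ((transition c c').map_source (hSs hy))).1, ?_⟩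
      rw [Set.mem_preimage, symm_transition (hSs hy)]
      exact hy.2
    · rintro ⟨hz, hzA⟩
      have hzt : z ∈ (transition c c').target := mem_transition_target.mpr ⟨hz, hc hzA⟩
      refine ⟨(transition c c').symm z, ⟨(mem_transition_source.mp
        ((transition c c').map_target hzt)).1, ?_⟩, (transition c c').right_inv hzt⟩
      rw [Set.mem_preimage, ← symm_transition ((transition c c').map_target hzt),
        (transition c c').right_inv hzt]
      exact hzA
  rw [← himg, lintegral_image_eq_lintegral_abs_det_fderiv_mul volume
    (measurableSet_preimage_symm c hA)
    (fun y hy ↦ ((contDiffAt_transition (hSs hy)).differentiableAt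
      (by simp)).hasFDerivAt.hasFDerivWithinAt) ((transition c c').injOn.mono hSs)]
  refine setLIntegral_congr_fun (measurableSet_preimage_symm c hA) fun y hy ↦ ?_
  rw [gram_transition g (hSs hy), sqrt_det_pullback, ENNReal.ofReal_mul (abs_nonneg _),
    det_fderiv ((contDiffAt_transition (hSs hy)).differentiableAt (by simp))]

theorem chartVolume_compl_source (g : Metric n M) (c : M) :
    chartVolume g c (extChartAt (𝓡 n) c).sourceᶜ = 0 := by
  rw [chartVolume_apply g c (isOpen_extChartAt_source c).measurableSet.compl]
  have : (extChartAt (𝓡 n) c).target ∩ (extChartAt (𝓡 n) c).symm ⁻¹' (extChartAt (𝓡 n) c).sourceᶜ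
      = ∅ := by
    ext y
    simp only [Set.mem_inter_iff, Set.mem_preimage, Set.mem_compl_iff, Set.mem_empty_iff_false,
      iff_false, not_and, not_not]
    exact fun hy ↦ (extChartAt (𝓡 n) c).map_target hy
  rw [this, Measure.restrict_empty, lintegral_zero_measure]

/-- The Riemannian volume is the chart volume on the domain of every chart. -/
theorem riemannianVolume_restrict [T2Space M] (g : Metric n M) (c : M) :
    (riemannianVolume g).restrict (extChartAt (𝓡 n) c).source = chartVolume g c := by
  have hs := (isOpen_extChartAt_source (I := 𝓡 n) c).measurableSet
  -- a measure that dominates all chart volumes and is equal to the one of `c` on its domain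
  set ν : Measure M := chartVolume g c
    + (⊤ : ENNReal) • Measure.count.restrict (extChartAt (𝓡 n) c).sourceᶜ with hν
  have hle : riemannianVolume g ≤ ν := by
    refine iSup_le fun c' ↦ Measure.le_iff.mpr fun A hA ↦ ?_
    have hs' := (isOpen_extChartAt_source (I := 𝓡 n) c').measurableSet
    rw [← measure_inter_add_sdiff A hs]
    refine add_le_add ?_ ?_
    · have h1 : chartVolume g c' (A ∩ (extChartAt (𝓡 n) c).source)
          ≤ chartVolume g c' (A ∩ (extChartAt (𝓡 n) c).source ∩ (extChartAt (𝓡 n) c').source) := by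
        rw [← measure_inter_add_sdiff (A ∩ (extChartAt (𝓡 n) c).source) hs']
        have h2 : chartVolume g c' ((A ∩ (extChartAt (𝓡 n) c).source)
            \ (extChartAt (𝓡 n) c').source) = 0 :=
          measure_mono_null (fun x hx ↦ hx.2) (chartVolume_compl_source g c')
        rw [h2, add_zero]
      refine h1.trans ?_
      rw [chartVolume_eq_of_subset g (c' := c) ((hA.inter hs).inter hs') (fun x hx ↦ hx.2)
        fun x hx ↦ hx.1.2]
      exact measure_mono fun x hx ↦ hx.1.1
    · change _ ≤ ((⊤ : ENNReal) • Measure.count.restrict (extChartAt (𝓡 n) c).sourceᶜ : Measure M) A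
      rw [Measure.smul_apply, Measure.restrict_apply hA, smul_eq_mul]
      obtain h | h := (A \ (extChartAt (𝓡 n) c).source).eq_empty_or_nonempty
      · rw [h, measure_empty]
        exact zero_le
      · have : Measure.count (A ∩ (extChartAt (𝓡 n) c).sourceᶜ) ≠ 0 := Measure.count_ne_zero h
        rw [ENNReal.top_mul this]
        exact le_top
  refine le_antisymm ?_ ?_
  · refine Measure.le_iff.mpr fun A hA ↦ ?_
    rw [Measure.restrict_apply hA]
    refine (hle _).trans ?_
    rw [hν, Measure.add_apply, Measure.smul_apply, Measure.restrict_apply (hA.inter hs)]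
    have : A ∩ (extChartAt (𝓡 n) c).source ∩ (extChartAt (𝓡 n) c).sourceᶜ = ∅ := by
      rw [Set.inter_assoc, Set.inter_compl_self, Set.inter_empty]
    rw [this, measure_empty, smul_zero, add_zero]
    exact measure_mono Set.inter_subset_left
  · refine Measure.le_iff.mpr fun A hA ↦ ?_
    rw [Measure.restrict_apply hA, ← measure_inter_add_sdiff A hs]
    have : chartVolume g c (A \ (extChartAt (𝓡 n) c).source) = 0 :=
      measure_mono_null (fun x hx ↦ hx.2) (chartVolume_compl_source g c)
    rw [this, add_zero]
    exact le_iSup (fun c ↦ chartVolume g c) c _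

theorem isFiniteMeasure_riemannianVolume [T2Space M] [CompactSpace M] (g : Metric n M) :
    IsFiniteMeasure (riemannianVolume g) := by
  have : IsFiniteMeasureOnCompacts (riemannianVolume g) := by
    refine ⟨fun K hK ↦ hK.measure_lt_top_of_nhdsWithin fun x _ ↦ ?_⟩
    set c := x
    obtain ⟨r, hr, hrt⟩ := Metric.isOpen_iff.mp (isOpen_extChartAt_target (I := 𝓡 n) c) _
      (mem_extChartAt_target c)
    set L : Set (Model n) := Metric.closedBall (extChartAt (𝓡 n) c c) (r / 2) with hL
    have hLt : L ⊆ (extChartAt (𝓡 n) c).target :=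
      (Metric.closedBall_subset_ball (by linarith)).trans hrt
    set N : Set M := (extChartAt (𝓡 n) c).source ∩ extChartAt (𝓡 n) c ⁻¹'
      Metric.ball (extChartAt (𝓡 n) c c) (r / 2) with hN
    have hNo : IsOpen N := isOpen_extChartAt_preimage' c Metric.isOpen_ball
    have hxN : x ∈ N := ⟨mem_extChartAt_source x, Metric.mem_ball_self (by positivity)⟩
    refine ⟨N, mem_nhdsWithin_of_mem_nhds (hNo.mem_nhds hxN), ?_⟩
    have h1 : riemannianVolume g N = chartVolume g c N := by
      rw [← riemannianVolume_restrict g c, Measure.restrict_apply hNo.measurableSet,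
        Set.inter_eq_left.mpr fun z hz ↦ hz.1]
    rw [h1, chartVolume_apply g c hNo.measurableSet]
    have hsub : (extChartAt (𝓡 n) c).target ∩ (extChartAt (𝓡 n) c).symm ⁻¹' N ⊆ L := by
      rintro y ⟨hy, _, hyN⟩
      rw [Set.mem_preimage, (extChartAt (𝓡 n) c).right_inv hy] at hyN
      exact Metric.ball_subset_closedBall hyN
    refine (lintegral_mono_set hsub).trans_lt ?_
    have hcont : ContinuousOn (fun y ↦ √(gram g c y).det) L := fun y hy ↦
      ((isMetricOn_gram g c).sqrt_det (hLt hy)).continuousAt.continuousWithinAt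
    have hint : IntegrableOn (fun y ↦ √(gram g c y).det) L :=
      hcont.integrableOn_compact (isCompact_closedBall _ _)
    exact (hasFiniteIntegral_iff_ofReal (Filter.Eventually.of_forall fun y ↦
      Real.sqrt_nonneg _)).mp hint.2
  exact ⟨isCompact_univ.measure_lt_top⟩

/-- Integrals of functions that vanish outside a chart, in coordinates. -/
theorem integral_riemannianVolume [T2Space M] (g : Metric n M) (c : M) {f : M → ℝ}
    (hf : ContinuousOn f (extChartAt (𝓡 n) c).source)
    (h0 : ∀ x ∉ (extChartAt (𝓡 n) c).source, f x = 0) :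
    ∫ x, f x ∂(riemannianVolume g) = ∫ y in (extChartAt (𝓡 n) c).target,
      √(gram g c y).det * f ((extChartAt (𝓡 n) c).symm y) := by
  have hs := (isOpen_extChartAt_source (I := 𝓡 n) c).measurableSet
  have ht := (isOpen_extChartAt_target (I := 𝓡 n) c).measurableSet
  rw [← setIntegral_eq_integral_of_forall_compl_eq_zero h0]
  have hm : AEStronglyMeasurable f (chartVolume g c) := by
    rw [← riemannianVolume_restrict g c]
    obtain h | h := isEmpty_or_nonempty M
    · exact (measurable_of_empty f).aestronglyMeasurable
    · exact (hf.aemeasurable hs).aestronglyMeasurable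
  rw [riemannianVolume_restrict g c, chartVolume, integral_map (aemeasurable_symm c _) hm,
    integral_withDensity_eq_integral_toReal_smul₀]
  · refine setIntegral_congr_fun ht fun y _ ↦ ?_
    simp [ENNReal.toReal_ofReal (Real.sqrt_nonneg _)]
  · refine AEMeasurable.ennreal_ofReal (ContinuousOn.aemeasurable (fun y hy ↦ ?_) ht)
    exact ((isMetricOn_gram g c).sqrt_det hy).continuousAt.continuousWithinAt
  · exact Filter.Eventually.of_forall fun y ↦ ENNReal.ofReal_lt_top

end Volume

/-! ### The integral of the trace of the Lie derivative -/

section TraceLie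

variable {n : ℕ}

theorem lie_congr {B : Model n → Matrix (Fin n) (Fin n) ℝ} {X Y : Fin n → Model n → ℝ}
    {y : Model n} (h : ∀ k, X k =ᶠ[nhds y] Y k) : lie B X y = lie B Y y := by
  have h1 : jac X y = jac Y y := by
    ext k i
    exact pd_congr (h k)
  have h2 : ∀ k, X k y = Y k y := fun k ↦ (h k).self_of_nhds
  simp only [lie, h1, h2]

theorem trLie_congr {G B : Model n → Matrix (Fin n) (Fin n) ℝ} {X Y : Fin n → Model n → ℝ}
    {y : Model n} (h : ∀ k, X k =ᶠ[nhds y] Y k) : trLie G B X y = trLie G B Y y := by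
  rw [trLie, trLie, lie_congr h]

theorem trLie_sum {ι : Type*} {s : Finset ι} {G B : Model n → Matrix (Fin n) (Fin n) ℝ}
    {X : ι → Fin n → Model n → ℝ} {y : Model n}
    (hX : ∀ a ∈ s, ∀ k, DifferentiableAt ℝ (X a k) y) :
    trLie G B (fun k z ↦ ∑ a ∈ s, X a k z) y = ∑ a ∈ s, trLie G B (X a) y := by
  have h1 : jac (fun k z ↦ ∑ a ∈ s, X a k z) y = ∑ a ∈ s, jac (X a) y := by
    ext k i
    rw [Matrix.sum_apply]
    exact pd_sum fun a ha ↦ hX a ha k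
  have h2 : lie B (fun k z ↦ ∑ a ∈ s, X a k z) y = ∑ a ∈ s, lie B (X a) y := by
    simp only [lie, h1, Finset.sum_add_distrib, Finset.sum_smul, Matrix.transpose_sum,
      Finset.sum_mul, Finset.mul_sum]
    rw [Finset.sum_comm]
  rw [trLie, h2, Finset.mul_sum, Matrix.trace_sum]
  rfl

theorem contDiffAt_trLie {O : Set (Model n)} {G B : Model n → Matrix (Fin n) (Fin n) ℝ}
    {X : Fin n → Model n → ℝ} (hG : IsMetricOn O G) (hB : SmoothMat O B)
    (hX : ∀ y ∈ O, ∀ k, ContDiffAt ℝ ∞ (X k) y) {y : Model n} (hy : y ∈ O) :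
    ContDiffAt ℝ ∞ (trLie G B X) y := by
  have hJ : SmoothMat O (jac X) := fun z hz i j ↦ contDiffAt_pd (hX z hz i) j
  have hJt : SmoothMat O (fun z ↦ (jac X z)ᵀ) := fun z hz i j ↦ hJ z hz j i
  have hL : SmoothMat O (lie B X) := by
    intro z hz i j
    simp only [lie, Matrix.add_apply, Matrix.sum_apply, Matrix.smul_apply, smul_eq_mul]
    exact ((ContDiffAt.sum fun k _ ↦ (hX z hz k).mul (hB.pdM k z hz i j)).add
      (hJt.mul hB z hz i j)).add (hB.mul hJ z hz i j)
  exact (hG.inv.mul hL).trace hy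

end TraceLie

section DivergenceTheorem

variable {n : ℕ} {M : Type*} [TopologicalSpace M] [ChartedSpace (Model n) M]

/-- The components `Vₖ` of a smooth vector field, in all charts. -/
structure IsVectorField (V : M → Fin n → Model n → ℝ) : Prop where
  smooth : ∀ c, ∀ y ∈ (extChartAt (𝓡 n) c).target, ∀ k, ContDiffAt ℝ ∞ (V c k) y
  transition : ∀ c c' : M, ∀ y ∈ (transition c c').source, ∀ k,
    V c' k (transition c c' y) = ∑ i, jacM (transition c c') y k i * V c i y

/-- The components of the product of a function and a vector field. -/
def smulField (ρ : M → ℝ) (V : M → Fin n → Model n → ℝ) (c : M) (k : Fin n) (z : Model n) : ℝ :=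
  ρ ((extChartAt (𝓡 n) c).symm z) * V c k z

variable [IsManifold (𝓡 n) ∞ M]

theorem contDiffAt_comp_symm {ρ : M → ℝ} (hρ : ContMDiff (𝓡 n) 𝓘(ℝ, ℝ) ∞ ρ) {c : M} {y : Model n}
    (hy : y ∈ (extChartAt (𝓡 n) c).target) :
    ContDiffAt ℝ ∞ (fun z ↦ ρ ((extChartAt (𝓡 n) c).symm z)) y := by
  have hs : ContMDiffAt 𝓘(ℝ, Model n) (𝓡 n) ∞ (extChartAt (𝓡 n) c).symm y :=
    (contMDiffOn_extChartAt_symm c).contMDiffAt ((isOpen_extChartAt_target c).mem_nhds hy)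
  exact (hρ.contMDiffAt.comp y hs).contDiffAt

theorem IsVectorField.smul {V : M → Fin n → Model n → ℝ} (hV : IsVectorField V) {ρ : M → ℝ}
    (hρ : ContMDiff (𝓡 n) 𝓘(ℝ, ℝ) ∞ ρ) : IsVectorField (smulField ρ V) := by
  refine ⟨fun c y hy k ↦ (contDiffAt_comp_symm hρ hy).mul (hV.smooth c y hy k),
    fun c c' y hy k ↦ ?_⟩
  simp only [smulField, symm_transition hy, hV.transition c c' y hy k, Finset.mul_sum]
  exact Finset.sum_congr rfl fun i _ ↦ by ring

/-- The function `tr_g (L_V h)`. -/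
def traceLie (g h : Metric n M) (V : M → Fin n → Model n → ℝ) (x : M) : ℝ :=
  trLie (gram g x) (gram h x) (V x) (extChartAt (𝓡 n) x x)

theorem trLie_transition (g h : Metric n M) {V : M → Fin n → Model n → ℝ} (hV : IsVectorField V)
    {c c' : M} {y : Model n} (hy : y ∈ (transition c c').source) :
    trLie (gram g c) (gram h c) (V c) y
      = trLie (gram g c') (gram h c') (V c') (transition c c' y) := by
  have ht := (mem_transition_target.mp ((transition c c').map_source hy)).1
  have hnhds := (transition c c').open_source.mem_nhds hy
  refine trLie_pullback (contDiffAt_transition hy) ((isMetricOn_gram h c').smooth.entryDiff ht)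
    (fun k ↦ (hV.smooth c y (mem_transition_source.mp hy).1 k).differentiableAt (by simp))
    (fun k ↦ (hV.smooth c' _ ht k).differentiableAt (by simp)) (det_jacM_transition hy)
    (gram_transition g hy) ?_ ?_
  · filter_upwards [hnhds] with z hz using gram_transition h hz
  · filter_upwards [hnhds] with z hz using hV.transition c c' z hz

theorem traceLie_eq (g h : Metric n M) {V : M → Fin n → Model n → ℝ} (hV : IsVectorField V)
    {c x : M} (hx : x ∈ (extChartAt (𝓡 n) c).source) :
    traceLie g h V x = trLie (gram g c) (gram h c) (V c) (extChartAt (𝓡 n) c x) := by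
  have hs : extChartAt (𝓡 n) x x ∈ (transition x c).source :=
    mem_transition_source.mpr ⟨mem_extChartAt_target x, by rwa [extChartAt_to_inv]⟩
  rw [traceLie, trLie_transition g h hV hs, transition_apply, extChartAt_to_inv]

theorem continuous_traceLie (g h : Metric n M) {V : M → Fin n → Model n → ℝ}
    (hV : IsVectorField V) : Continuous (traceLie g h V) := by
  refine continuous_iff_continuousAt.mpr fun x ↦ ?_
  have h1 : ContinuousAt (fun z ↦ trLie (gram g x) (gram h x) (V x) (extChartAt (𝓡 n) x z)) x :=
    ContinuousAt.comp (g := trLie (gram g x) (gram h x) (V x))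
      (contDiffAt_trLie (isMetricOn_gram g x) (isMetricOn_gram h x).smooth (hV.smooth x)
        (mem_extChartAt_target x)).continuousAt (continuousAt_extChartAt x)
  refine h1.congr ?_
  filter_upwards [(isOpen_extChartAt_source (I := 𝓡 n) x).mem_nhds
    (mem_extChartAt_source (I := 𝓡 n) x)] with z hz
  exact (traceLie_eq g h hV hz).symm

variable [MeasurableSpace M] [BorelSpace M] [T2Space M] [CompactSpace M]

theorem integral_traceLie_smul {g h : Metric n M} (hd : ∀ c, ∀ y ∈ (extChartAt (𝓡 n) c).target,
    ∀ j, defect (gram g c) (gram h c) j y = 0) {V : M → Fin n → Model n → ℝ}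
    (hV : IsVectorField V) {ρ : M → ℝ} (hρ : ContMDiff (𝓡 n) 𝓘(ℝ, ℝ) ∞ ρ) {c : M}
    (hs : tsupport ρ ⊆ (extChartAt (𝓡 n) c).source) :
    ∫ x, traceLie g h (smulField ρ V) x ∂(riemannianVolume g) = 0 := by
  classical
  have hW := hV.smul hρ
  have hto := isOpen_extChartAt_target (I := 𝓡 n) c
  have h0 : ∀ x ∉ (extChartAt (𝓡 n) c).source, traceLie g h (smulField ρ V) x = 0 := by
    intro x hx
    have hρx : ρ =ᶠ[nhds x] fun _ ↦ 0 := notMem_tsupport_iff_eventuallyEq.mp fun hcon ↦ hx (hs hcon)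
    refine trLie_eq_zero fun k ↦ ?_
    have hc := continuousAt_extChartAt_symm (I := 𝓡 n) x
    have h1 : ∀ᶠ z in nhds (extChartAt (𝓡 n) x x), ρ ((extChartAt (𝓡 n) x).symm z) = 0 :=
      hc.eventually (by rw [extChartAt_to_inv]; exact hρx)
    filter_upwards [h1] with z hz
    rw [smulField, hz, zero_mul]
  rw [integral_riemannianVolume g c (continuous_traceLie g h hW).continuousOn h0]
  set X : Fin n → Model n → ℝ := fun k z ↦
    if z ∈ (extChartAt (𝓡 n) c).target then smulField ρ V c k z else 0 with hX
  have hXe : ∀ y ∈ (extChartAt (𝓡 n) c).target, ∀ k, X k =ᶠ[nhds y] smulField ρ V c k := by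
    intro y hy k
    filter_upwards [hto.mem_nhds hy] with z hz
    simp only [hX]
    rw [if_pos hz]
  have hXt : ∀ k, IsTest (extChartAt (𝓡 n) c).target (X k) := by
    intro k
    refine .of_compact (K := extChartAt (𝓡 n) c '' tsupport ρ)
      ((isClosed_tsupport ρ).isCompact.image_of_continuousOn ((continuousOn_extChartAt c).mono hs))
      (Set.image_subset_iff.mpr fun x hx ↦ (extChartAt (𝓡 n) c).map_source (hs hx))
      (fun y hy ↦ (hW.smooth c y hy k).congr_of_eventuallyEq (hXe y hy k)) fun y hy ↦ ?_
    by_cases hyt : y ∈ (extChartAt (𝓡 n) c).target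
    · have : ρ ((extChartAt (𝓡 n) c).symm y) = 0 := image_eq_zero_of_notMem_tsupport fun hcon ↦
        hy ⟨_, hcon, (extChartAt (𝓡 n) c).right_inv hyt⟩
      simp only [hX]
      rw [if_pos hyt, smulField, this, zero_mul]
    · simp only [hX]
      rw [if_neg hyt]
  have h1 : ∫ y in (extChartAt (𝓡 n) c).target,
      √(gram g c y).det * traceLie g h (smulField ρ V) ((extChartAt (𝓡 n) c).symm y)
      = ∫ y in (extChartAt (𝓡 n) c).target,
        √(gram g c y).det * trLie (gram g c) (gram h c) X y := by
    refine setIntegral_congr_fun hto.measurableSet fun y hy ↦ ?_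
    rw [traceLie_eq g h hW ((extChartAt (𝓡 n) c).map_target hy),
      (extChartAt (𝓡 n) c).right_inv hy, trLie_congr (hXe y hy)]
  rw [h1, setIntegral_eq_integral_of_forall_compl_eq_zero fun y hy ↦ by
    rw [trLie_eq_zero fun k ↦ (hXt k).eventually_eq_zero hy, mul_zero],
    integral_trLie hto (isMetricOn_gram g c)
      ⟨(isMetricOn_gram h c).smooth, (isMetricOn_gram h c).symm⟩ hXt]
  have h2 : ∀ y, ∑ k, X k y * (√(gram g c y).det * defect (gram g c) (gram h c) k y) = 0 := by
    refine fun y ↦ Finset.sum_eq_zero fun k _ ↦ ?_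
    by_cases hy : y ∈ (extChartAt (𝓡 n) c).target
    · rw [hd c y hy k, mul_zero, mul_zero]
    · rw [(hXt k).eq_zero hy, zero_mul]
  simp [h2]

/-- If `h` is harmonic with respect to `g`, the integral of `tr_g (L_V h)` vanishes for all vector
fields `V`. A partition of unity reduces this to vector fields with support in a chart. -/
theorem integral_traceLie {g h : Metric n M} (hd : ∀ c, ∀ y ∈ (extChartAt (𝓡 n) c).target,
    ∀ j, defect (gram g c) (gram h c) j y = 0) {V : M → Fin n → Model n → ℝ}
    (hV : IsVectorField V) : ∫ x, traceLie g h V x ∂(riemannianVolume g) = 0 := by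
  obtain ⟨t, ht⟩ := isCompact_univ.elim_finite_subcover
    (fun c : M ↦ (extChartAt (𝓡 n) c).source) (fun c ↦ isOpen_extChartAt_source c)
    fun x _ ↦ Set.mem_iUnion.mpr ⟨x, mem_extChartAt_source x⟩
  obtain ⟨ρ, hρ⟩ := SmoothPartitionOfUnity.exists_isSubordinate (𝓡 n) isClosed_univ
    (fun c : t ↦ (extChartAt (𝓡 n) (c : M)).source) (fun c ↦ isOpen_extChartAt_source (c : M))
    fun x hx ↦ by
      obtain ⟨c, hc, hxc⟩ := Set.mem_iUnion₂.mp (ht hx)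
      exact Set.mem_iUnion.mpr ⟨⟨c, hc⟩, hxc⟩
  have hρs : ∀ a, ContMDiff (𝓡 n) 𝓘(ℝ, ℝ) ∞ (ρ a) := fun a ↦ (ρ a).contMDiff
  have hsum : ∀ x, ∑ a, ρ a x = 1 := fun x ↦ by
    rw [← finsum_eq_sum_of_fintype]
    exact ρ.sum_eq_one (Set.mem_univ x)
  have h1 : ∀ x, traceLie g h V x = ∑ a, traceLie g h (smulField (ρ a) V) x := by
    intro x
    simp only [traceLie]
    rw [← trLie_sum fun a _ k ↦ (((hV.smul (hρs a)).smooth x) _ (mem_extChartAt_target x)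
      k).differentiableAt (by simp)]
    refine trLie_congr fun k ↦ Filter.Eventually.of_forall fun z ↦ ?_
    simp only [smulField, ← Finset.sum_mul, hsum, one_mul]
  have := isFiniteMeasure_riemannianVolume g
  have hint : ∀ a, Integrable (traceLie g h (smulField (ρ a) V)) (riemannianVolume g) := by
    intro a
    have hc := continuous_traceLie g h (hV.smul (hρs a))
    rw [← integrableOn_univ]
    exact hc.continuousOn.integrableOn_compact isCompact_univ
  simp only [h1]
  rw [integral_finsetSum _ fun a _ ↦ hint a]
  exact Finset.sum_eq_zero fun a _ ↦ integral_traceLie_smul hd hV (hρs a) (hρ a)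

end DivergenceTheorem

/-! ### Perturbations of a Riemannian metric -/

section MetricFamily

variable {n : ℕ}

/-- A metric is harmonic with respect to itself. -/
theorem defect_self {O : Set (Model n)} (hO : IsOpen O) {G : Model n → Matrix (Fin n) (Fin n) ℝ}
    (hG : IsMetricOn O G) {y : Model n} (hy : y ∈ O) (j : Fin n) : defect G G j y = 0 := by
  have hGe := hG.smooth.entryDiff hy
  have hs : ∀ᶠ z in nhds y, (G z).IsSymm := by
    filter_upwards [hO.mem_nhds hy] with x hx using hG.symm x hx
  have h := sqrt_det_mul_defect hGe hGe (hG.det_pos y hy) hs hs j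
  have h1 : ∀ i, pd i (fun z ↦ √(G z).det * ((G z)⁻¹ * G z) i j) y
      = if i = j then pd j (fun z ↦ √(G z).det) y else 0 := by
    intro i
    have : (fun z ↦ √(G z).det * ((G z)⁻¹ * G z) i j)
        =ᶠ[nhds y] fun z ↦ (if i = j then 1 else 0) * √(G z).det := by
      filter_upwards [hO.mem_nhds hy] with z hz
      rw [Matrix.nonsing_inv_mul _ (isUnit_iff_ne_zero.mpr (hG.det_pos z hz).ne'),
        Matrix.one_apply, mul_comm]
    rw [pd_congr this, pd_const_mul _ ((hG.sqrt_det hy).differentiableAt (by simp))]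
    split_ifs with hij
    · rw [hij, one_mul]
    · rw [zero_mul]
  simp only [h1, Finset.sum_ite_eq', Finset.mem_univ, if_true] at h
  rw [pd_sqrt_det hGe (hG.det_pos y hy), sub_self] at h
  exact (mul_eq_zero.mp h).resolve_left (Real.sqrt_pos.mpr (hG.det_pos y hy)).ne'

theorem continuousAt_quadratic {A : Model n → Matrix (Fin n) (Fin n) ℝ} {y : Model n}
    (hA : ∀ i j, ContinuousAt (fun z ↦ A z i j) y) (v : Fin n → ℝ) :
    ContinuousAt (fun p : Model n × (Fin n → ℝ) ↦ p.2 ⬝ᵥ A p.1 *ᵥ p.2) (y, v) := by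
  simp only [dotProduct, Matrix.mulVec]
  have hc : ∀ i, ContinuousAt (fun p : Model n × (Fin n → ℝ) ↦ p.2 i) (y, v) := fun i ↦
    ((continuous_apply i).comp continuous_snd).continuousAt
  refine tendsto_finsetSum _ fun i _ ↦ (hc i).mul (tendsto_finsetSum _ fun j _ ↦ ?_)
  exact ContinuousAt.mul (ContinuousAt.comp (g := fun z ↦ A z i j) (f := Prod.fst) (hA i j)
    continuousAt_fst) (hc j)

theorem quadratic_smul (A : Matrix (Fin n) (Fin n) ℝ) (a : ℝ) (v : Fin n → ℝ) :
    (a • v) ⬝ᵥ A *ᵥ (a • v) = a ^ 2 * (v ⬝ᵥ A *ᵥ v) := by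
  rw [Matrix.mulVec_smul, smul_dotProduct, dotProduct_smul]
  simp only [smul_eq_mul]
  ring

/-- A continuous field of quadratic forms is locally bounded by a multiple of a positive definite
one, since this holds on the unit sphere at one point. -/
theorem eventually_quadratic_le {G B : Model n → Matrix (Fin n) (Fin n) ℝ} {y : Model n}
    (hG : ∀ i j, ContinuousAt (fun z ↦ G z i j) y) (hB : ∀ i j, ContinuousAt (fun z ↦ B z i j) y)
    (hpos : (G y).PosDef) :
    ∃ C, ∀ᶠ z in nhds y, ∀ v, |v ⬝ᵥ B z *ᵥ v| ≤ C * (v ⬝ᵥ G z *ᵥ v) := by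
  have hS : IsCompact (Metric.sphere (0 : Fin n → ℝ) 1) := isCompact_sphere 0 1
  have hp : ∀ v ∈ Metric.sphere (0 : Fin n → ℝ) 1, 0 < v ⬝ᵥ G y *ᵥ v := fun v hv ↦ by
    have hv0 : v ≠ 0 := ne_zero_of_mem_sphere one_ne_zero ⟨v, hv⟩
    simpa using hpos.dotProduct_mulVec_pos hv0
  have hcont : ∀ A : Matrix (Fin n) (Fin n) ℝ, Continuous fun v : Fin n → ℝ ↦ v ⬝ᵥ A *ᵥ v :=
    fun A ↦ Continuous.dotProduct continuous_id
      (Continuous.matrix_mulVec continuous_const continuous_id)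
  obtain ⟨C, hC⟩ := hS.exists_bound_of_continuousOn
    (f := fun v ↦ (v ⬝ᵥ B y *ᵥ v) / (v ⬝ᵥ G y *ᵥ v))
    ((hcont _).continuousOn.div (hcont _).continuousOn fun v hv ↦ (hp v hv).ne')
  refine ⟨C + 1, ?_⟩
  have hev : ∀ᶠ z in nhds y, ∀ v ∈ Metric.sphere (0 : Fin n → ℝ) 1,
      |v ⬝ᵥ B z *ᵥ v| < (C + 1) * (v ⬝ᵥ G z *ᵥ v) := by
    refine hS.eventually_forall_of_forall_eventually fun v hv ↦ ?_
    refine ContinuousAt.eventually_lt (f := fun p : Model n × (Fin n → ℝ) ↦ |p.2 ⬝ᵥ B p.1 *ᵥ p.2|)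
      (g := fun p ↦ (C + 1) * (p.2 ⬝ᵥ G p.1 *ᵥ p.2)) (continuousAt_quadratic hB v).abs
      (continuousAt_const.mul (continuousAt_quadratic hG v)) ?_
    have h1 := hC v hv
    rw [Real.norm_eq_abs, abs_div, abs_of_pos (hp v hv), div_le_iff₀ (hp v hv)] at h1
    have := hp v hv
    simp only
    linarith
  filter_upwards [hev] with z hz v
  by_cases hv : v = 0
  · simp [hv]
  · have hn : 0 < ‖v‖ := norm_pos_iff.mpr hv
    have hw : ‖v‖⁻¹ • v ∈ Metric.sphere (0 : Fin n → ℝ) 1 := by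
      rw [mem_sphere_zero_iff_norm, norm_smul, norm_inv, norm_norm, inv_mul_cancel₀ hn.ne']
    have h1 := (hz _ hw).le
    rw [quadratic_smul, quadratic_smul, abs_mul, abs_of_nonneg (sq_nonneg ‖v‖⁻¹)] at h1
    have h2 : 0 < ‖v‖⁻¹ ^ 2 := by positivity
    refine le_of_mul_le_mul_left (a := ‖v‖⁻¹ ^ 2) ?_ h2
    linarith

variable {M : Type*} [TopologicalSpace M] [ChartedSpace (Model n) M] [IsManifold (𝓡 n) ∞ M]

theorem exists_eq_sum_coordVec {c : M} {y : Model n} (hy : y ∈ (extChartAt (𝓡 n) c).target)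
    (u : Model n) : ∃ v : Fin n → ℝ, u = ∑ i, v i • (coordVec c y i : Model n) := by
  have hinv := isInvertible_mfderivWithin_extChartAt_symm (I := 𝓡 n) hy
  rw [ModelWithCorners.range_eq_univ, mfderivWithin_univ] at hinv
  let L : Model n →L[ℝ] Model n :=
    mfderiv 𝓘(ℝ, Model n) (𝓡 n) (extChartAt (𝓡 n) c).symm y
  have hL : Function.Surjective L := hinv.surjective
  obtain ⟨w, rfl⟩ := hL u
  refine ⟨fun i ↦ w i, ?_⟩
  conv_lhs => rw [← sum_single w]
  simp only [map_sum, map_smul]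
  rfl

/-- On a compact manifold, a two-tensor field is bounded by a multiple of the metric. -/
theorem exists_forall_abs_le [CompactSpace M] (g : Metric n M) (φ : TwoTensor n M) :
    ∃ C, ∀ (x : M) (u : TangentSpace (𝓡 n) x), |φ x u u| ≤ C * g.inner x u u := by
  suffices h : ∃ C, ∀ x ∈ (Set.univ : Set M), ∀ u : TangentSpace (𝓡 n) x,
      |φ x u u| ≤ C * g.inner x u u by
    obtain ⟨C, hC⟩ := h
    exact ⟨C, fun x ↦ hC x (Set.mem_univ x)⟩
  refine isCompact_univ.induction_on ⟨0, fun _ h ↦ h.elim⟩ ?_ ?_ fun x _ ↦ ?_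
  · rintro s t hst ⟨C, hC⟩
    exact ⟨C, fun x hx ↦ hC x (hst hx)⟩
  · rintro s t ⟨C, hC⟩ ⟨D, hD⟩
    have hg : ∀ (x : M) (u : TangentSpace (𝓡 n) x), 0 ≤ g.inner x u u := fun x u ↦ by
      by_cases hu : u = 0
      · simp [hu]
      · exact (g.pos x u hu).le
    refine ⟨max C D, fun x hx u ↦ hx.elim (fun hx ↦ ?_) fun hx ↦ ?_⟩
    · exact (hC x hx u).trans (mul_le_mul_of_nonneg_right (le_max_left _ _) (hg x u))
    · exact (hD x hx u).trans (mul_le_mul_of_nonneg_right (le_max_right _ _) (hg x u))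
  · have hy := mem_extChartAt_target (I := 𝓡 n) x
    obtain ⟨C, hC⟩ := eventually_quadratic_le (G := gram g x) (B := bcomp φ x)
      (fun i j ↦ ((isMetricOn_gram g x).smooth _ hy i j).continuousAt)
      (fun i j ↦ (smoothMat_bcomp φ.contMDiff x _ hy i j).continuousAt) (posDef_gram g hy)
    have hev := (continuousAt_extChartAt (I := 𝓡 n) x).eventually hC
    refine ⟨_, mem_nhdsWithin_of_mem_nhds (Filter.inter_mem hev
      ((isOpen_extChartAt_source (I := 𝓡 n) x).mem_nhds (mem_extChartAt_source x))), C, ?_⟩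
    rintro z ⟨hz, hzs⟩
    have key : ∀ x', (extChartAt (𝓡 n) x).symm (extChartAt (𝓡 n) x z) = x' →
        ∀ u : TangentSpace (𝓡 n) x', |φ x' u u| ≤ C * g.inner x' u u := by
      rintro _ rfl u
      obtain ⟨v, rfl⟩ := exists_eq_sum_coordVec ((extChartAt (𝓡 n) x).map_source hzs) u
      have h1 := hz v
      change |v ⬝ᵥ bcomp φ x _ *ᵥ v| ≤ C * (v ⬝ᵥ bcomp g.inner x _ *ᵥ v) at h1
      rw [bcomp_quadratic, bcomp_quadratic] at h1
      exact h1
    exact key z ((extChartAt (𝓡 n) x).left_inv hzs)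

/-- A metric as a two-tensor field. -/
def Metric.toTensor (g : Metric n M) : TwoTensor n M := ⟨g.inner, g.contMDiff⟩

theorem isHarmonicTensor_toTensor (g : Metric n M) : IsHarmonicTensor g g.toTensor :=
  isHarmonicTensor_iff.mpr ⟨g.symm, fun c _ hy j ↦
    defect_self (isOpen_extChartAt_target c) (isMetricOn_gram g c) hy j⟩

/-- The tensor `g + tφ` is a metric if it is bounded below by `½ g`. -/
theorem exists_metric {g : Metric n M} {φ : TwoTensor n M}
    (hφ : ∀ x (v w : TangentSpace (𝓡 n) x), φ x v w = φ x w v) {t C : ℝ}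
    (hC : ∀ (x : M) (u : TangentSpace (𝓡 n) x), |φ x u u| ≤ C * g.inner x u u)
    (ht : |t| * C ≤ 1 / 2) :
    ∃ h : Metric n M, ∀ x, h.inner x = g.inner x + t • φ x := by
  have hhalf : ∀ (x : M) (v : TangentSpace (𝓡 n) x), v ≠ 0 →
      1 / 2 * g.inner x v v ≤ g.inner x v v + t * φ x v v := by
    intro x v hv
    have h1 := g.pos x v hv
    have h2 : |t * φ x v v| ≤ 1 / 2 * g.inner x v v := by
      rw [abs_mul]
      calc |t| * |φ x v v| ≤ |t| * (C * g.inner x v v) :=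
            mul_le_mul_of_nonneg_left (hC x v) (abs_nonneg t)
        _ = |t| * C * g.inner x v v := by ring
        _ ≤ 1 / 2 * g.inner x v v := mul_le_mul_of_nonneg_right ht h1.le
    have h3 := neg_abs_le (t * φ x v v)
    linarith
  have happ : ∀ (x : M) (v w : TangentSpace (𝓡 n) x),
      (g.inner x + t • φ x) v w = g.inner x v w + t * φ x v w := fun _ _ _ ↦ rfl
  refine ⟨⟨fun x ↦ g.inner x + t • φ x, fun x v w ↦ ?_, fun x v hv ↦ ?_, fun x ↦ ?_, ?_⟩,
    fun _ ↦ rfl⟩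
  · rw [happ, happ, g.symm, hφ]
  · rw [happ]
    have := g.pos x v hv
    linarith [hhalf x v hv]
  · have h2 := (g.isVonNBounded x).image (√2 • ContinuousLinearMap.id ℝ (TangentSpace (𝓡 n) x))
    refine h2.subset fun v hv ↦ (Set.mem_image _ _ _).mpr ⟨(√2)⁻¹ • v, ?_, ?_⟩
    · by_cases hv0 : v = 0
      · simp [hv0]
      · have h3 := hhalf x v hv0
        rw [Set.mem_ofPred_eq, happ] at hv
        have h4 : (√2 : ℝ)⁻¹ * ((√2)⁻¹ * g.inner x v v) = 1 / 2 * g.inner x v v := by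
          rw [← mul_assoc, ← mul_inv, Real.mul_self_sqrt (by norm_num)]
          ring
        simp only [Set.mem_ofPred_eq, map_smul, _root_.smul_apply, smul_eq_mul]
        rw [h4]
        linarith
    · simp [smul_smul]
  · exact (g.toTensor + t • φ).contMDiff

theorem isHarmonicTensor_metric {g h : Metric n M} {φ : TwoTensor n M} {t : ℝ}
    (hφ : IsHarmonicTensor g φ) (hh : ∀ x, h.inner x = g.inner x + t • φ x) (c : M) :
    ∀ y ∈ (extChartAt (𝓡 n) c).target, ∀ j, defect (gram g c) (gram h c) j y = 0 := by
  have h1 := (isHarmonicTensor_iff.mp (isHarmonicTensor_smul_add t hφ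
    (isHarmonicTensor_toTensor g))).2 c
  have h2 : comp (TwoTensor.form (t • φ + g.toTensor)) c = gram h c := by
    funext y
    ext i j
    rw [gram, comp, comp, Matrix.of_apply, Matrix.of_apply, Metric.form, hh]
    exact add_comm _ _
  rw [h2] at h1
  exact h1

end MetricFamily

/-! ### The coordinate energy density of a variation -/

section LocalVariation

variable {n : ℕ}

/-- The Jacobian matrix in the space variables of a map that depends on a parameter. -/
def spaceJac (Φ : ℝ × Model n → Model n) (p : ℝ × Model n) : Matrix (Fin n) (Fin n) ℝ :=
  Matrix.of fun k i ↦ fderiv ℝ (fun q ↦ Φ q k) p (0, EuclideanSpace.single i 1)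

/-- The components of the velocity of a family of maps. -/
def velocity (Φ : ℝ × Model n → Model n) (k : Fin n) (p : ℝ × Model n) : ℝ :=
  fderiv ℝ (fun q ↦ Φ q k) p (1, 0)

theorem contDiffAt_component {Φ : ℝ × Model n → Model n} {p : ℝ × Model n}
    (hΦ : ContDiffAt ℝ ∞ Φ p) (k : Fin n) : ContDiffAt ℝ ∞ (fun q ↦ Φ q k) p :=
  (EuclideanSpace.proj k : Model n →L[ℝ] ℝ).contDiff.contDiffAt.comp p hΦ

theorem contDiffAt_spaceJac {Φ : ℝ × Model n → Model n} {p : ℝ × Model n}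
    (hΦ : ContDiffAt ℝ ∞ Φ p) (k i : Fin n) : ContDiffAt ℝ ∞ (fun q ↦ spaceJac Φ q k i) p :=
  ((contDiffAt_component hΦ k).fderiv_right (m := ∞) (by simp)).clm_apply contDiffAt_const

theorem contDiffAt_velocity {Φ : ℝ × Model n → Model n} {p : ℝ × Model n}
    (hΦ : ContDiffAt ℝ ∞ Φ p) (k : Fin n) : ContDiffAt ℝ ∞ (velocity Φ k) p :=
  ((contDiffAt_component hΦ k).fderiv_right (m := ∞) (by simp)).clm_apply contDiffAt_const

theorem hasDerivAt_slice {f : ℝ × Model n → ℝ} {s : ℝ} {z : Model n}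
    (hf : DifferentiableAt ℝ f (s, z)) :
    HasDerivAt (fun r ↦ f (r, z)) (fderiv ℝ f (s, z) (1, 0)) s := by
  have h1 : HasDerivAt (fun r : ℝ ↦ (r, z)) (1, 0) s :=
    (hasDerivAt_id s).prodMk (hasDerivAt_const s z)
  exact hf.hasFDerivAt.comp_hasDerivAt s h1

theorem hasFDerivAt_slice {f : ℝ × Model n → ℝ} {s : ℝ} {z : Model n}
    (hf : DifferentiableAt ℝ f (s, z)) : HasFDerivAt (fun w ↦ f (s, w))
      ((fderiv ℝ f (s, z)).comp (ContinuousLinearMap.inr ℝ ℝ (Model n))) z := by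
  have h1 : HasFDerivAt (fun w : Model n ↦ (s, w)) (ContinuousLinearMap.inr ℝ ℝ (Model n)) z :=
    hasFDerivAt_prodMk_right s z
  exact hf.hasFDerivAt.comp z h1

theorem pd_slice {f : ℝ × Model n → ℝ} {s : ℝ} {z : Model n} (hf : DifferentiableAt ℝ f (s, z))
    (i : Fin n) : pd i (fun w ↦ f (s, w)) z
      = fderiv ℝ f (s, z) (0, EuclideanSpace.single i 1) := by
  rw [pd, (hasFDerivAt_slice hf).fderiv]
  simp

theorem jacM_slice {Φ : ℝ × Model n → Model n} {s : ℝ} {z : Model n}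
    (hΦ : ContDiffAt ℝ ∞ Φ (s, z)) : jacM (fun w ↦ Φ (s, w)) z = spaceJac Φ (s, z) := by
  ext k i
  exact pd_slice ((contDiffAt_component hΦ k).differentiableAt (by simp)) i

/-- The derivative of the Jacobian matrix of a family of maps is the Jacobian matrix of its
velocity. -/
theorem hasDerivAt_spaceJac {Φ : ℝ × Model n → Model n} {z : Model n}
    (hΦ : ContDiffAt ℝ ∞ Φ (0, z)) (k i : Fin n) :
    HasDerivAt (fun s ↦ spaceJac Φ (s, z) k i) (jac (fun k w ↦ velocity Φ k (0, w)) z k i) 0 := by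
  have hc := contDiffAt_component hΦ k
  have hd : DifferentiableAt ℝ (fderiv ℝ fun q ↦ Φ q k) (0, z) :=
    (hc.fderiv_right (m := ∞) (by simp)).differentiableAt (by simp)
  have h := hasDerivAt_slice ((contDiffAt_spaceJac hΦ k i).differentiableAt (by simp))
  convert h using 1
  have h1 : jac (fun k w ↦ velocity Φ k (0, w)) z k i
      = fderiv ℝ (velocity Φ k) (0, z) (0, EuclideanSpace.single i 1) :=
    pd_slice ((contDiffAt_velocity hΦ k).differentiableAt (by simp)) i
  have h2 : ∀ u v : ℝ × Model n, fderiv ℝ (fun q ↦ fderiv ℝ (fun q ↦ Φ q k) q v) (0, z) u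
      = fderiv ℝ (fderiv ℝ fun q ↦ Φ q k) (0, z) u v := by
    intro u v
    rw [fderiv_clm_apply hd (differentiableAt_const v)]
    simp
  rw [h1]
  refine (h2 _ _).trans (Eq.trans ?_ (h2 _ _).symm)
  have h3 : ((2 : ℕ∞) : WithTop ℕ∞) ≤ ∞ := WithTop.coe_le_coe.mpr le_top
  exact (hc.isSymmSndFDerivAt (by simpa using h3)).eq _ _

theorem hasDerivAt_matrix_mul {A B : ℝ → Matrix (Fin n) (Fin n) ℝ}
    {A' B' : Matrix (Fin n) (Fin n) ℝ} {s : ℝ} (hA : ∀ i j, HasDerivAt (fun r ↦ A r i j) (A' i j) s)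
    (hB : ∀ i j, HasDerivAt (fun r ↦ B r i j) (B' i j) s) (i j : Fin n) :
    HasDerivAt (fun r ↦ (A r * B r) i j) ((A' * B s + A s * B') i j) s := by
  simp only [Matrix.mul_apply, Matrix.add_apply, ← Finset.sum_add_distrib]
  exact HasDerivAt.fun_sum fun k _ ↦ (hA i k).mul (hB k j)

/-- The derivative of the pullbacks of `H` under a family of maps that starts at the identity is
the Lie derivative of `H` along the velocity. -/
theorem hasDerivAt_pullback {Φ : ℝ × Model n → Model n} {z : Model n}
    {H : Model n → Matrix (Fin n) (Fin n) ℝ} (hΦ : ContDiffAt ℝ ∞ Φ (0, z))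
    (h0 : ∀ᶠ w in nhds z, Φ (0, w) = w) (hH : EntryDiff H z) (i j : Fin n) :
    HasDerivAt (fun s ↦ ((spaceJac Φ (s, z))ᵀ * H (Φ (s, z)) * spaceJac Φ (s, z)) i j)
      (lie H (fun k w ↦ velocity Φ k (0, w)) z i j) 0 := by
  have hz : Φ (0, z) = z := h0.self_of_nhds
  have hJ0 : spaceJac Φ (0, z) = 1 := by
    rw [← jacM_slice hΦ, ← jacM_id z]
    exact jacM_congr h0
  have hJ := hasDerivAt_spaceJac hΦ
  have hHd : ∀ a b, HasDerivAt (fun s ↦ H (Φ (s, z)) a b)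
      ((∑ k, velocity Φ k (0, z) • pdM k H z) a b) 0 := by
    intro a b
    have h1 : HasDerivAt (fun s ↦ Φ (s, z)) (fderiv ℝ Φ (0, z) (1, 0)) 0 :=
      (hΦ.differentiableAt (by simp)).hasFDerivAt.comp_hasDerivAt (0 : ℝ)
        ((hasDerivAt_id (0 : ℝ)).prodMk (hasDerivAt_const (0 : ℝ) z))
    have h2 : HasFDerivAt (fun w ↦ H w a b) (fderiv ℝ (fun w ↦ H w a b) z) (Φ (0, z)) := by
      rw [hz]
      exact (hH a b).hasFDerivAt
    have h3 := h2.comp_hasDerivAt (0 : ℝ) h1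
    change HasDerivAt (fun s ↦ H (Φ (s, z)) a b) _ 0 at h3
    refine h3.congr_deriv ?_
    rw [fderiv_apply_eq_sum_pd, Matrix.sum_apply]
    refine Finset.sum_congr rfl fun k _ ↦ ?_
    have h4 : velocity Φ k (0, z) = fderiv ℝ Φ (0, z) (1, 0) k := by
      have : HasFDerivAt (fun q ↦ Φ q k)
          ((EuclideanSpace.proj k : Model n →L[ℝ] ℝ).comp (fderiv ℝ Φ (0, z))) (0, z) :=
        (EuclideanSpace.proj k : Model n →L[ℝ] ℝ).hasFDerivAt.comp (0, z)
          (hΦ.differentiableAt (by simp)).hasFDerivAt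
      rw [velocity, this.fderiv]
      rfl
    rw [Matrix.smul_apply, smul_eq_mul, h4, mul_comm]
    rfl
  have h := hasDerivAt_matrix_mul (hasDerivAt_matrix_mul (A := fun s ↦ (spaceJac Φ (s, z))ᵀ)
    (A' := (jac (fun k w ↦ velocity Φ k (0, w)) z)ᵀ) (fun a b ↦ hJ b a) hHd) hJ i j
  convert h using 1
  simp only [hJ0, hz, lie, Matrix.transpose_one, Matrix.mul_one, Matrix.one_mul]
  rw [add_comm (∑ k, velocity Φ k (0, z) • pdM k H z)]

end LocalVariation

/-! ### Variations of the identity in charts -/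

section Variation

variable {n : ℕ} {M : Type*} [TopologicalSpace M] [ChartedSpace (Model n) M]

/-- A family of maps of `M`, in the chart around `c`. -/
def inChart (F : ℝ → M → M) (c : M) (p : ℝ × Model n) : Model n :=
  extChartAt (𝓡 n) c (F p.1 ((extChartAt (𝓡 n) c).symm p.2))

/-- The points at which the expression of a family of maps in the chart around `c` is meaningful. -/
def chartDomain (F : ℝ → M → M) (c : M) : Set (ℝ × Model n) :=
  {p | p.2 ∈ (extChartAt (𝓡 n) c).target ∧
    F p.1 ((extChartAt (𝓡 n) c).symm p.2) ∈ (extChartAt (𝓡 n) c).source}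

theorem mem_chartDomain_of_mem_source {F : ℝ → M → M} {c x : M} {s : ℝ}
    (hx : x ∈ (extChartAt (𝓡 n) c).source) (hF : F s x ∈ (extChartAt (𝓡 n) c).source) :
    (s, extChartAt (𝓡 n) c x) ∈ chartDomain F c :=
  ⟨(extChartAt (𝓡 n) c).map_source hx, by rwa [(extChartAt (𝓡 n) c).left_inv hx]⟩

/-- The pullback of a bilinear form under a linear map. -/
def pullbackForm (A : Model n →L[ℝ] Model n →L[ℝ] ℝ) (D : Model n →L[ℝ] Model n) :
    Model n →L[ℝ] Model n →L[ℝ] ℝ := A.bilinearComp D D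

/-- The pullback `f^* h` as a field of bilinear forms. -/
def pullbackField [IsManifold (𝓡 n) ∞ M] (h : Metric n M) (f : M → M) : BilinField n M := fun x ↦
  pullbackForm (h.inner (f x)) (mfderiv (𝓡 n) (𝓡 n) f x)

theorem contMDiff_slice {F : ℝ → M → M}
    (hF : ContMDiff (𝓘(ℝ, ℝ).prod (𝓡 n)) (𝓡 n) ∞ (fun p : ℝ × M ↦ F p.1 p.2))
    (s : ℝ) : ContMDiff (𝓡 n) (𝓡 n) ∞ (F s) :=
  hF.comp (contMDiff_const.prodMk contMDiff_id)

variable [IsManifold (𝓡 n) ∞ M]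

theorem pullback_eq (h : Metric n M) (f : M → M) :
    (pullback h f : Form2 n M) = fun x v w ↦ pullbackField h f x v w := rfl

theorem pullbackField_symm (h : Metric n M) (f : M → M) (x : M) (v w : TangentSpace (𝓡 n) x) :
    pullbackField h f x v w = pullbackField h f x w v := h.symm _ _ _

/-- The energy density in an arbitrary chart. -/
theorem energyDensity_eq (g h : Metric n M) (f : M → M) {c x : M}
    (hx : x ∈ (extChartAt (𝓡 n) c).source) : energyDensity g h f x
      = ((gram g c (extChartAt (𝓡 n) c x))⁻¹
        * bcomp (pullbackField h f) c (extChartAt (𝓡 n) c x)).trace := by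
  have hs : extChartAt (𝓡 n) x x ∈ (transition x c).source :=
    mem_transition_source.mpr ⟨mem_extChartAt_target x, by rwa [extChartAt_to_inv]⟩
  rw [energyDensity, pullback_eq, coordTrace_transition g (pullbackField_symm h f) hs,
    transition_apply, extChartAt_to_inv]
  exact trace_eq_sum_inv_mul (bcomp_isSymm (pullbackField_symm h f) c _)

variable {F : ℝ → M → M}

theorem contMDiffAt_comp_symm
    (hF : ContMDiff (𝓘(ℝ, ℝ).prod (𝓡 n)) (𝓡 n) ∞ (fun p : ℝ × M ↦ F p.1 p.2))
    {c : M} {p : ℝ × Model n}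
    (hp : p.2 ∈ (extChartAt (𝓡 n) c).target) :
    ContMDiffAt 𝓘(ℝ, ℝ × Model n) (𝓡 n) ∞
      (fun q : ℝ × Model n ↦ F q.1 ((extChartAt (𝓡 n) c).symm q.2)) p := by
  have hs : ContMDiffAt 𝓘(ℝ, Model n) (𝓡 n) ∞ (extChartAt (𝓡 n) c).symm p.2 :=
    (contMDiffOn_extChartAt_symm c).contMDiffAt ((isOpen_extChartAt_target c).mem_nhds hp)
  have h1 : ContMDiffAt 𝓘(ℝ, ℝ × Model n) 𝓘(ℝ, Model n) ∞ (fun q : ℝ × Model n ↦ q.2) p :=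
    contDiff_snd.contMDiff.contMDiffAt
  have h2 : ContMDiffAt 𝓘(ℝ, ℝ × Model n) 𝓘(ℝ, ℝ) ∞ (fun q : ℝ × Model n ↦ q.1) p :=
    contDiff_fst.contMDiff.contMDiffAt
  exact (hF.contMDiffAt (x := (p.1, (extChartAt (𝓡 n) c).symm p.2))).comp p
    (h2.prodMk (hs.comp p h1))

theorem isOpen_chartDomain
    (hF : ContMDiff (𝓘(ℝ, ℝ).prod (𝓡 n)) (𝓡 n) ∞ (fun p : ℝ × M ↦ F p.1 p.2))
    (c : M) : IsOpen (chartDomain (n := n) F c) := by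
  refine isOpen_iff_mem_nhds.mpr fun p hp ↦ ?_
  have h1 := (contMDiffAt_comp_symm (c := c) (p := p) hF hp.1).continuousAt
  have h2 : ContinuousAt (fun q : ℝ × Model n ↦ q.2) p := continuous_snd.continuousAt
  exact Filter.inter_mem
    (h2 ((isOpen_extChartAt_target (I := 𝓡 n) c).mem_nhds hp.1))
    (h1 ((isOpen_extChartAt_source (I := 𝓡 n) c).mem_nhds hp.2))

theorem contDiffAt_inChart
    (hF : ContMDiff (𝓘(ℝ, ℝ).prod (𝓡 n)) (𝓡 n) ∞ (fun p : ℝ × M ↦ F p.1 p.2))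
    {c : M} {p : ℝ × Model n} (hp : p ∈ chartDomain F c) :
    ContDiffAt ℝ ∞ (inChart F c) p := by
  have h1 : ContMDiffAt (𝓡 n) 𝓘(ℝ, Model n) ∞ (extChartAt (𝓡 n) c)
      (F p.1 ((extChartAt (𝓡 n) c).symm p.2)) :=
    contMDiffAt_extChartAt' (by rw [← extChartAt_source (I := 𝓡 n)]; exact hp.2)
  exact (ContMDiffAt.comp p h1 (contMDiffAt_comp_symm hF hp.1)).contDiffAt

theorem mfderiv_coordVec
    (hF : ContMDiff (𝓘(ℝ, ℝ).prod (𝓡 n)) (𝓡 n) ∞ (fun p : ℝ × M ↦ F p.1 p.2))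
    {c : M} {s : ℝ} {z : Model n} (hp : (s, z) ∈ chartDomain F c)
    (i : Fin n) : (mfderiv (𝓡 n) (𝓡 n) (F s) ((extChartAt (𝓡 n) c).symm z) (coordVec c z i) :
      Model n) = ∑ k, spaceJac (inChart F c) (s, z) k i
        • (coordVec c (inChart F c (s, z)) k : Model n) := by
  have hΦ := contDiffAt_inChart hF hp
  set ρ : Model n → Model n := fun w ↦ inChart F c (s, w) with hρ
  have hd : DifferentiableAt ℝ ρ z :=
    (hΦ.differentiableAt (by simp)).comp z
      ((differentiableAt_const s).prodMk differentiableAt_id)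
  have ht : ρ z ∈ (extChartAt (𝓡 n) c).target := (extChartAt (𝓡 n) c).map_source hp.2
  have hcont : ContinuousAt (fun w : Model n ↦ (s, w)) z := by fun_prop
  have h1 : F s ∘ (extChartAt (𝓡 n) c).symm =ᶠ[nhds z] (extChartAt (𝓡 n) c).symm ∘ ρ := by
    filter_upwards [hcont ((isOpen_chartDomain hF c).mem_nhds hp)] with w hw
    exact ((extChartAt (𝓡 n) c).left_inv hw.2).symm
  have h2 := h1.mfderiv_eq (I := 𝓘(ℝ, Model n)) (I' := 𝓡 n)
  have h3 := mfderiv_comp z (mdifferentiableAt_symm ht) hd.mdifferentiableAt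
  have h4 := mfderiv_comp z ((contMDiff_slice hF s).mdifferentiableAt (by simp)
    (x := (extChartAt (𝓡 n) c).symm z)) (mdifferentiableAt_symm hp.1)
  have h5 : (mfderiv (𝓡 n) (𝓡 n) (F s) ((extChartAt (𝓡 n) c).symm z) (coordVec c z i) : Model n)
      = mfderiv 𝓘(ℝ, Model n) (𝓡 n) (extChartAt (𝓡 n) c).symm (ρ z)
        (fderiv ℝ ρ z (EuclideanSpace.single i (1 : ℝ))) := by
    rw [← mfderiv_eq_fderiv]
    exact congrArg (fun L : Model n →L[ℝ] Model n ↦ L (EuclideanSpace.single i (1 : ℝ)))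
      (h4.symm.trans (h2.trans h3))
  rw [h5, ← sum_single (fderiv ℝ ρ z (EuclideanSpace.single i (1 : ℝ)))]
  simp only [← jacM_apply hd]
  rw [hρ, jacM_slice hΦ]
  let L : Model n →L[ℝ] Model n :=
    mfderiv 𝓘(ℝ, Model n) (𝓡 n) (extChartAt (𝓡 n) c).symm (ρ z)
  change L _ = ∑ k, spaceJac (inChart F c) (s, z) k i • L _
  simp only [map_sum, map_smul]

/-- The components of the pullback `F_s^* h`. -/
theorem bcomp_pullbackField (h : Metric n M)
    (hF : ContMDiff (𝓘(ℝ, ℝ).prod (𝓡 n)) (𝓡 n) ∞ (fun p : ℝ × M ↦ F p.1 p.2))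
    {c : M} {s : ℝ} {z : Model n}
    (hp : (s, z) ∈ chartDomain F c) :
    bcomp (pullbackField h (F s)) c z = (spaceJac (inChart F c) (s, z))ᵀ
      * gram h c (inChart F c (s, z)) * spaceJac (inChart F c) (s, z) := by
  have key : ∀ x x' : M, x = x' → ∀ (J : Matrix (Fin n) (Fin n) ℝ) (v w : Fin n → Model n),
      (∀ i, v i = ∑ k, J k i • w k) → (Matrix.of fun i j ↦ h.inner x (v i) (v j))
      = Jᵀ * (Matrix.of fun i j ↦ h.inner x' (w i) (w j)) * J := by
    rintro x _ rfl J v w hvw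
    exact bilin_change_of_basis (h.inner x) hvw
  exact key _ _ ((extChartAt (𝓡 n) c).left_inv hp.2).symm _ _ _ (mfderiv_coordVec hF hp)

end Variation

/-! ### Differentiation of the energy under the integral -/

section EnergyOfFamily

variable {n : ℕ} {M : Type*} [TopologicalSpace M] [ChartedSpace (Model n) M]

/-- The pairs `(s, x)` for which some chart contains both `x` and `F s x`. -/
def commonChartPairs (F : ℝ → M → M) : Set (ℝ × M) :=
  {p | ∃ c, p.2 ∈ (extChartAt (𝓡 n) c).source ∧ F p.1 p.2 ∈ (extChartAt (𝓡 n) c).source}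

variable {F : ℝ → M → M}

theorem eventually_mem_source
    (hF : ContMDiff (𝓘(ℝ, ℝ).prod (𝓡 n)) (𝓡 n) ∞ (fun p : ℝ × M ↦ F p.1 p.2)) {c : M}
    {p : ℝ × M} (hx : p.2 ∈ (extChartAt (𝓡 n) c).source)
    (hs : F p.1 p.2 ∈ (extChartAt (𝓡 n) c).source) : ∀ᶠ q in nhds p,
      q.2 ∈ (extChartAt (𝓡 n) c).source ∧ F q.1 q.2 ∈ (extChartAt (𝓡 n) c).source := by
  have ho := isOpen_extChartAt_source (I := 𝓡 n) c
  have h1 : ContinuousAt (fun q : ℝ × M ↦ q.2) p := continuous_snd.continuousAt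
  exact (h1.eventually (ho.mem_nhds hx)).and
    (hF.continuous.continuousAt.eventually (ho.mem_nhds hs))

theorem isOpen_commonChartPairs
    (hF : ContMDiff (𝓘(ℝ, ℝ).prod (𝓡 n)) (𝓡 n) ∞ (fun p : ℝ × M ↦ F p.1 p.2)) :
    IsOpen (commonChartPairs (n := n) F) := by
  refine isOpen_iff_mem_nhds.mpr fun p ⟨c, hx, hs⟩ ↦ ?_
  filter_upwards [eventually_mem_source hF hx hs] with q hq
  exact ⟨c, hq⟩

theorem continuousAt_prod_chart {c : M} {p : ℝ × M} (hx : p.2 ∈ (extChartAt (𝓡 n) c).source) :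
    ContinuousAt (fun q : ℝ × M ↦ (q.1, extChartAt (𝓡 n) c q.2)) p :=
  continuous_fst.continuousAt.prodMk (ContinuousAt.comp (f := fun q : ℝ × M ↦ q.2)
    (continuousAt_extChartAt' hx)
    continuous_snd.continuousAt)

/-- A variation of the identity stays in common charts for small values of the parameter. -/
theorem exists_forall_mem_commonChartPairs [CompactSpace M]
    (hF : ContMDiff (𝓘(ℝ, ℝ).prod (𝓡 n)) (𝓡 n) ∞ (fun p : ℝ × M ↦ F p.1 p.2)) (h0 : F 0 = id) :
    ∃ r > 0, ∀ s ∈ Set.Icc (-r) r, ∀ x, (s, x) ∈ commonChartPairs (n := n) F := by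
  have hsub : ({0} : Set ℝ) ×ˢ (Set.univ : Set M) ⊆ commonChartPairs (n := n) F := by
    rintro ⟨s, x⟩ ⟨hs, -⟩
    obtain rfl : s = 0 := hs
    refine ⟨x, mem_extChartAt_source (I := 𝓡 n) x, ?_⟩
    simp only [h0, id]
    exact mem_extChartAt_source (I := 𝓡 n) x
  obtain ⟨u, v, hu, -, h0u, hv, huv⟩ := generalized_tube_lemma isCompact_singleton isCompact_univ
    (isOpen_commonChartPairs hF) hsub
  obtain ⟨r, hr, hru⟩ := Metric.isOpen_iff.mp hu 0 (h0u rfl)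
  refine ⟨r / 2, by positivity, fun s hs x ↦ huv ⟨hru ?_, hv (Set.mem_univ x)⟩⟩
  rw [Metric.mem_ball, Real.dist_eq, sub_zero]
  exact (abs_le.mpr hs).trans_lt (by linarith)

variable [IsManifold (𝓡 n) ∞ M]

/-- The energy density of a family of maps, in the chart around `c`. -/
def localEnergy (g h : Metric n M) (F : ℝ → M → M) (c : M) (p : ℝ × Model n) : ℝ :=
  ((gram g c p.2)⁻¹ * ((spaceJac (inChart F c) p)ᵀ * gram h c (inChart F c p)
    * spaceJac (inChart F c) p)).trace

theorem contDiffAt_localEnergy (g h : Metric n M)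
    (hF : ContMDiff (𝓘(ℝ, ℝ).prod (𝓡 n)) (𝓡 n) ∞ (fun p : ℝ × M ↦ F p.1 p.2)) {c : M}
    {p : ℝ × Model n} (hp : p ∈ chartDomain F c) : ContDiffAt ℝ ∞ (localEnergy g h F c) p := by
  have hΦ := contDiffAt_inChart hF hp
  have hG : ∀ i j, ContDiffAt ℝ ∞ (fun q : ℝ × Model n ↦ (gram g c q.2)⁻¹ i j) p := fun i j ↦
    ContDiffAt.comp p (f := fun q : ℝ × Model n ↦ q.2) (g := fun z ↦ (gram g c z)⁻¹ i j)
      ((isMetricOn_gram g c).inv p.2 hp.1 i j) contDiff_snd.contDiffAt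
  have hH : ∀ i j, ContDiffAt ℝ ∞ (fun q ↦ gram h c (inChart F c q) i j) p := fun i j ↦
    ContDiffAt.comp p (f := inChart F c) (g := fun z ↦ gram h c z i j)
      ((isMetricOn_gram h c).smooth _ ((extChartAt (𝓡 n) c).map_source hp.2) i j) hΦ
  unfold localEnergy
  simp only [Matrix.trace, Matrix.diag_apply, Matrix.mul_apply,
    Matrix.transpose_apply]
  exact ContDiffAt.sum fun i _ ↦ ContDiffAt.sum fun j _ ↦ (hG i j).mul <| ContDiffAt.sum fun k _ ↦
    (ContDiffAt.sum fun l _ ↦ (contDiffAt_spaceJac hΦ l j).mul (hH l k)).mul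
      (contDiffAt_spaceJac hΦ k i)

theorem energyDensity_family (g h : Metric n M)
    (hF : ContMDiff (𝓘(ℝ, ℝ).prod (𝓡 n)) (𝓡 n) ∞ (fun p : ℝ × M ↦ F p.1 p.2)) {c x : M} {s : ℝ}
    (hx : x ∈ (extChartAt (𝓡 n) c).source) (hs : F s x ∈ (extChartAt (𝓡 n) c).source) :
    energyDensity g h (F s) x = localEnergy g h F c (s, extChartAt (𝓡 n) c x) := by
  rw [energyDensity_eq g h (F s) hx,
    bcomp_pullbackField h hF (mem_chartDomain_of_mem_source hx hs)]
  rfl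

theorem continuousAt_energyDensity (g h : Metric n M)
    (hF : ContMDiff (𝓘(ℝ, ℝ).prod (𝓡 n)) (𝓡 n) ∞ (fun p : ℝ × M ↦ F p.1 p.2)) {p : ℝ × M}
    (hp : p ∈ commonChartPairs (n := n) F) :
    ContinuousAt (fun q : ℝ × M ↦ energyDensity g h (F q.1) q.2) p := by
  obtain ⟨c, hx, hs⟩ := hp
  have h1 := ContinuousAt.comp (g := localEnergy g h F c) (x := p)
    (f := fun q : ℝ × M ↦ (q.1, extChartAt (𝓡 n) c q.2))
    (contDiffAt_localEnergy g h hF (mem_chartDomain_of_mem_source hx hs)).continuousAt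
    (continuousAt_prod_chart hx)
  refine h1.congr ?_
  filter_upwards [eventually_mem_source hF hx hs] with q hq
  exact (energyDensity_family g h hF hq.1 hq.2).symm

theorem hasDerivAt_energyDensity_chart (g h : Metric n M)
    (hF : ContMDiff (𝓘(ℝ, ℝ).prod (𝓡 n)) (𝓡 n) ∞ (fun p : ℝ × M ↦ F p.1 p.2)) {c x : M} {s : ℝ}
    (hx : x ∈ (extChartAt (𝓡 n) c).source) (hs : F s x ∈ (extChartAt (𝓡 n) c).source) :
    HasDerivAt (fun r ↦ energyDensity g h (F r) x)
      (fderiv ℝ (localEnergy g h F c) (s, extChartAt (𝓡 n) c x) (1, 0)) s := by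
  have h1 := hasDerivAt_slice ((contDiffAt_localEnergy g h hF
    (mem_chartDomain_of_mem_source hx hs)).differentiableAt (by simp))
  refine h1.congr_of_eventuallyEq ?_
  have h2 : ContinuousAt (fun r : ℝ ↦ (r, x)) s := by fun_prop
  filter_upwards [h2.eventually (eventually_mem_source (p := (s, x)) hF hx hs)] with r hr
  exact energyDensity_family g h hF hr.1 hr.2

theorem hasDerivAt_energyDensity (g h : Metric n M)
    (hF : ContMDiff (𝓘(ℝ, ℝ).prod (𝓡 n)) (𝓡 n) ∞ (fun p : ℝ × M ↦ F p.1 p.2)) {s : ℝ} {x : M}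
    (hp : (s, x) ∈ commonChartPairs (n := n) F) : HasDerivAt (fun r ↦ energyDensity g h (F r) x)
      (deriv (fun r ↦ energyDensity g h (F r) x) s) s := by
  obtain ⟨c, hx, hs⟩ := hp
  exact (hasDerivAt_energyDensity_chart g h hF hx hs).differentiableAt.hasDerivAt

theorem continuousAt_deriv_energyDensity (g h : Metric n M)
    (hF : ContMDiff (𝓘(ℝ, ℝ).prod (𝓡 n)) (𝓡 n) ∞ (fun p : ℝ × M ↦ F p.1 p.2)) {p : ℝ × M}
    (hp : p ∈ commonChartPairs (n := n) F) :
    ContinuousAt (fun q : ℝ × M ↦ deriv (fun r ↦ energyDensity g h (F r) q.2) q.1) p := by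
  obtain ⟨c, hx, hs⟩ := hp
  have h0 : ContDiffAt ℝ ∞ (fun q ↦ fderiv ℝ (localEnergy g h F c) q (1, 0))
      (p.1, extChartAt (𝓡 n) c p.2) := ((contDiffAt_localEnergy g h hF
    (mem_chartDomain_of_mem_source hx hs)).fderiv_right (m := ∞) (by simp)).clm_apply
      contDiffAt_const
  have h1 := ContinuousAt.comp (g := fun q ↦ fderiv ℝ (localEnergy g h F c) q (1, 0)) (x := p)
    (f := fun q : ℝ × M ↦ (q.1, extChartAt (𝓡 n) c q.2))
    h0.continuousAt (continuousAt_prod_chart hx)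
  refine h1.congr ?_
  filter_upwards [eventually_mem_source hF hx hs] with q hq
  exact (hasDerivAt_energyDensity_chart g h hF hq.1 hq.2).deriv.symm

/-- Differentiation of the energy under the integral sign. -/
theorem hasDerivAt_integral_energyDensity [CompactSpace M] [T2Space M] [MeasurableSpace M]
    [BorelSpace M] (g h : Metric n M)
    (hF : ContMDiff (𝓘(ℝ, ℝ).prod (𝓡 n)) (𝓡 n) ∞ (fun p : ℝ × M ↦ F p.1 p.2)) (h0 : F 0 = id)
    (U : Set M) : HasDerivAt (fun s ↦ ∫ x in U, energyDensity g h (F s) x ∂(riemannianVolume g))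
      (∫ x in U, deriv (fun r ↦ energyDensity g h (F r) x) 0 ∂(riemannianVolume g)) 0 := by
  have := isFiniteMeasure_riemannianVolume g
  obtain ⟨r, hr, hgood⟩ := exists_forall_mem_commonChartPairs hF h0
  have hnhds : Set.Icc (-r) r ∈ nhds (0 : ℝ) := Icc_mem_nhds (by linarith) hr
  have hr0 : (0 : ℝ) ∈ Set.Icc (-r) r := mem_of_mem_nhds hnhds
  have hslice : ∀ (s : ℝ) (x : M), ContinuousAt (fun x : M ↦ (s, x)) x := fun s x ↦ by fun_prop
  have hcont : ∀ s ∈ Set.Icc (-r) r, Continuous (energyDensity g h (F s)) := fun s hs ↦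
    continuous_iff_continuousAt.mpr fun x ↦ ContinuousAt.comp (f := fun x : M ↦ (s, x))
      (g := fun q : ℝ × M ↦ energyDensity g h (F q.1) q.2)
      (continuousAt_energyDensity g h hF (hgood s hs x)) (hslice s x)
  have hcont' : Continuous fun x ↦ deriv (fun r ↦ energyDensity g h (F r) x) 0 :=
    continuous_iff_continuousAt.mpr fun x ↦ ContinuousAt.comp (f := fun x : M ↦ ((0 : ℝ), x))
      (g := fun q : ℝ × M ↦ deriv (fun r ↦ energyDensity g h (F r) q.2) q.1)
      (continuousAt_deriv_energyDensity g h hF (hgood 0 hr0 x)) (hslice 0 x)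
  have hcomp : IsCompact (Set.Icc (-r) r ×ˢ (Set.univ : Set M)) := isCompact_Icc.prod isCompact_univ
  obtain ⟨C, hC⟩ := hcomp.exists_bound_of_continuousOn
    (f := fun q : ℝ × M ↦ deriv (fun r ↦ energyDensity g h (F r) q.2) q.1)
    fun q hq ↦ (continuousAt_deriv_energyDensity g h hF (hgood q.1 hq.1 q.2)).continuousWithinAt
  refine (hasDerivAt_integral_of_dominated_loc_of_deriv_le (bound := fun _ ↦ C)
    (F' := fun s x ↦ deriv (fun r ↦ energyDensity g h (F r) x) s) hnhds ?_ ?_ ?_ ?_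
    (integrable_const C) ?_).2
  · filter_upwards [hnhds] with s hs
    exact (hcont s hs).aestronglyMeasurable
  · exact ((hcont 0 hr0).continuousOn.integrableOn_compact isCompact_univ).mono_set
      (Set.subset_univ U)
  · exact hcont'.aestronglyMeasurable
  · exact Filter.Eventually.of_forall fun x s hs ↦ hC (s, x) ⟨hs, Set.mem_univ x⟩
  · exact Filter.Eventually.of_forall fun x s hs ↦ hasDerivAt_energyDensity g h hF (hgood s hs x)

end EnergyOfFamily

/-! ### The first variation formula at the identity -/

section FirstVariation

variable {n : ℕ} {M : Type*} [TopologicalSpace M] [ChartedSpace (Model n) M]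
  {F : ℝ → M → M}

/-- The components of the initial velocity of a family of maps, in all charts. -/
def initialVelocity (F : ℝ → M → M) (c : M) (k : Fin n) (z : Model n) : ℝ :=
  velocity (inChart F c) k (0, z)

theorem mem_chartDomain_zero (h0 : F 0 = id) {c : M} {z : Model n}
    (hz : z ∈ (extChartAt (𝓡 n) c).target) : ((0 : ℝ), z) ∈ chartDomain F c := by
  refine ⟨hz, ?_⟩
  simp only [h0, id]
  exact (extChartAt (𝓡 n) c).map_target hz

variable [IsManifold (𝓡 n) ∞ M]

theorem hasDerivAt_inChart
    (hF : ContMDiff (𝓘(ℝ, ℝ).prod (𝓡 n)) (𝓡 n) ∞ (fun p : ℝ × M ↦ F p.1 p.2)) (h0 : F 0 = id)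
    {c : M} {z : Model n} (hz : z ∈ (extChartAt (𝓡 n) c).target) (k : Fin n) :
    HasDerivAt (fun s ↦ inChart F c (s, z) k) (initialVelocity F c k z) 0 :=
  hasDerivAt_slice ((contDiffAt_component
    (contDiffAt_inChart hF (mem_chartDomain_zero h0 hz)) k).differentiableAt (by simp))

theorem isVectorField_initialVelocity
    (hF : ContMDiff (𝓘(ℝ, ℝ).prod (𝓡 n)) (𝓡 n) ∞ (fun p : ℝ × M ↦ F p.1 p.2)) (h0 : F 0 = id) :
    IsVectorField (n := n) (initialVelocity F) := by
  refine ⟨fun c z hz k ↦ ?_, fun c c' y hy k ↦ ?_⟩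
  · have h1 := contDiffAt_velocity (contDiffAt_inChart hF (mem_chartDomain_zero h0 hz)) k
    have h2 : ContDiffAt ℝ ∞ (fun w : Model n ↦ ((0 : ℝ), w)) z :=
      contDiffAt_const.prodMk contDiffAt_id
    exact ContDiffAt.comp z (f := fun w : Model n ↦ ((0 : ℝ), w)) h1 h2
  · have hyt := (mem_transition_source.mp hy).1
    have hy0 : inChart F c (0, y) = y := by
      simp only [inChart, h0, id]
      exact (extChartAt (𝓡 n) c).right_inv hyt
    have h1 := hasDerivAt_inChart hF h0
      (mem_transition_target.mp ((transition c c').map_source hy)).1 k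
    -- The expressions of the family in the two charts are conjugate under the transition map.
    have h2 : (fun s ↦ inChart F c' (s, transition c c' y) k)
        =ᶠ[nhds 0] fun s ↦ transition c c' (inChart F c (s, y)) k := by
      have hcont : ContinuousAt (fun s : ℝ ↦ (s, y)) 0 := by fun_prop
      filter_upwards [hcont ((isOpen_chartDomain hF c).mem_nhds (mem_chartDomain_zero h0 hyt))]
        with s hs
      simp only [inChart, symm_transition hy]
      rw [transition_apply, (extChartAt (𝓡 n) c).left_inv hs.2]
    have h3 : HasDerivAt (fun s ↦ inChart F c (s, y))
        (WithLp.toLp 2 fun i ↦ initialVelocity F c i y) 0 := by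
      have h6 := hasDerivAt_pi.mpr fun i ↦ hasDerivAt_inChart hF h0 hyt i
      exact (PiLp.continuousLinearEquiv 2 ℝ fun _ : Fin n ↦ ℝ).symm.hasFDerivAt.comp_hasDerivAt
        (0 : ℝ) h6
    have h4 : HasFDerivAt (fun z ↦ transition c c' z k) (fderiv ℝ (fun z ↦ transition c c' z k) y)
        (inChart F c (0, y)) := by
      rw [hy0]
      exact (((EuclideanSpace.proj k : Model n →L[ℝ] ℝ).contDiff.contDiffAt.comp y
        (contDiffAt_transition hy)).differentiableAt (by simp)).hasFDerivAt
    have h5 := h4.comp_hasDerivAt (0 : ℝ) h3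
    rw [fderiv_apply_eq_sum_pd] at h5
    exact (h1.congr_of_eventuallyEq h2.symm).unique h5

/-- The first variation of the energy density at the identity is `tr_g (L_V h)`, where `V` is the
velocity of the variation. -/
theorem deriv_energyDensity (g h : Metric n M)
    (hF : ContMDiff (𝓘(ℝ, ℝ).prod (𝓡 n)) (𝓡 n) ∞ (fun p : ℝ × M ↦ F p.1 p.2)) (h0 : F 0 = id)
    (x : M) : deriv (fun r ↦ energyDensity g h (F r) x) 0
      = traceLie g h (initialVelocity F) x := by
  have hx := mem_extChartAt_source (I := 𝓡 n) x
  have hz := mem_extChartAt_target (I := 𝓡 n) x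
  have hx0 : F 0 x ∈ (extChartAt (𝓡 n) x).source := by
    simp only [h0, id]
    exact hx
  set z := extChartAt (𝓡 n) x x with hzdef
  have hΦ := contDiffAt_inChart hF (mem_chartDomain_zero h0 hz)
  have hid : ∀ᶠ w in nhds z, inChart F x (0, w) = w := by
    filter_upwards [(isOpen_extChartAt_target (I := 𝓡 n) x).mem_nhds hz] with w hw
    simp only [inChart, h0, id]
    exact (extChartAt (𝓡 n) x).right_inv hw
  have h1 := hasDerivAt_pullback hΦ hid ((isMetricOn_gram h x).smooth.entryDiff hz)
  have h2 : HasDerivAt (fun s ↦ localEnergy g h F x (s, z))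
      (traceLie g h (initialVelocity F) x) 0 := by
    simp only [traceLie, trLie, localEnergy, Matrix.trace, Matrix.diag_apply]
    have h3 := fun i j ↦ hasDerivAt_matrix_mul (A := fun _ ↦ (gram g x z)⁻¹) (A' := 0)
      (fun a b ↦ hasDerivAt_const (0 : ℝ) _) h1 i j
    simp only [Matrix.zero_mul, zero_add] at h3
    exact HasDerivAt.fun_sum fun i _ ↦ h3 i i
  refine (h2.congr_of_eventuallyEq ?_).deriv
  have h4 : ContinuousAt (fun r : ℝ ↦ (r, x)) 0 := by fun_prop
  filter_upwards [h4.eventually (eventually_mem_source (p := ((0 : ℝ), x)) hF hx hx0)] with r hr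
  exact energyDensity_family g h hF hr.1 hr.2

theorem traceLie_initialVelocity_eq_zero (g h : Metric n M)
    (hF : ContMDiff (𝓘(ℝ, ℝ).prod (𝓡 n)) (𝓡 n) ∞ (fun p : ℝ × M ↦ F p.1 p.2)) (h0 : F 0 = id)
    {K : Set M} (hK : IsClosed K) (hFK : ∀ s, ∀ x ∉ K, F s x = x) {x : M} (hx : x ∉ K) :
    traceLie g h (initialVelocity F) x = 0 := by
  refine trLie_eq_zero fun k ↦ ?_
  have hc := continuousAt_extChartAt_symm (I := 𝓡 n) x
  have h1 : ∀ᶠ z in nhds (extChartAt (𝓡 n) x x), (extChartAt (𝓡 n) x).symm z ∈ Kᶜ :=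
    hc.eventually (by rw [extChartAt_to_inv]; exact hK.isOpen_compl.mem_nhds hx)
  filter_upwards [h1, (isOpen_extChartAt_target (I := 𝓡 n) x).mem_nhds
    (mem_extChartAt_target (I := 𝓡 n) x)] with z hz hzt
  have h2 := hasDerivAt_inChart hF h0 hzt k
  simp only [inChart, hFK _ _ hz] at h2
  exact h2.unique (hasDerivAt_const _ _)

/-- If `h` is harmonic with respect to `g`, the identity map `(M, g) → (M, h)` is harmonic. -/
theorem isHarmonicMap_id [CompactSpace M] [T2Space M] [MeasurableSpace M] [BorelSpace M]
    {g h : Metric n M} (hd : ∀ c, ∀ y ∈ (extChartAt (𝓡 n) c).target,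
      ∀ j, defect (gram g c) (gram h c) j y = 0) : IsHarmonicMap g h (id : M → M) := by
  refine ⟨contMDiff_id, fun U K hU _ hK hKU F hF h0 hFK ↦ ?_⟩
  have h1 := (hasDerivAt_integral_energyDensity g h hF h0 U).const_mul (1 / 2)
  simp only [deriv_energyDensity g h hF h0] at h1
  rw [setIntegral_eq_integral_of_forall_compl_eq_zero fun x hx ↦
    traceLie_initialVelocity_eq_zero g h hF h0 hK.isClosed hFK fun hxK ↦ hx (hKU hxK),
    integral_traceLie hd (isVectorField_initialVelocity hF h0), mul_zero] at h1
  exact h1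

end FirstVariation

/-! ### Harmonic identity maps -/

section HarmonicMetrics

variable {n : ℕ} {M : Type*} [TopologicalSpace M] [ChartedSpace (Model n) M]
  [IsManifold (𝓡 n) ∞ M] [T2Space M] [CompactSpace M] [MeasurableSpace M] [BorelSpace M]

/-- The condition for the identity map to be harmonic is linear in the target metric and holds for
`g` and `φ`, hence for `g + t φ`, which by compactness is positive definite for small `t`. -/
theorem exists_pos_forall_isHarmonicMap {g : Metric n M} {φ : TwoTensor n M}
    (hφ : φ ∈ harmonicTensors g) : ∃ ε : ℝ, 0 < ε ∧ ∀ t ∈ Set.Ioo (-ε) ε,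
      ∃ gt : Metric n M, (∀ x, gt.inner x = g.inner x + t • φ x) ∧
        IsHarmonicMap g gt (id : M → M) := by
  obtain ⟨C, hC⟩ := exists_forall_abs_le g φ
  have hpos : 0 < |C| + 1 := by positivity
  refine ⟨1 / (2 * (|C| + 1)), by positivity, fun t ht ↦ ?_⟩
  have ht' : |t| * C ≤ 1 / 2 := by
    have h1 : |t| ≤ 1 / (2 * (|C| + 1)) := (abs_lt.mpr ht).le
    calc |t| * C ≤ |t| * (|C| + 1) := by
          gcongr
          linarith [le_abs_self C]
      _ ≤ 1 / (2 * (|C| + 1)) * (|C| + 1) := by gcongr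
      _ = 1 / 2 := by field_simp
  obtain ⟨h, hh⟩ := exists_metric hφ.1 hC ht'
  exact ⟨h, hh, isHarmonicMap_id (isHarmonicTensor_metric hφ hh)⟩

/-- The metrics `g + t φ` with harmonic `φ` for which the identity map is harmonic. -/
def harmonicPencils (g : Metric n M) : Set (TwoTensor n M) :=
  {T ∈ harmonicMetrics g | ∃ φ ∈ harmonicTensors g, ∃ t : ℝ, ∀ x, T x = g.inner x + t • φ x}

/-- A harmonic tensor `φ` is a difference quotient of the metrics `g` and `g + t φ`. -/
theorem harmonicTensors_le_span (g : Metric n M) :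
    harmonicTensors g ≤ Submodule.span ℝ (harmonicPencils g) := by
  intro φ hφ
  obtain ⟨ε, hε, h⟩ := exists_pos_forall_isHarmonicMap hφ
  have key : ∀ t ∈ Set.Ioo (-ε) ε, g.toTensor + t • φ ∈ Submodule.span ℝ (harmonicPencils g) := by
    intro t ht
    obtain ⟨gt, hgt, hharm⟩ := h t ht
    exact Submodule.subset_span ⟨⟨gt, hgt, hharm⟩, φ, hφ, t, fun x ↦ rfl⟩
  have h1 := key 0 ⟨by linarith, hε⟩
  have h2 := key (ε / 2) ⟨by linarith, by linarith⟩
  rw [zero_smul, add_zero] at h1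
  have h3 := Submodule.smul_mem _ (ε / 2)⁻¹ (Submodule.sub_mem _ h2 h1)
  rwa [add_sub_cancel_left, smul_smul, inv_mul_cancel₀ (by positivity), one_smul] at h3

end HarmonicMetrics

end HarmId

end

theorem theorem4 (n : ℕ) (hn : 2 ≤ n) (M : Type*) [TopologicalSpace M]
    [ChartedSpace (HarmId.Model n) M] [IsManifold (𝓡 n) ∞ M]
    [T2Space M] [CompactSpace M] [Nonempty M] [MeasurableSpace M] [BorelSpace M]
    (g : HarmId.Metric n M) :
    (∀ φ ∈ HarmId.harmonicTensors g, ∃ ε : ℝ, 0 < ε ∧ ∀ t ∈ Set.Ioo (-ε) ε,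
      ∃ gt : HarmId.Metric n M, (∀ x, gt.inner x = g.inner x + t • φ x) ∧
        HarmId.IsHarmonicMap g gt (id : M → M)) ∧
    ¬ FiniteDimensional ℝ (HarmId.harmonicTensors g) ∧
    ¬ FiniteDimensional ℝ (Submodule.span ℝ {T ∈ HarmId.harmonicMetrics g |
        ∃ φ ∈ HarmId.harmonicTensors g, ∃ t : ℝ, ∀ x, T x = g.inner x + t • φ x}) := by
  have hloc := fun O hO hne ↦ HarmId.exists_harmonicTensor_supported hn g (O := O) hO hne
  refine ⟨fun φ hφ ↦ HarmId.exists_pos_forall_isHarmonicMap hφ,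
    HarmId.not_finiteDimensional_of_localized hn hloc,
    HarmId.not_finiteDimensional_of_localized hn fun O hO hne ↦ ?_⟩
  obtain ⟨φ, hφ, h⟩ := hloc O hO hne
  exact ⟨φ, HarmId.harmonicTensors_le_span g hφ, h⟩
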